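/- We use the unit-cost word RAM with $w$-bit words. A program is a finite text, independent of $w$ and of the input; it uses a fixed number of registers and of memory banks, each bank being indexed by one word. In one step it loads a constant (modulo $2^w$) into a register, performs a word operation (addition, subtraction and multiplication modulo $2^w$; bitwise and, or, xor; shifts; unsigned comparisons), reads or writes a memory cell whose address is held in a register, or tests whether a register is zero (for a conditional or a loop). Logarithms are to base $2$. For an array $A[1..m']$ of nonnegative integers, $v\ge 0$ and $j\in[0..m']$, the range counting query asks for $\mathrm{rcount}_A(v,j)=|\{i\in[1..j] : A[i]\ge v\}|$; for $v\ge 0$ and $r\in[1..\mathrm{rcount}_A(v,m')]$, the range selection query asks for $\mathrm{rselect}_A(v,r)$, the $r$th smallest element of $\{i\in[1..m'] : A[i]\ge v\}$. **Proposition.** For every constant $C$ there are word RAM programs for preprocessing, for range counting and for range selection, and a constant $K$, such that the following holds for all integers $m\ge 2$ and $0\le m'\le m$, every word size $w$ with $m<2^w$, and every array $A[1..m']$ of nonnegative integers that fit in $w$-bit words and satisfy $\sum_{i=1}^{m'}A[i]\le C\,m\log m$. Given $A$, $m$ and $m'$, with all other registers and memory cells arbitrary, the preprocessing halts after at most $Km$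 steps. With the memory contents it leaves, the counting program computes $\mathrm{rcount}_A(v,j)$ in at most $K(1+\log\log m)$ steps for every $w$-bit word $v\ge 0$ and every $j\in[0..m']$, and the selection program computes $\mathrm{rselect}_A(v,r)$ in at most $K$ steps for every $w$-bit word $v\ge 0$ and every $r\in[1..\mathrm{rcount}_A(v,m')]$. Both query programs leave the memory unchanged, so any number of queries can follow. In other words, the preprocessing takes $O(m)$ time, range counting takes $O(\log\log m)$ time and range selection takes $O(1)$ time. -/

import Mathlib

/-! ## The word RAM

Words have `w` bits.  A program is a finite text that is fixed independently of the word size, of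
the input and of its size.  The machine has registers and a random-access memory; the memory is
made of banks, each indexed by a word, and a bank is named in the program text by a literal, so
that a program uses a fixed number of registers and of banks (an address is one word together
with a constant number of further bits). -/

namespace WordRAM

/-- The unit-cost operations on two words: arithmetic modulo `2 ^ w`, bitwise operations, shifts
by a variable amount, and comparisons of unsigned words (with result `0` or `1`). -/
inductive Op
  | add | sub | mul | band | bor | bxor | shl | shr | lt | eq

/-- The value of an operation on `w`-bit words. -/
def Op.eval {w : ℕ} : Op → BitVec w → BitVec w → BitVec w
  | .add, x, y => x + y
  | .sub, x, y => x - y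
  | .mul, x, y => x * y
  | .band, x, y => x &&& y
  | .bor, x, y => x ||| y
  | .bxor, x, y => x ^^^ y
  | .shl, x, y => x <<< y
  | .shr, x, y => x >>> y
  | .lt, x, y => if x.toNat < y.toNat then 1 else 0
  | .eq, x, y => if x = y then 1 else 0

/-- Word RAM programs.  Registers and memory banks are named by literals. -/
inductive Program
  /-- do nothing -/
  | skip
  /-- `reg dst := n` (modulo `2 ^ w`) -/
  | const (dst n : ℕ)
  /-- `reg dst := o (reg a) (reg b)` -/
  | op (o : Op) (dst a b : ℕ)
  /-- `reg dst := mem bank (reg addr)` -/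
  | load (dst bank addr : ℕ)
  /-- `mem bank (reg addr) := reg src` -/
  | store (bank addr src : ℕ)
  /-- run `p`, then `q` -/
  | seq (p q : Program)
  /-- run `p` if `reg r ≠ 0`, and `q` otherwise -/
  | cond (r : ℕ) (p q : Program)
  /-- as long as `reg r ≠ 0`, run `p` -/
  | loop (r : ℕ) (p : Program)

/-- A state of the machine with `w`-bit words: the contents of the registers and of the memory
(`mem b a` is the word at address `a` of bank `b`). -/
structure State (w : ℕ) where
  reg : ℕ → BitVec w
  mem : ℕ → BitVec w → BitVec w

/-- The state `s` after the word `x` is written into register `r`. -/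
def State.setReg {w : ℕ} (s : State w) (r : ℕ) (x : BitVec w) : State w :=
  { s with reg := Function.update s.reg r x }

/-- The state `s` after the word `x` is written at address `a` of bank `b`. -/
def State.setMem {w : ℕ} (s : State w) (b : ℕ) (a x : BitVec w) : State w :=
  { s with mem := Function.update s.mem b (Function.update (s.mem b) a x) }

/-- `Exec p s t s'`: started in the state `s`, the program `p` halts after exactly `t` steps, in
the state `s'`.  Every instruction and every test of a register takes one step. -/
inductive Exec {w : ℕ} : Program → State w → ℕ → State w → Prop
  | skip (s : State w) : Exec .skip s 1 s
  | const (s : State w) (dst n : ℕ) :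
      Exec (.const dst n) s 1 (s.setReg dst (BitVec.ofNat w n))
  | op (s : State w) (o : Op) (dst a b : ℕ) :
      Exec (.op o dst a b) s 1 (s.setReg dst (o.eval (s.reg a) (s.reg b)))
  | load (s : State w) (dst bank addr : ℕ) :
      Exec (.load dst bank addr) s 1 (s.setReg dst (s.mem bank (s.reg addr)))
  | store (s : State w) (bank addr src : ℕ) :
      Exec (.store bank addr src) s 1 (s.setMem bank (s.reg addr) (s.reg src))
  | seq {p q : Program} {s s₁ s₂ : State w} {t₁ t₂ : ℕ} :
      Exec p s t₁ s₁ → Exec q s₁ t₂ s₂ → Exec (.seq p q) s (t₁ + t₂) s₂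
  | cond_true {r : ℕ} {p q : Program} {s s' : State w} {t : ℕ} :
      s.reg r ≠ 0 → Exec p s t s' → Exec (.cond r p q) s (t + 1) s'
  | cond_false {r : ℕ} {p q : Program} {s s' : State w} {t : ℕ} :
      s.reg r = 0 → Exec q s t s' → Exec (.cond r p q) s (t + 1) s'
  | loop_done {r : ℕ} {p : Program} {s : State w} :
      s.reg r = 0 → Exec (.loop r p) s 1 s
  | loop_step {r : ℕ} {p : Program} {s s₁ s₂ : State w} {t₁ t₂ : ℕ} :
      s.reg r ≠ 0 → Exec p s t₁ s₁ → Exec (.loop r p) s₁ t₂ s₂ →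
      Exec (.loop r p) s (t₁ + t₂ + 1) s₂

end WordRAM

/-! ## Range counting and selection

An array `A[1..n]` is a function `A : ℕ → ℕ` of which only the values at `1, …, n` are used. -/

/-- The range counting query: `|{i ∈ [1..j] : A[i] ≥ v}|`. -/
def rcount (A : ℕ → ℕ) (v j : ℕ) : ℕ :=
  ((Finset.Icc 1 j).filter (fun i => v ≤ A i)).card

/-- The range selection query: the `r`th smallest element of `{i ∈ [1..n] : A[i] ≥ v}`, for
`1 ≤ r ≤ rcount A v n` (`Nat.nth` counts from zero). -/
noncomputable def rselect (A : ℕ → ℕ) (n v r : ℕ) : ℕ :=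
  Nat.nth (fun i => (1 ≤ i ∧ i ≤ n) ∧ v ≤ A i) (r - 1)

/-- The input of the preprocessing: register `0` holds `m`, register `1` holds the length `n` of
the array, and `A[i]` is stored at address `i` of bank `0`, for `i ∈ [1..n]`.  All the other
registers and memory cells are arbitrary. -/
def IsInput {w : ℕ} (s : WordRAM.State w) (m n : ℕ) (A : ℕ → ℕ) : Prop :=
  (s.reg 0).toNat = m ∧ (s.reg 1).toNat = n ∧
    ∀ i : ℕ, 1 ≤ i → i ≤ n → (s.mem 0 (BitVec.ofNat w i)).toNat = A i

/-- With memory contents `M`, the program `query` answers the query with arguments `x`, `y`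
(passed in registers `0` and `1`) by the number `ans` (returned in register `0`) in at most `T`
steps.  The other registers are arbitrary, and the memory is left as it was, so that further
queries can follow. -/
def Answers {w : ℕ} (query : WordRAM.Program) (M : ℕ → BitVec w → BitVec w)
    (x y ans : ℕ) (T : ℝ) : Prop :=
  ∀ s : WordRAM.State w, s.mem = M → (s.reg 0).toNat = x → (s.reg 1).toNat = y →
    ∃ (t : ℕ) (s' : WordRAM.State w), WordRAM.Exec query s t s' ∧ (t : ℝ) ≤ T ∧
      (s'.reg 0).toNat = ans ∧ s'.mem = M

/-! Let `L` be a power of two with `L * 2 ^ L ≤ m < 2 ^ (2 * L) * (2 * L)`. Then `L` is of order log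
m, while tables that give the number of one bits of every `L`-bit word, and the place of each of its
one bits, have at most `m` entries. A bit vector of length `n` is stored as a column of `n / L + 1`
such words. With the rank at the start of each row, any rank takes constant time. For selection, the
nonempty rows are listed, and a second bit vector, indexed by the numbers of the one bits, marks
those that come first in their row. A rank among these marks leads from the number of a one bit to
its row (`cnt_start_of_mem`, `ColInv.select_row`), and the table finishes inside the word.

One column of full length for every threshold would be too much. The sum of the array is at most `E
* m * L` for a constant `E`, so the largest value divided by `L` is O(m), and the set of occurring
values fits in O(m) bit words. Ranks in it replace a value by its class, the number of distinct
smaller values. There are at most `m` classes, and no class exceeds its value, so the bound on the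
sum survives.

The classes are grouped into levels: each class below `L` is a level of its own, and each interval
from `L * 2 ^ k` to `L * 2 ^ (k + 1)` is one level. This makes O(L) levels, so one full-length
column per level costs O(m) words; it shows the elements that are at least the least class of the
level (`lev_le_iff`). For each interval, the elements from `L * 2 ^ k` on form a subsequence, and
this subsequence has one column per class of the level. If it has `n` elements, these columns take
about `n * 2 ^ k` words. An element `x` belongs to the subsequences with `L * 2 ^ k ≤ x`, and these
powers form a geometric sum of at most `2 * x` (`sum_levels`); so the total is O(m). Rounding adds
one row per column, and the widths of the levels add up to at most the number of classes.

Counting takes a rank in the column of the level, which is a prefix length of the subsequence, and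
then a rank there in the column of the class. Selection inverts the two steps in the opposite order.
Both take constant time, so the doubly logarithmic bound for counting is not needed in full.

All columns of a sequence are built together, row by row: the word for threshold `u + 1` is the word
for `u` with the positions of value exactly `u` removed by an exclusive or. With `b` columns this
takes time O((n / L + 1)(L + b + 1)), which is again summable over the levels.

The space is a constant multiple of `m`, and `m` may be close to `2 ^ w`, so one word need not
suffice for an address. The programs are therefore written for a machine with double words and paged
arrays and then translated (`compile_correct`) at the price of a constant factor. -/

set_option linter.unusedSimpArgs false
set_option linter.unusedVariables false

/-! ## A word RAM with double-word registers and paged memory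

Programs are written for a machine whose registers hold numbers below `2 ^ (2 * w)` and whose
memory arrays have `H * 2 ^ w` one-word cells.  Its instructions are exact on natural numbers, with
side conditions that exclude overflow.  `Stmt.compile` translates to the word RAM: a register
becomes a pair of registers, and an array becomes `H` banks. -/

namespace PagedRAM

open WordRAM

/-- The operations of the machine. -/
inductive AOp
  | mov | add | sub | lt | eq | band | bor | bxor | shl | shr | high | low | pair

/-- The value of an operation. -/
def AOp.val (w : ℕ) : AOp → ℕ → ℕ → ℕ
  | .mov, a, _ => a
  | .add, a, b => a + b
  | .sub, a, b => a - b
  | .lt, a, b => if a < b then 1 else 0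
  | .eq, a, b => if a = b then 1 else 0
  | .band, a, b => a &&& b
  | .bor, a, b => a ||| b
  | .bxor, a, b => a ^^^ b
  | .shl, a, b => a * 2 ^ b
  | .shr, a, b => a / 2 ^ b
  | .high, a, _ => a / 2 ^ w
  | .low, a, _ => a % 2 ^ w
  | .pair, a, b => a * 2 ^ w + b

/-- The side condition under which an operation is exact. -/
def AOp.Valid (w : ℕ) : AOp → ℕ → ℕ → Prop
  | .add, a, b => a + b < 2 ^ w * 2 ^ w
  | .band, a, b => a < 2 ^ w ∧ b < 2 ^ w
  | .bor, a, b => a < 2 ^ w ∧ b < 2 ^ w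
  | .bxor, a, b => a < 2 ^ w ∧ b < 2 ^ w
  | .shl, a, b => a < 2 ^ w ∧ b < 2 ^ w ∧ a * 2 ^ b < 2 ^ w
  | .shr, a, b => a < 2 ^ w ∧ b < 2 ^ w
  | .pair, a, b => a < 2 ^ w ∧ b < 2 ^ w
  | _, _, _ => True

/-- Programs of the machine. -/
inductive Stmt
  | skip
  | const (x n : ℕ)
  | op (o : AOp) (x y z : ℕ)
  | load (x a y : ℕ)
  | store (a y z : ℕ)
  | seq (p q : Stmt)
  | ite (r : ℕ) (p q : Stmt)
  | loop (r : ℕ) (p : Stmt)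

/-- States of the machine. -/
structure AState where
  reg : ℕ → ℕ
  mem : ℕ → ℕ → ℕ

/-- Assignment to a register. -/
def AState.set (σ : AState) (x v : ℕ) : AState := { σ with reg := Function.update σ.reg x v }

/-- Assignment to a memory cell. -/
def AState.setMem (σ : AState) (a x v : ℕ) : AState :=
  { σ with mem := Function.update σ.mem a (Function.update (σ.mem a) x v) }

@[simp] theorem AState.set_reg (σ : AState) (x v y : ℕ) :
    (σ.set x v).reg y = if y = x then v else σ.reg y := by
  simp [AState.set, Function.update_apply]

@[simp] theorem AState.set_mem (σ : AState) (x v : ℕ) : (σ.set x v).mem = σ.mem := rfl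

@[simp] theorem AState.setMem_reg (σ : AState) (a x v : ℕ) : (σ.setMem a x v).reg = σ.reg := rfl

theorem AState.setMem_mem (σ : AState) (a x v b y : ℕ) :
    (σ.setMem a x v).mem b y = if b = a ∧ y = x then v else σ.mem b y := by
  by_cases h : b = a
  · subst h; simp [AState.setMem, Function.update_apply]
  · simp [AState.setMem, h]

theorem AState.setMem_mem_of_ne (σ : AState) {a x v b : ℕ} (h : b ≠ a) :
    (σ.setMem a x v).mem b = σ.mem b := by
  simp [AState.setMem, h]

theorem AState.setMem_mem_same (σ : AState) (a x v y : ℕ) :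
    (σ.setMem a x v).mem a y = if y = x then v else σ.mem a y := by
  simp [AState.setMem, Function.update_apply]

/-- Big-step semantics with step counts. -/
inductive Big (w H : ℕ) : Stmt → AState → ℕ → AState → Prop
  | skip (σ) : Big w H .skip σ 1 σ
  | const (σ x n) : n < 2 ^ w → Big w H (.const x n) σ 1 (σ.set x n)
  | op (σ o x y z) : AOp.Valid w o (σ.reg y) (σ.reg z) →
      Big w H (.op o x y z) σ 1 (σ.set x (o.val w (σ.reg y) (σ.reg z)))
  | load (σ x a y) : σ.reg y < H * 2 ^ w →
      Big w H (.load x a y) σ 1 (σ.set x (σ.mem a (σ.reg y)))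
  | store (σ a y z) : σ.reg y < H * 2 ^ w → σ.reg z < 2 ^ w →
      Big w H (.store a y z) σ 1 (σ.setMem a (σ.reg y) (σ.reg z))
  | seq {p q σ σ₁ σ₂ t₁ t₂} : Big w H p σ t₁ σ₁ → Big w H q σ₁ t₂ σ₂ →
      Big w H (.seq p q) σ (t₁ + t₂) σ₂
  | ite_true {r p q σ σ' t} : σ.reg r ≠ 0 → Big w H p σ t σ' → Big w H (.ite r p q) σ (t + 1) σ'
  | ite_false {r p q σ σ' t} : σ.reg r = 0 → Big w H q σ t σ' → Big w H (.ite r p q) σ (t + 1) σ'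
  | loop_done {r p σ} : σ.reg r = 0 → Big w H (.loop r p) σ 1 σ
  | loop_step {r p σ σ₁ σ₂ t₁ t₂} : σ.reg r ≠ 0 → Big w H p σ t₁ σ₁ →
      Big w H (.loop r p) σ₁ t₂ σ₂ → Big w H (.loop r p) σ (t₁ + t₂ + 1) σ₂

/-- The registers written by a program. -/
def Stmt.wr : Stmt → List ℕ
  | .skip => []
  | .const x _ => [x]
  | .op _ x _ _ => [x]
  | .load x _ _ => [x]
  | .store _ _ _ => []
  | .seq p q => p.wr ++ q.wr
  | .ite _ p q => p.wr ++ q.wr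
  | .loop _ p => p.wr

/-- The arrays written by a program. -/
def Stmt.wa : Stmt → List ℕ
  | .store a _ _ => [a]
  | .seq p q => p.wa ++ q.wa
  | .ite _ p q => p.wa ++ q.wa
  | .loop _ p => p.wa
  | _ => []

/-- `σ'` agrees with `σ` except on the given registers and arrays. -/
def Agree (rs as : List ℕ) (σ σ' : AState) : Prop :=
  (∀ r, r ∉ rs → σ'.reg r = σ.reg r) ∧ ∀ a, a ∉ as → σ'.mem a = σ.mem a

theorem Agree.refl (rs as : List ℕ) (σ : AState) : Agree rs as σ σ :=
  ⟨fun _ _ => rfl, fun _ _ => rfl⟩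

theorem Agree.trans {rs as : List ℕ} {σ σ₁ σ₂ : AState} (h : Agree rs as σ σ₁)
    (h' : Agree rs as σ₁ σ₂) : Agree rs as σ σ₂ :=
  ⟨fun r hr => (h'.1 r hr).trans (h.1 r hr), fun r hr => (h'.2 r hr).trans (h.2 r hr)⟩

theorem Agree.mono {rs as rs' as' : List ℕ} {σ σ' : AState} (h : Agree rs as σ σ')
    (hr : rs ⊆ rs') (ha : as ⊆ as') : Agree rs' as' σ σ' :=
  ⟨fun r hr' => h.1 r fun h => hr' (hr h), fun a ha' => h.2 a fun h => ha' (ha h)⟩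

/-- A syntactic frame rule. For concrete programs, membership in the lists of written registers and
arrays is decided by evaluation; this carries all untouched data through the later proofs. -/
theorem Big.agree {w H : ℕ} {p : Stmt} {σ σ' : AState} {t : ℕ} (h : Big w H p σ t σ') :
    Agree p.wr p.wa σ σ' := by
  induction h with
  | skip | loop_done => exact Agree.refl _ _ _
  | const | op | load =>
    refine ⟨fun r hr => ?_, fun a _ => rfl⟩
    simp only [Stmt.wr, List.mem_singleton] at hr
    simp [hr]
  | store =>
    refine ⟨fun r hr => rfl, fun a ha => ?_⟩
    simp only [Stmt.wa, List.mem_singleton] at ha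
    exact AState.setMem_mem_of_ne _ ha
  | seq _ _ h₁ h₂ =>
    exact (h₁.mono (by simp [Stmt.wr]) (by simp [Stmt.wa])).trans
      (h₂.mono (by simp [Stmt.wr]) (by simp [Stmt.wa]))
  | ite_true _ _ h => exact h.mono (by simp [Stmt.wr]) (by simp [Stmt.wa])
  | ite_false _ _ h => exact h.mono (by simp [Stmt.wr]) (by simp [Stmt.wa])
  | loop_step _ _ _ h₁ h₂ => exact Agree.trans h₁ h₂

/-! ### Translation to the word RAM -/

/-- Sequential composition of a list of programs. -/
def seqs : List Program → Program
  | [] => .skip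
  | p :: l => .seq p (seqs l)

/-- Primitive instructions without a store. -/
def isPrim : Program → Bool
  | .const _ _ => true
  | .op _ _ _ _ => true
  | .load _ _ _ => true
  | _ => false

/-- The effect of a primitive instruction. -/
def primStep {w : ℕ} (s : State w) : Program → State w
  | .const dst n => s.setReg dst (BitVec.ofNat w n)
  | .op o dst a b => s.setReg dst (o.eval (s.reg a) (s.reg b))
  | .load dst bank addr => s.setReg dst (s.mem bank (s.reg addr))
  | _ => s

theorem exec_seqs {w : ℕ} (l : List Program) (hl : l.all isPrim = true) (s : State w) :
    Exec (seqs l) s (l.length + 1) (l.foldl primStep s) := by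
  induction l generalizing s with
  | nil => exact Exec.skip s
  | cons p l ih =>
    simp only [List.all_cons, Bool.and_eq_true] at hl
    have h1 : Exec p s 1 (primStep s p) := by
      cases p with
      | const => exact Exec.const _ _ _
      | op => exact Exec.op _ _ _ _ _
      | load => exact Exec.load _ _ _ _
      | _ => simp [isPrim] at hl
    have := Exec.seq h1 (ih hl.2 (primStep s p))
    rw [show (p :: l).length + 1 = 1 + (l.length + 1) by simp; omega]
    exact this

theorem foldl_primStep_mem {w : ℕ} (l : List Program) (s : State w) :
    (l.foldl primStep s).mem = s.mem := by
  induction l generalizing s with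
  | nil => rfl
  | cons p l ih => rw [List.foldl_cons, ih]; cases p <;> rfl

/-- Code for an operation: the two words of the result are left in registers `2` and `3`. -/
def opCode (o : AOp) (ly hy lz hz : ℕ) : List Program :=
  match o with
  | .mov => [.op .bor 2 ly ly, .op .bor 3 hy hy]
  | .add => [.op .add 2 ly lz, .op .lt 4 2 ly, .op .add 3 hy hz, .op .add 3 3 4]
  | .sub => [.op .lt 4 hy hz, .op .eq 5 hy hz, .op .lt 6 ly lz, .op .band 5 5 6, .op .bor 4 4 5,
      .op .sub 2 ly lz, .op .sub 3 hy hz, .op .sub 3 3 6, .const 7 0, .op .eq 7 4 7,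
      .op .mul 2 2 7, .op .mul 3 3 7]
  | .lt => [.op .lt 4 hy hz, .op .eq 5 hy hz, .op .lt 6 ly lz, .op .band 5 5 6, .op .bor 2 4 5,
      .const 3 0]
  | .eq => [.op .eq 4 hy hz, .op .eq 5 ly lz, .op .band 2 4 5, .const 3 0]
  | .band => [.op .band 2 ly lz, .const 3 0]
  | .bor => [.op .bor 2 ly lz, .const 3 0]
  | .bxor => [.op .bxor 2 ly lz, .const 3 0]
  | .shl => [.op .shl 2 ly lz, .const 3 0]
  | .shr => [.op .shr 2 ly lz, .const 3 0]
  | .high => [.op .bor 2 hy hy, .const 3 0]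
  | .low => [.op .bor 2 ly ly, .const 3 0]
  | .pair => [.op .bor 2 lz lz, .op .bor 3 ly ly]

/-- Load into register `5` from one of the banks `b, …, b + k`, selected by register `3`. -/
def loadChain : ℕ → ℕ → Program
  | b, 0 => .load 5 b 2
  | b, k + 1 => .cond 3 (.seq (.op .sub 3 3 4) (loadChain (b + 1) k)) (.load 5 b 2)

/-- Store register `5` to one of the banks `b, …, b + k`, selected by register `3`. -/
def storeChain : ℕ → ℕ → Program
  | b, 0 => .store b 2 5
  | b, k + 1 => .cond 3 (.seq (.op .sub 3 3 4) (storeChain (b + 1) k)) (.store b 2 5)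

/-- The translation; arrays have `H` pages. -/
def Stmt.compile (H : ℕ) : Stmt → Program
  | .skip => .skip
  | .const x n => seqs [.const (2 * x + 10) n, .const (2 * x + 11) 0]
  | .op o x y z => seqs (opCode o (2 * y + 10) (2 * y + 11) (2 * z + 10) (2 * z + 11) ++
      [.op .bor (2 * x + 10) 2 2, .op .bor (2 * x + 11) 3 3])
  | .load x a y => .seq (seqs [.op .bor 2 (2 * y + 10) (2 * y + 10),
      .op .bor 3 (2 * y + 11) (2 * y + 11), .const 4 1])
      (.seq (loadChain (a * H) (H - 1))
        (seqs [.op .bor (2 * x + 10) 5 5, .const (2 * x + 11) 0]))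
  | .store a y z => .seq (seqs [.op .bor 2 (2 * y + 10) (2 * y + 10),
      .op .bor 3 (2 * y + 11) (2 * y + 11), .const 4 1,
      .op .bor 5 (2 * z + 10) (2 * z + 10)]) (storeChain (a * H) (H - 1))
  | .seq p q => .seq (p.compile H) (q.compile H)
  | .ite r p q => .seq (.op .bor 2 (2 * r + 10) (2 * r + 11))
      (.cond 2 (p.compile H) (q.compile H))
  | .loop r p => .seq (.op .bor 2 (2 * r + 10) (2 * r + 11))
      (.loop 2 (.seq (p.compile H) (.op .bor 2 (2 * r + 10) (2 * r + 11))))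

/-- The word RAM state `s` represents `σ`. -/
def Rel {w : ℕ} (H : ℕ) (s : State w) (σ : AState) : Prop :=
  (∀ r, σ.reg r = (s.reg (2 * r + 11)).toNat * 2 ^ w + (s.reg (2 * r + 10)).toNat) ∧
  ∀ a x, x < H * 2 ^ w →
    σ.mem a x = (s.mem (a * H + x / 2 ^ w) (BitVec.ofNat w (x % 2 ^ w))).toNat

theorem setReg_reg {w : ℕ} (s : State w) (r : ℕ) (x : BitVec w) (y : ℕ) :
    (s.setReg r x).reg y = if y = r then x else s.reg y := by
  simp [State.setReg, Function.update_apply]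

/-- The value of an operation on double words. -/
theorem opCode_spec {w : ℕ} (hw : 2 ≤ w) (o : AOp) (y z : ℕ) (s : State w) (a b : ℕ)
    (ha : a = (s.reg (2 * y + 11)).toNat * 2 ^ w + (s.reg (2 * y + 10)).toNat)
    (hb : b = (s.reg (2 * z + 11)).toNat * 2 ^ w + (s.reg (2 * z + 10)).toNat)
    (hv : o.Valid w a b) (s' : State w)
    (hs : s' = (opCode o (2 * y + 10) (2 * y + 11) (2 * z + 10) (2 * z + 11)).foldl primStep s) :
    o.val w a b = (s'.reg 3).toNat * 2 ^ w + (s'.reg 2).toNat ∧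
      ∀ ρ, s'.reg (ρ + 10) = s.reg (ρ + 10) := by
  subst hs
  have hW : 1 < 2 ^ w := Nat.one_lt_two_pow (by omega)
  have h1 : (1 : BitVec w).toNat = 1 := by
    simp [BitVec.toNat_ofNat, Nat.mod_eq_of_lt hW]
  have l1 := (s.reg (2 * y + 10)).isLt
  have l2 := (s.reg (2 * y + 11)).isLt
  have l3 := (s.reg (2 * z + 10)).isLt
  have l4 := (s.reg (2 * z + 11)).isLt
  constructor
  swap
  · intro ρ
    cases o <;> simp [opCode, primStep, setReg_reg]
  generalize hly : s.reg (2 * y + 10) = ly at *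
  generalize hhy : s.reg (2 * y + 11) = hy at *
  generalize hlz : s.reg (2 * z + 10) = lz at *
  generalize hhz : s.reg (2 * z + 11) = hz at *
  have small : ∀ h l : ℕ, h * 2 ^ w + l < 2 ^ w → h = 0 := by
    intro h l hh
    rcases Nat.eq_zero_or_pos h with h0 | h0
    · exact h0
    · nlinarith
  have hlt : a < b ↔ hy.toNat < hz.toNat ∨ (hy.toNat = hz.toNat ∧ ly.toNat < lz.toNat) := by
    subst ha hb
    rcases Nat.lt_trichotomy hy.toNat hz.toNat with h | h | h
    · simp only [h, true_or, iff_true]; nlinarith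
    · simp [h]
    · have : ¬ hy.toNat < hz.toNat := by omega
      have : ¬ hy.toNat = hz.toNat := by omega
      simp only [*, false_and, or_false, iff_false]; nlinarith
  have hw0 : w ≠ 0 := by omega
  have h1' : (1#w).toNat = 1 := h1
  have hif : ∀ (p : Prop) [Decidable p], (if p then 1#w else 0#w).toNat = if p then 1 else 0 := by
    intro p _; split_ifs <;> simp [h1']
  cases o with
  | mov => simp [opCode, primStep, setReg_reg, AOp.val, Op.eval, *]
  | add =>
    simp only [AOp.Valid] at hv
    -- The sum of the low words overflows exactly if its residue is smaller than a summand; that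
    -- comparison is the carry.
    have key : a + b = (hy.toNat + hz.toNat +
        (if (ly.toNat + lz.toNat) % 2 ^ w < ly.toNat then 1 else 0)) % 2 ^ w * 2 ^ w +
        (ly.toNat + lz.toNat) % 2 ^ w := by
      subst ha hb
      generalize 2 ^ w = W at *
      rcases Nat.lt_or_ge (ly.toNat + lz.toNat) W with h | h
      · have h2 : hy.toNat + hz.toNat < W := by nlinarith
        rw [Nat.mod_eq_of_lt h, if_neg (by omega), add_zero, Nat.mod_eq_of_lt h2]; ring
      · have h2 : hy.toNat + hz.toNat + 1 < W := by nlinarith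
        have h3 : (ly.toNat + lz.toNat) % W = ly.toNat + lz.toNat - W := by
          rw [Nat.mod_eq_sub_mod h, Nat.mod_eq_of_lt (by omega)]
        rw [h3, if_pos (by omega), Nat.mod_eq_of_lt h2, add_mul, add_mul, one_mul]
        omega
    simp [opCode, primStep, setReg_reg, AOp.val, Op.eval, hly, hhy, hlz, hhz, hif]
    exact key
  | sub =>
    simp [opCode, primStep, setReg_reg, AOp.val, Op.eval, hly, hhy, hlz, hhz, hif, hw0]
    -- Subtraction is truncated: the code multiplies both words of the result by the indicator of `¬
    -- a < b`.
    have hcond : (hz.toNat ≤ hy.toNat ∧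
        ((if hy = hz then 1#w else 0#w) &&& if ly.toNat < lz.toNat then 1#w else 0#w) = 0#w) ↔
        ¬ a < b := by
      rw [hlt]
      by_cases c1 : hy.toNat < hz.toNat <;> by_cases c2 : hy = hz <;>
        by_cases c3 : ly.toNat < lz.toNat <;>
        simp [c1, c2, c3, hw0, BitVec.toNat_inj, not_lt.mp, not_le.mpr]
    simp only [hcond]
    by_cases hab : a < b
    · simp [hab]; omega
    · simp only [hab, not_false_eq_true, if_true, BitVec.toNat_sub, hif]
      rw [hlt] at hab
      push Not at hab
      subst ha hb
      generalize 2 ^ w = W at *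
      by_cases c3 : ly.toNat < lz.toNat
      · have c4 : hz.toNat < hy.toNat := by
          rcases Nat.lt_or_ge hz.toNat hy.toNat with h | h
          · exact h
          · have := hab.2 (by omega); omega
        simp only [c3, if_true]
        have e1 : (W - lz.toNat + ly.toNat) % W = W - lz.toNat + ly.toNat :=
          Nat.mod_eq_of_lt (by omega)
        have e2 : (W - hz.toNat + hy.toNat) % W = hy.toNat - hz.toNat := by
          rw [Nat.mod_eq_sub_mod (by omega), Nat.mod_eq_of_lt (by omega)]; omega
        have e3 : (W - 1 + (hy.toNat - hz.toNat)) % W = hy.toNat - hz.toNat - 1 := by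
          rw [Nat.mod_eq_sub_mod (by omega), Nat.mod_eq_of_lt (by omega)]; omega
        rw [e1, e2, e3]
        obtain ⟨d, hd⟩ : ∃ d, hy.toNat = hz.toNat + 1 + d := ⟨_, (by omega : _ = hz.toNat + 1 + (hy.toNat - hz.toNat - 1))⟩
        rw [show hy.toNat - hz.toNat - 1 = d by omega, hd, add_mul, add_mul]; omega
      · simp only [c3, if_false]
        have e1 : (W - lz.toNat + ly.toNat) % W = ly.toNat - lz.toNat := by
          rw [Nat.mod_eq_sub_mod (by omega), Nat.mod_eq_of_lt (by omega)]; omega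
        have e2 : (W - hz.toNat + hy.toNat) % W = hy.toNat - hz.toNat := by
          rw [Nat.mod_eq_sub_mod (by omega), Nat.mod_eq_of_lt (by omega)]; omega
        rw [e1, e2]
        obtain ⟨d, hd⟩ : ∃ d, hy.toNat = hz.toNat + d := ⟨_, (by omega : _ = hz.toNat + (hy.toNat - hz.toNat))⟩
        rw [show hy.toNat - hz.toNat = d by omega, hd, add_mul]
        rw [Nat.sub_zero, Nat.add_mod_left, Nat.mod_eq_of_lt (by omega)]
        omega
  | lt =>
    simp [opCode, primStep, setReg_reg, AOp.val, Op.eval, hly, hhy, hlz, hhz, hif, hlt]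
    simp only [← BitVec.toNat_inj]
    by_cases c1 : hy.toNat < hz.toNat <;> by_cases c2 : hy.toNat = hz.toNat <;>
        by_cases c3 : ly.toNat < lz.toNat <;> simp [c1, c2, c3, hw0]
  | eq =>
    have heq : a = b ↔ hy = hz ∧ ly = lz := by
      rw [← BitVec.toNat_inj (x := hy), ← BitVec.toNat_inj (x := ly)]
      constructor
      · intro h
        have d1 : hy.toNat = hz.toNat := by
          have := congrArg (· / 2 ^ w) h
          simpa [ha, hb, mul_comm _ (2 ^ w), Nat.mul_add_div (show 0 < 2 ^ w by omega), Nat.div_eq_of_lt l1,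
            Nat.div_eq_of_lt l3] using this
        exact ⟨d1, by rw [ha, hb, d1] at h; omega⟩
      · rintro ⟨h1, h2⟩; rw [ha, hb, h1, h2]
    simp [opCode, primStep, setReg_reg, AOp.val, Op.eval, hly, hhy, hlz, hhz, hif, heq]
    by_cases c1 : hy = hz <;> by_cases c2 : ly = lz <;> simp [c1, c2]
  | band =>
    have e1 := small _ _ (ha ▸ hv.1)
    have e2 := small _ _ (hb ▸ hv.2)
    simp [opCode, primStep, setReg_reg, AOp.val, Op.eval, *]
  | bor => 
    have e1 := small _ _ (ha ▸ hv.1)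
    have e2 := small _ _ (hb ▸ hv.2)
    simp [opCode, primStep, setReg_reg, AOp.val, Op.eval, *]
  | bxor =>
    have e1 := small _ _ (ha ▸ hv.1)
    have e2 := small _ _ (hb ▸ hv.2)
    simp [opCode, primStep, setReg_reg, AOp.val, Op.eval, *]
  | shl =>
    have e1 := small _ _ (ha ▸ hv.1)
    have e2 := small _ _ (hb ▸ hv.2.1)
    have e3 := hv.2.2
    simp [e1, e2] at ha hb
    subst ha hb
    simp [opCode, primStep, setReg_reg, AOp.val, Op.eval, hly, hlz, Nat.shiftLeft_eq, Nat.mod_eq_of_lt e3]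
  | shr =>
    have e1 := small _ _ (ha ▸ hv.1)
    have e2 := small _ _ (hb ▸ hv.2)
    simp [e1, e2] at ha hb
    subst ha hb
    simp [opCode, primStep, setReg_reg, AOp.val, Op.eval, hly, hlz, Nat.shiftRight_eq_div_pow]
  | high =>
    have : a / 2 ^ w = hy.toNat := by
      rw [ha, mul_comm, Nat.mul_add_div (by omega), Nat.div_eq_of_lt l1, add_zero]
    simp [opCode, primStep, setReg_reg, AOp.val, Op.eval, this, hhy]
  | low =>
    have : a % 2 ^ w = ly.toNat := by
      rw [ha, mul_comm, Nat.mul_add_mod, Nat.mod_eq_of_lt l1]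
    simp [opCode, primStep, setReg_reg, AOp.val, Op.eval, this, hly]
  | pair =>
    have e1 := small _ _ (ha ▸ hv.1)
    have e2 := small _ _ (hb ▸ hv.2)
    simp [opCode, primStep, setReg_reg, AOp.val, Op.eval, *]

/-- Register `x` is represented by the registers `2 * x + 10` and `2 * x + 11`. The registers below
`10` are scratch space of the translation, so nothing is asked of them. -/
theorem Rel.set_of {w H : ℕ} {s s' : State w} {σ : AState} (h : Rel H s σ) (x v : ℕ)
    (hm : s'.mem = s.mem)
    (hx : v = (s'.reg (2 * x + 11)).toNat * 2 ^ w + (s'.reg (2 * x + 10)).toNat)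
    (hr : ∀ ρ, ρ ≠ 2 * x → ρ ≠ 2 * x + 1 → s'.reg (ρ + 10) = s.reg (ρ + 10)) :
    Rel H s' (σ.set x v) := by
  refine ⟨fun r => ?_, fun a y hy => by rw [hm]; exact h.2 a y hy⟩
  rw [AState.set_reg]
  split_ifs with hrx
  · rw [hrx, hx]
  · rw [hr (2 * r) (by omega) (by omega), hr (2 * r + 1) (by omega) (by omega)]
    exact h.1 r

/-- Banks are named by literals, so a page number cannot serve as an address. It is counted down
through nested conditionals instead, at a cost linear in the number of pages, which is constant. -/
theorem loadChain_exec {w : ℕ} (hw : 2 ≤ w) (k b : ℕ) (s : State w) (h4 : s.reg 4 = 1)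
    (hk : (s.reg 3).toNat ≤ k) :
    ∃ t s', Exec (loadChain b k) s t s' ∧ t ≤ 2 * k + 2 ∧
      s'.reg 5 = s.mem (b + (s.reg 3).toNat) (s.reg 2) ∧ s'.mem = s.mem ∧
      ∀ ρ, s'.reg (ρ + 10) = s.reg (ρ + 10) := by
  induction k generalizing b s with
  | zero =>
    refine ⟨_, _, Exec.load _ _ _ _, by omega, ?_, rfl, fun ρ => ?_⟩
    · simp [setReg_reg, show (s.reg 3).toNat = 0 by omega]
    · simp [setReg_reg]
  | succ k ih =>
    by_cases h3 : s.reg 3 = 0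
    · refine ⟨_, _, Exec.cond_false h3 (Exec.load _ _ _ _), by omega, ?_, rfl, fun ρ => ?_⟩
      · simp [setReg_reg, h3]
      · simp [setReg_reg]
    · have h3' : (s.reg 3).toNat ≠ 0 := fun h => h3 (BitVec.eq_of_toNat_eq (by simpa using h))
      have hW : 1 < 2 ^ w := Nat.one_lt_two_pow (by omega)
      have hsub : (s.reg 3 - 1).toNat = (s.reg 3).toNat - 1 := by
        have := (s.reg 3).isLt
        have h1 : (1#w).toNat = 1 := by simp [Nat.mod_eq_of_lt hW]
        rw [BitVec.toNat_sub]
        show (2 ^ w - (1#w).toNat + _) % _ = _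
        rw [h1, Nat.mod_eq_sub_mod (by omega), Nat.mod_eq_of_lt (by omega)]; omega
      obtain ⟨t, s', he, ht, h5, hm, hr⟩ := ih (b + 1) (s.setReg 3 (s.reg 3 - s.reg 4))
        (by simp [setReg_reg, h4]) (by simp only [setReg_reg, if_true, Op.eval, h4]; rw [hsub]; omega)
      refine ⟨_, s', Exec.cond_true h3 (Exec.seq (Exec.op _ _ _ _ _) he), by omega, ?_, hm,
        fun ρ => ?_⟩
      · rw [h5]; simp only [setReg_reg, h4, hsub, if_true]
        rw [show b + 1 + ((s.reg 3).toNat - 1) = b + (s.reg 3).toNat by omega]; rfl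
      · rw [hr]; simp [setReg_reg]

theorem storeChain_exec {w : ℕ} (hw : 2 ≤ w) (k b : ℕ) (s : State w) (h4 : s.reg 4 = 1)
    (hk : (s.reg 3).toNat ≤ k) :
    ∃ t s', Exec (storeChain b k) s t s' ∧ t ≤ 2 * k + 2 ∧
      s'.mem = (s.setMem (b + (s.reg 3).toNat) (s.reg 2) (s.reg 5)).mem ∧
      ∀ ρ, s'.reg (ρ + 10) = s.reg (ρ + 10) := by
  induction k generalizing b s with
  | zero =>
    refine ⟨_, _, Exec.store _ _ _ _, by omega, ?_, fun ρ => rfl⟩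
    simp [show (s.reg 3).toNat = 0 by omega]
  | succ k ih =>
    by_cases h3 : s.reg 3 = 0
    · refine ⟨_, _, Exec.cond_false h3 (Exec.store _ _ _ _), by omega, ?_, fun ρ => rfl⟩
      simp [h3]
    · have h3' : (s.reg 3).toNat ≠ 0 := fun h => h3 (BitVec.eq_of_toNat_eq (by simpa using h))
      have hW : 1 < 2 ^ w := Nat.one_lt_two_pow (by omega)
      have hsub : (s.reg 3 - 1).toNat = (s.reg 3).toNat - 1 := by
        have := (s.reg 3).isLt
        have h1 : (1#w).toNat = 1 := by simp [Nat.mod_eq_of_lt hW]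
        rw [BitVec.toNat_sub]
        show (2 ^ w - (1#w).toNat + _) % _ = _
        rw [h1, Nat.mod_eq_sub_mod (by omega), Nat.mod_eq_of_lt (by omega)]; omega
      obtain ⟨t, s', he, ht, hm, hr⟩ := ih (b + 1) (s.setReg 3 (s.reg 3 - s.reg 4))
        (by simp [setReg_reg, h4]) (by simp only [setReg_reg, if_true, Op.eval, h4]; rw [hsub]; omega)
      refine ⟨_, s', Exec.cond_true h3 (Exec.seq (Exec.op _ _ _ _ _) he), by omega, ?_,
        fun ρ => ?_⟩
      · rw [hm]; simp only [setReg_reg, h4, hsub, if_true]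
        rw [show b + 1 + ((s.reg 3).toNat - 1) = b + (s.reg 3).toNat by omega]; rfl
      · rw [hr]; simp [setReg_reg]

/-- A double word vanishes exactly if the bitwise or of its halves does. -/
theorem exec_test {w H : ℕ} {s : State w} {σ : AState} (h : Rel H s σ) (r : ℕ) :
    ∃ s₁, Exec (.op .bor 2 (2 * r + 10) (2 * r + 11)) s 1 s₁ ∧ Rel H s₁ σ ∧
      (s₁.reg 2 = 0 ↔ σ.reg r = 0) ∧ s₁.mem = s.mem := by
  refine ⟨_, Exec.op _ _ _ _ _, ⟨fun x => ?_, h.2⟩, ?_, rfl⟩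
  · rw [h.1 x]; simp [setReg_reg]
  · rw [h.1 r]
    simp only [setReg_reg, if_true, Op.eval]
    rw [← BitVec.toNat_inj]
    simp [Nat.or_eq_zero_iff]
    tauto

/-- The translation is correct, with a constant overhead. -/
theorem compile_correct {w H : ℕ} (hw : 2 ≤ w) (hH : 1 ≤ H) {p : Stmt} {σ σ' : AState} {t : ℕ}
    (h : Big w H p σ t σ') (s : State w) (hs : Rel H s σ) :
    ∃ t' s', Exec (p.compile H) s t' s' ∧ t' ≤ (30 + 2 * H) * t ∧ Rel H s' σ' ∧
      (p.wa = [] → s'.mem = s.mem) := by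
  have hW : 1 < 2 ^ w := Nat.one_lt_two_pow (by omega)
  have high : ∀ h l : ℕ, l < 2 ^ w → (h * 2 ^ w + l) / 2 ^ w = h := by
    intro h l hl
    rw [mul_comm, Nat.mul_add_div (by omega), Nat.div_eq_of_lt hl, add_zero]
  have low : ∀ h l : ℕ, l < 2 ^ w → (h * 2 ^ w + l) % 2 ^ w = l := by
    intro h l hl
    rw [mul_comm, Nat.mul_add_mod, Nat.mod_eq_of_lt hl]
  induction h generalizing s with
  | skip => exact ⟨_, _, Exec.skip _, by omega, hs, fun _ => rfl⟩
  | const σ x n hn =>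
    refine ⟨_, _, exec_seqs _ (by simp [isPrim]) s, by simp; omega, ?_, fun _ => ?_⟩
    · refine hs.set_of _ _ (foldl_primStep_mem _ _) ?_ ?_
      · simp [primStep, setReg_reg, Nat.mod_eq_of_lt hn]
      · intro ρ h1 h2; simp [primStep, setReg_reg, h1, h2]
    · exact foldl_primStep_mem _ _
  | op σ o x y z hv =>
    have := opCode_spec hw o y z s _ _ (hs.1 y) (hs.1 z) hv _ rfl
    refine ⟨_, _, exec_seqs _ ?_ s, ?_, ?_, fun _ => foldl_primStep_mem _ _⟩
    · cases o <;> simp [isPrim, opCode]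
    · cases o <;> simp [opCode] <;> omega
    · refine hs.set_of _ _ (foldl_primStep_mem _ _) ?_ ?_
      · rw [this.1, List.foldl_append]
        simp [primStep, setReg_reg, Op.eval]
      · intro ρ h1 h2
        rw [← this.2 ρ, List.foldl_append]
        simp [primStep, setReg_reg, h1, h2]
  | load σ x a y hy =>
    have e1 := exec_seqs [.op .bor 2 (2 * y + 10) (2 * y + 10),
      .op .bor 3 (2 * y + 11) (2 * y + 11), .const 4 1] (by simp [isPrim]) s
    have m1 := foldl_primStep_mem [.op .bor 2 (2 * y + 10) (2 * y + 10),
      .op .bor 3 (2 * y + 11) (2 * y + 11), .const 4 1] s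
    generalize hs1 : List.foldl primStep s [.op .bor 2 (2 * y + 10) (2 * y + 10),
      .op .bor 3 (2 * y + 11) (2 * y + 11), .const 4 1] = s1 at e1 m1
    have r2 : s1.reg 2 = s.reg (2 * y + 10) := by
      rw [← hs1]; simp [primStep, setReg_reg, Op.eval]
    have r3 : s1.reg 3 = s.reg (2 * y + 11) := by
      rw [← hs1]; simp [primStep, setReg_reg, Op.eval]
    have r4 : s1.reg 4 = 1 := by
      rw [← hs1]; simp [primStep, setReg_reg, Op.eval]
    have rr : ∀ ρ, s1.reg (ρ + 10) = s.reg (ρ + 10) := by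
      intro ρ; rw [← hs1]; simp [primStep, setReg_reg]
    have ylt := (s.reg (2 * y + 10)).isLt
    have hpage : (s1.reg 3).toNat ≤ H - 1 := by
      rw [hs.1 y] at hy
      have : (s.reg (2 * y + 11)).toNat < H := by
        by_contra hc
        have := Nat.mul_le_mul_right (2 ^ w) (not_lt.mp hc)
        omega
      rw [r3]; omega
    obtain ⟨t2, s2, e2, ht2, r5, m2, rr2⟩ := loadChain_exec hw (H - 1) (a * H) s1 r4 hpage
    have e3 := exec_seqs [.op .bor (2 * x + 10) 5 5, .const (2 * x + 11) 0] (by simp [isPrim]) s2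
    refine ⟨_, _, Exec.seq e1 (Exec.seq e2 e3), ?_, ?_, fun _ => ?_⟩
    · simp; omega
    · refine hs.set_of _ _ ?_ ?_ ?_
      · rw [foldl_primStep_mem, m2, m1]
      · rw [hs.2 _ _ hy, hs.1 y, high _ _ ylt, low _ _ ylt]
        simp [primStep, setReg_reg, Op.eval, r5, r2, r3, m1]
      · intro ρ h1 h2
        rw [← rr ρ, ← rr2 ρ]
        simp [primStep, setReg_reg, h1, h2]
    · rw [foldl_primStep_mem, m2, m1]
  | store σ a y z hy hz =>
    have e1 := exec_seqs [.op .bor 2 (2 * y + 10) (2 * y + 10),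
      .op .bor 3 (2 * y + 11) (2 * y + 11), .const 4 1,
      .op .bor 5 (2 * z + 10) (2 * z + 10)] (by simp [isPrim]) s
    have m1 := foldl_primStep_mem [.op .bor 2 (2 * y + 10) (2 * y + 10),
      .op .bor 3 (2 * y + 11) (2 * y + 11), .const 4 1,
      .op .bor 5 (2 * z + 10) (2 * z + 10)] s
    generalize hs1 : List.foldl primStep s [.op .bor 2 (2 * y + 10) (2 * y + 10),
      .op .bor 3 (2 * y + 11) (2 * y + 11), .const 4 1,
      .op .bor 5 (2 * z + 10) (2 * z + 10)] = s1 at e1 m1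
    have r2 : s1.reg 2 = s.reg (2 * y + 10) := by
      rw [← hs1]; simp [primStep, setReg_reg, Op.eval]
    have r3 : s1.reg 3 = s.reg (2 * y + 11) := by
      rw [← hs1]; simp [primStep, setReg_reg, Op.eval]
    have r4 : s1.reg 4 = 1 := by
      rw [← hs1]; simp [primStep, setReg_reg, Op.eval]
    have r5 : s1.reg 5 = s.reg (2 * z + 10) := by
      rw [← hs1]; simp [primStep, setReg_reg, Op.eval]
    have rr : ∀ ρ, s1.reg (ρ + 10) = s.reg (ρ + 10) := by
      intro ρ; rw [← hs1]; simp [primStep, setReg_reg]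
    have ylt := (s.reg (2 * y + 10)).isLt
    have hpage' : (s.reg (2 * y + 11)).toNat < H := by
      rw [hs.1 y] at hy
      by_contra hc
      have := Nat.mul_le_mul_right (2 ^ w) (not_lt.mp hc)
      omega
    have hpage : (s1.reg 3).toNat ≤ H - 1 := by rw [r3]; omega
    have hzv : σ.reg z = (s.reg (2 * z + 10)).toNat := by
      rw [hs.1 z] at hz ⊢
      have : (s.reg (2 * z + 11)).toNat = 0 := by
        by_contra hc
        have := Nat.mul_le_mul_right (2 ^ w) (Nat.one_le_iff_ne_zero.mpr hc)
        omega
      rw [this]; omega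
    obtain ⟨t2, s2, e2, ht2, m2, rr2⟩ := storeChain_exec hw (H - 1) (a * H) s1 r4 hpage
    refine ⟨_, _, Exec.seq e1 e2, ?_, ⟨fun r => ?_, fun b u hu => ?_⟩, fun h => by simp [Stmt.wa] at h⟩
    · simp; omega
    · rw [AState.setMem_reg, hs.1 r, rr2 (2 * r), rr2 (2 * r + 1), rr, rr]
    · rw [AState.setMem_mem, m2]
      have hu' : u / 2 ^ w < H := Nat.div_lt_of_lt_mul (by rwa [mul_comm] at hu)
      have hul : u % 2 ^ w < 2 ^ w := Nat.mod_lt _ (by omega)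
      have hb := hs.2 b u hu
      simp only [State.setMem, r2, r3, r5, m1, Function.update_apply]
      by_cases hcell : b = a ∧ u = σ.reg y
      · obtain ⟨rfl, rfl⟩ := hcell
        rw [if_pos ⟨rfl, rfl⟩, hs.1 y, high _ _ ylt, low _ _ ylt]
        simp [hzv]
      · rw [if_neg hcell, hb]
        -- Array `a` owns the banks from `a * H` to `a * H + H - 1`, so equal banks force equal
        -- arrays and pages; the low words must then differ.
        by_cases hbank : b * H + u / 2 ^ w = a * H + (s.reg (2 * y + 11)).toNat
        · have hba : b = a := by
            rcases Nat.lt_trichotomy b a with h | h | h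
            · have := Nat.mul_le_mul_right H (show b + 1 ≤ a from h)
              rw [Nat.add_mul, one_mul] at this
              generalize u / 2 ^ w = page at *
              omega
            · exact h
            · have := Nat.mul_le_mul_right H (show a + 1 ≤ b from h)
              rw [Nat.add_mul, one_mul] at this
              generalize u / 2 ^ w = page at *
              omega
          subst hba
          have hne : BitVec.ofNat w (u % 2 ^ w) ≠ s.reg (2 * y + 10) := by
            intro he
            apply hcell
            refine ⟨rfl, ?_⟩
            have he' := congrArg BitVec.toNat he
            rw [BitVec.toNat_ofNat, Nat.mod_mod] at he'
            rw [hs.1 y, ← he', show (s.reg (2 * y + 11)).toNat = u / 2 ^ w by omega]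
            rw [mul_comm]; exact (Nat.div_add_mod u (2 ^ w)).symm
          rw [if_pos hbank, Function.update_of_ne hne, hbank]
        · rw [if_neg hbank]
  | @seq p q σ σ₁ σ₂ t₁ t₂ h₁ h₂ ih₁ ih₂ =>
    obtain ⟨t1, s1, e1, ht1, hr1, hm1⟩ := ih₁ s hs
    obtain ⟨t2, s2, e2, ht2, hr2, hm2⟩ := ih₂ s1 hr1
    refine ⟨_, _, Exec.seq e1 e2, ?_, hr2, fun h => ?_⟩
    · rw [Nat.mul_add]; omega
    · simp only [Stmt.wa, List.append_eq_nil_iff] at h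
      rw [hm2 h.2, hm1 h.1]
  | @ite_true r p q σ σ' t h1 h2 ih =>
    obtain ⟨s1, e1, hr1, hz, hm1⟩ := exec_test hs r
    obtain ⟨t2, s2, e2, ht2, hr2, hm2⟩ := ih s1 hr1
    refine ⟨_, _, Exec.seq e1 (Exec.cond_true (mt hz.1 h1) e2), ?_, hr2, fun h => ?_⟩
    · rw [Nat.mul_add]; omega
    · simp only [Stmt.wa, List.append_eq_nil_iff] at h
      rw [hm2 h.1, hm1]
  | @ite_false r p q σ σ' t h1 h2 ih =>
    obtain ⟨s1, e1, hr1, hz, hm1⟩ := exec_test hs r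
    obtain ⟨t2, s2, e2, ht2, hr2, hm2⟩ := ih s1 hr1
    refine ⟨_, _, Exec.seq e1 (Exec.cond_false (hz.2 h1) e2), ?_, hr2, fun h => ?_⟩
    · rw [Nat.mul_add]; omega
    · simp only [Stmt.wa, List.append_eq_nil_iff] at h
      rw [hm2 h.2, hm1]
  | @loop_done r p σ h1 =>
    obtain ⟨s1, e1, hr1, hz, hm1⟩ := exec_test hs r
    exact ⟨_, _, Exec.seq e1 (Exec.loop_done (hz.2 h1)), by omega, hr1, fun _ => hm1⟩
  | @loop_step r p σ σ₁ σ₂ t₁ t₂ h1 h2 h3 ih₁ ih₂ =>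
    obtain ⟨s1, e1, hr1, hz, hm1⟩ := exec_test hs r
    obtain ⟨t2, s2, e2, ht2, hr2, hm2⟩ := ih₁ s1 hr1
    obtain ⟨t3, s3, e3, ht3, hr3, hm3⟩ := ih₂ s2 hr2
    -- The translated loop begins with a test. In the run of the remaining iterations, this test is
    -- split off and becomes the one at the end of the current iteration.
    cases e3 with
    | seq e3 e4 =>
      refine ⟨_, _, Exec.seq e1 (Exec.loop_step (mt hz.1 h1) (Exec.seq e2 e3) e4), ?_, hr3,
        fun h => ?_⟩
      · rw [Nat.mul_add, Nat.mul_add]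
        rename_i ta tb _ _
        omega
      · rw [hm3 h, hm2 h, hm1]

end PagedRAM

/-! ## Reasoning about programs -/

namespace PagedRAM

/-- Sequential composition of a list of statements. -/
def block : List Stmt → Stmt
  | [] => .skip
  | p :: l => .seq p (block l)

/-- Repeat `body` as many times as register `c` says; register `99` is scratch space. -/
def forN (c : ℕ) (body : Stmt) : Stmt :=
  .loop c (.seq (.const 99 1) (.seq (.op .sub c c 99) body))

/-- An upper bound on the running time of loop-free programs. -/
def Stmt.size : Stmt → ℕ
  | .seq p q => p.size + q.size
  | .ite _ p q => p.size + q.size + 1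
  | _ => 1

/-- `p` halts within `T` steps in a state that satisfies `Q`. -/
def Post (w H : ℕ) (p : Stmt) (σ : AState) (T : ℕ) (Q : AState → Prop) : Prop :=
  ∃ t σ', Big w H p σ t σ' ∧ t ≤ T ∧ Q σ'

/-- Weakest preconditions of loop-free programs. -/
def wp (w H : ℕ) : Stmt → (AState → Prop) → AState → Prop
  | .skip, Q, σ => Q σ
  | .const x n, Q, σ => n < 2 ^ w ∧ Q (σ.set x n)
  | .op o x y z, Q, σ => o.Valid w (σ.reg y) (σ.reg z) ∧
      ∀ v, v = o.val w (σ.reg y) (σ.reg z) → Q (σ.set x v)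
  | .load x a y, Q, σ => σ.reg y < H * 2 ^ w ∧
      ∀ v, v = σ.mem a (σ.reg y) → Q (σ.set x v)
  | .store a y z, Q, σ => σ.reg y < H * 2 ^ w ∧ σ.reg z < 2 ^ w ∧
      Q (σ.setMem a (σ.reg y) (σ.reg z))
  | .seq p q, Q, σ => wp w H p (wp w H q Q) σ
  | .ite r p q, Q, σ => (σ.reg r ≠ 0 → wp w H p Q σ) ∧ (σ.reg r = 0 → wp w H q Q σ)
  | .loop _ _, _, _ => False

variable {w H : ℕ}

theorem Post.mono {p : Stmt} {σ : AState} {T T' : ℕ} {Q Q' : AState → Prop}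
    (h : Post w H p σ T Q) (hT : T ≤ T') (hQ : ∀ σ', Q σ' → Q' σ') : Post w H p σ T' Q' := by
  obtain ⟨t, σ', h1, h2, h3⟩ := h
  exact ⟨t, σ', h1, h2.trans hT, hQ _ h3⟩

theorem Post.with_agree {p : Stmt} {σ : AState} {T : ℕ} {Q : AState → Prop}
    (h : Post w H p σ T Q) : Post w H p σ T (fun σ' => Q σ' ∧ Agree p.wr p.wa σ σ') := by
  obtain ⟨t, σ', h1, h2, h3⟩ := h
  exact ⟨t, σ', h1, h2, h3, h1.agree⟩

theorem Post.seq {p q : Stmt} {σ : AState} {T₁ T₂ : ℕ} {Q₁ Q : AState → Prop}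
    (h₁ : Post w H p σ T₁ Q₁)
    (h₂ : ∀ σ', Q₁ σ' → Agree p.wr p.wa σ σ' → Post w H q σ' T₂ Q) :
    Post w H (.seq p q) σ (T₁ + T₂) Q := by
  obtain ⟨t, σ', h1, h2, h3⟩ := h₁
  obtain ⟨t', σ'', h1', h2', h3'⟩ := h₂ σ' h3 h1.agree
  exact ⟨_, _, h1.seq h1', by omega, h3'⟩

/-- Without loops every instruction runs at most once, so the size of the text bounds the time. -/
theorem Post.of_wp {p : Stmt} {σ : AState} {Q : AState → Prop} (h : wp w H p Q σ) :
    Post w H p σ p.size Q := by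
  induction p generalizing σ Q with
  | skip => exact ⟨1, σ, Big.skip σ, le_rfl, h⟩
  | const x n => exact ⟨1, _, Big.const σ x n h.1, le_rfl, h.2⟩
  | op o x y z => exact ⟨1, _, Big.op σ o x y z h.1, le_rfl, h.2 _ rfl⟩
  | load x a y => exact ⟨1, _, Big.load σ x a y h.1, le_rfl, h.2 _ rfl⟩
  | store a y z => exact ⟨1, _, Big.store σ a y z h.1 h.2.1, le_rfl, h.2.2⟩
  | seq p q ihp ihq => exact Post.seq (ihp h) fun σ' h' _ => ihq h'
  | ite r p q ihp ihq =>
    by_cases hr : σ.reg r = 0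
    · obtain ⟨t, σ', h1, h2, h3⟩ := ihq (h.2 hr)
      exact ⟨_, _, Big.ite_false hr h1, by simp only [Stmt.size]; omega, h3⟩
    · obtain ⟨t, σ', h1, h2, h3⟩ := ihp (h.1 hr)
      exact ⟨_, _, Big.ite_true hr h1, by simp only [Stmt.size]; omega, h3⟩
  | loop => exact h.elim

theorem Post.wp {p : Stmt} {σ : AState} {T : ℕ} {Q : AState → Prop} (hT : p.size ≤ T)
    (h : wp w H p Q σ) : Post w H p σ T Q :=
  (Post.of_wp h).mono hT fun _ h => h

theorem Post.ite {r : ℕ} {p q : Stmt} {σ : AState} {T : ℕ} {Q : AState → Prop}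
    (h1 : σ.reg r ≠ 0 → Post w H p σ T Q) (h2 : σ.reg r = 0 → Post w H q σ T Q) :
    Post w H (.ite r p q) σ (T + 1) Q := by
  by_cases hr : σ.reg r = 0
  · obtain ⟨t, σ', h1, h2, h3⟩ := h2 hr
    exact ⟨_, _, Big.ite_false hr h1, by omega, h3⟩
  · obtain ⟨t, σ', h1, h2, h3⟩ := h1 hr
    exact ⟨_, _, Big.ite_true hr h1, by omega, h3⟩

/-- The `3` pays for the test, the constant and the decrement, and the final `1` for the failing
test. The budget varies with the iteration because the levels differ widely in cost. Each step may
use that nothing outside the written registers and arrays has changed since the start. -/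
theorem Post.forN_sum {c : ℕ} {body : Stmt} {σ : AState} (n : ℕ) (T : ℕ → ℕ)
    (I : ℕ → AState → Prop) (hw : 2 ≤ w) (hc : c ∉ 99 :: body.wr) (hn : σ.reg c = n) (h0 : I 0 σ)
    (step : ∀ i < n, ∀ σ', Agree (99 :: c :: body.wr) body.wa σ σ' → I i σ' →
      Post w H body ((σ'.set 99 1).set c (n - 1 - i)) (T i) (I (i + 1))) :
    Post w H (forN c body) σ ((∑ i ∈ Finset.range n, (T i + 3)) + 1) (I n) := by
  have hc99 : c ≠ 99 := by rintro rfl; simp at hc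
  have hcb : c ∉ body.wr := fun h => hc (by simp [h])
  have hW : 1 < 2 ^ w := Nat.one_lt_two_pow (by omega)
  suffices H' : ∀ k i σ', k + i = n → σ'.reg c = k → Agree (99 :: c :: body.wr) body.wa σ σ' →
      I i σ' → ∃ t σ'', Big w H (forN c body) σ' t σ'' ∧
        t ≤ (∑ j ∈ Finset.range k, (T (i + j) + 3)) + 1 ∧ I n σ'' by
    obtain ⟨t, σ', h1, h2, h3⟩ := H' n 0 σ rfl hn (Agree.refl _ _ _) h0
    exact ⟨t, σ', h1, by simpa using h2, h3⟩
  intro k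
  induction k with
  | zero =>
    intro i σ' hki hk hag hI
    exact ⟨1, σ', Big.loop_done hk, by simp, by rw [← hki, zero_add]; exact hI⟩
  | succ k ih =>
    intro i σ' hki hk hag hI
    obtain ⟨t, σ₁, h1, h2, h3⟩ := step i (by omega) σ' hag hI
    have e1 : Big w H (.const 99 1) σ' 1 (σ'.set 99 1) := Big.const _ _ _ hW
    have e2 := Big.op (w := w) (H := H) (σ'.set 99 1) .sub c c 99 trivial
    have hv : AOp.val w .sub ((σ'.set 99 1).reg c) ((σ'.set 99 1).reg 99) = n - 1 - i := by
      simp [AOp.val, hc99, hk]; omega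
    rw [hv] at e2
    have hag' : Agree (99 :: c :: body.wr) body.wa σ σ₁ := by
      refine hag.trans (Agree.trans (σ₁ := (σ'.set 99 1).set c (n - 1 - i)) ?_
        (h1.agree.mono (by intro; simp; tauto) (by simp)))
      refine ⟨fun r hr => ?_, fun _ _ => rfl⟩
      simp only [List.mem_cons, not_or] at hr
      simp [hr.1, hr.2.1]
    obtain ⟨t', σ₂, g1, g2, g3⟩ := ih (i + 1) σ₁ (by omega)
      (by rw [h1.agree.1 c hcb]; simp; omega) hag' h3
    refine ⟨_, σ₂, Big.loop_step (by omega) (e1.seq (e2.seq h1)) g1, ?_, g3⟩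
    rw [Finset.sum_range_succ']
    simp only [add_zero]
    have : ∑ j ∈ Finset.range k, (T (i + 1 + j) + 3) = ∑ j ∈ Finset.range k, (T (i + (j + 1)) + 3) :=
      Finset.sum_congr rfl fun j _ => by rw [show i + 1 + j = i + (j + 1) by omega]
    omega

theorem Post.forN {c : ℕ} {body : Stmt} {σ : AState} (n B : ℕ)
    (I : ℕ → AState → Prop) (hw : 2 ≤ w) (hc : c ∉ 99 :: body.wr) (hn : σ.reg c = n) (h0 : I 0 σ)
    (step : ∀ i < n, ∀ σ', Agree (99 :: c :: body.wr) body.wa σ σ' → I i σ' →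
      Post w H body ((σ'.set 99 1).set c (n - 1 - i)) B (I (i + 1))) :
    Post w H (forN c body) σ (n * (B + 3) + 1) (I n) := by
  simpa using Post.forN_sum n (fun _ => B) I hw hc hn h0 step

end PagedRAM

/-! ## Counting, bit words and rank structures -/

namespace PagedRAM

open Classical in
/-- The number of `i < n` with `P i`. -/
noncomputable def cnt (P : ℕ → Prop) (n : ℕ) : ℕ := Nat.count P n

/-! ### Counting below a bound, and one bits of a word -/

section cnt

variable {P Q : ℕ → Prop} {m n i j r : ℕ}

@[simp] theorem cnt_zero (P : ℕ → Prop) : cnt P 0 = 0 := by simp [cnt]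

theorem cnt_succ_pos (h : P n) : cnt P (n + 1) = cnt P n + 1 := by
  classical
  simp [cnt, Nat.count_succ, h]

theorem cnt_succ_neg (h : ¬ P n) : cnt P (n + 1) = cnt P n := by
  classical
  simp [cnt, Nat.count_succ, h]

theorem cnt_mono (h : m ≤ n) : cnt P m ≤ cnt P n := by
  classical
  exact Nat.count_monotone P h

theorem cnt_le : cnt P n ≤ n := by
  classical
  exact Nat.count_le _

theorem cnt_add (P : ℕ → Prop) (m n : ℕ) :
    cnt P (m + n) = cnt P m + cnt (fun k => P (m + k)) n := by
  classical
  exact Nat.count_add P m n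

theorem cnt_congr (h : ∀ i < n, P i ↔ Q i) : cnt P n = cnt Q n := by
  induction n with
  | zero => simp
  | succ n ih =>
    have ih := ih fun i hi => h i (by omega)
    by_cases hn : P n
    · rw [cnt_succ_pos hn, cnt_succ_pos ((h n (by omega)).1 hn), ih]
    · rw [cnt_succ_neg hn, cnt_succ_neg (fun hq => hn ((h n (by omega)).2 hq)), ih]

theorem cnt_eq_zero (h : ∀ i < n, ¬ P i) : cnt P n = 0 := by
  induction n with
  | zero => simp
  | succ n ih => rw [cnt_succ_neg (h n (by omega)), ih fun i hi => h i (by omega)]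

theorem cnt_eq_of_le (hmn : m ≤ n) (h : ∀ i, m ≤ i → i < n → ¬ P i) : cnt P n = cnt P m := by
  obtain ⟨k, rfl⟩ := Nat.exists_eq_add_of_le hmn
  have h0 : cnt (fun i => P (m + i)) k = 0 := cnt_eq_zero fun i hi => h _ (by omega) (by omega)
  rw [cnt_add, h0, add_zero]

theorem cnt_lt_cnt (h : P i) (hij : i < j) : cnt P i < cnt P j := by
  have := cnt_mono (P := P) (show i + 1 ≤ j from hij)
  rw [cnt_succ_pos h] at this
  omega

theorem exists_of_lt_cnt (h : r < cnt P n) : ∃ i < n, P i ∧ cnt P i = r := by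
  induction n with
  | zero => simp at h
  | succ n ih =>
    by_cases hr : r < cnt P n
    · obtain ⟨i, hi, h1⟩ := ih hr
      exact ⟨i, by omega, h1⟩
    · by_cases hn : P n
      · rw [cnt_succ_pos hn] at h
        exact ⟨n, by omega, hn, by omega⟩
      · rw [cnt_succ_neg hn] at h; omega

/-- The number of one bits among the lowest `L` bits. -/
noncomputable def pc (L y : ℕ) : ℕ := cnt (fun i => y.testBit i = true) L

theorem pc_zero (L : ℕ) : pc L 0 = 0 := cnt_eq_zero (by simp)

/-- Place `0` is split off and the others move down by one. Place `L` of `y` is empty, so counting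
`L + 1` places changes nothing. This recurrence fills the table of one bit numbers. -/
theorem pc_half {L y : ℕ} (hy : y < 2 ^ L) : pc L y = pc L (y / 2) + y % 2 := by
  have h1 : cnt (fun i => y.testBit i = true) (L + 1) = pc L y :=
    cnt_succ_neg (by simp [Nat.testBit_lt_two_pow hy])
  rw [← h1, add_comm L 1, cnt_add]
  have : cnt (fun k => y.testBit (1 + k) = true) L = pc L (y / 2) :=
    cnt_congr fun i _ => by rw [add_comm, Nat.testBit_succ]
  rw [this, add_comm]
  congr 1
  rcases Nat.mod_two_eq_zero_or_one y with h | h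
  · rw [show (1:ℕ) = 0 + 1 from rfl, cnt_succ_neg (by simp [Nat.testBit_zero, h]), cnt_zero, h]
  · rw [show (1:ℕ) = 0 + 1 from rfl, cnt_succ_pos (by simp [Nat.testBit_zero, h]), cnt_zero, h]

/-- Reduction modulo `2 ^ i` erases the places from `i` on; hence a rank inside a word is a mask and
one table lookup. -/
theorem pc_mod {L y i : ℕ} (hi : i ≤ L) :
    pc L (y % 2 ^ i) = cnt (fun k => y.testBit k = true) i := by
  unfold pc
  rw [cnt_eq_of_le hi]
  · exact cnt_congr fun k hk => by simp [Nat.testBit_mod_two_pow, hk]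
  · intro k hk _; simp [Nat.testBit_mod_two_pow, not_lt.mpr hk]

theorem pc_le {L y : ℕ} : pc L y ≤ L := cnt_le

end cnt

theorem Nat.and_mask (y i : ℕ) : y &&& (1 * 2 ^ i - 1) = y % 2 ^ i := by
  rw [one_mul]; exact Nat.and_two_pow_sub_one_eq_mod y i

/-- The `L`-bit word `y` holds the bits `P (q * L), …, P (q * L + L - 1)`. -/
def IsBW (L : ℕ) (P : ℕ → Prop) (q y : ℕ) : Prop :=
  y < 2 ^ L ∧ ∀ i < L, (y.testBit i = true ↔ P (q * L + i))

/-! ### Operations on bit words -/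

section IsBW

variable {L q y : ℕ} {P Q : ℕ → Prop}

theorem IsBW.congr (h : IsBW L P q y) (hPQ : ∀ i < L, P (q * L + i) ↔ Q (q * L + i)) :
    IsBW L Q q y := ⟨h.1, fun i hi => (h.2 i hi).trans (hPQ i hi)⟩

theorem IsBW.zero (h : ∀ i < L, ¬ P (q * L + i)) : IsBW L P q 0 :=
  ⟨by positivity, fun i hi => by simp [h i hi]⟩

theorem IsBW.eq_zero_iff (h : IsBW L P q y) : y = 0 ↔ ∀ i < L, ¬ P (q * L + i) := by
  constructor
  · rintro rfl i hi hp
    have := (h.2 i hi).2 hp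
    simp at this
  · intro hz
    apply Nat.eq_of_testBit_eq
    intro i
    rw [Nat.zero_testBit]
    by_cases hi : i < L
    · have := mt (h.2 i hi).1 (hz i hi); simpa using this
    · exact Nat.testBit_lt_two_pow (h.1.trans_le (Nat.pow_le_pow_right (by norm_num) (by omega)))

theorem IsBW.set (h : IsBW L P q y) {i : ℕ} (hi : i < L)
    (hQ : ∀ k < L, Q (q * L + k) ↔ P (q * L + k) ∨ k = i) : IsBW L Q q (y ||| 1 * 2 ^ i) := by
  rw [one_mul]
  refine ⟨Nat.or_lt_two_pow h.1 (Nat.pow_lt_pow_right (by norm_num) hi), fun k hk => ?_⟩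
  rw [Nat.testBit_or, Nat.testBit_two_pow, hQ k hk, Bool.or_eq_true, h.2 k hk]
  simp [eq_comm]

/-- For `Q` contained in `P`, exclusive or is set difference. This passes from one threshold to the
next. -/
theorem IsBW.xor {R : ℕ → Prop} {z : ℕ} (h : IsBW L P q y) (h' : IsBW L Q q z)
    (hR : ∀ k < L, R (q * L + k) ↔ (P (q * L + k) ∧ ¬ Q (q * L + k)))
    (hQP : ∀ k < L, Q (q * L + k) → P (q * L + k)) : IsBW L R q (y ^^^ z) := by
  refine ⟨Nat.xor_lt_two_pow h.1 h'.1, fun k hk => ?_⟩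
  have h1 := h.2 k hk
  have h2 := h'.2 k hk
  have h3 := hQP k hk
  rw [Nat.testBit_xor, hR k hk, ← h1, ← h2]
  rw [← h1, ← h2] at h3
  cases hy : y.testBit k <;> cases hz : z.testBit k <;> simp_all

theorem IsBW.pc_eq (h : IsBW L P q y) : cnt P ((q + 1) * L) = cnt P (q * L) + pc L y := by
  rw [add_mul, one_mul, cnt_add]
  congr 1
  exact cnt_congr fun i hi => (h.2 i hi).symm

theorem IsBW.cnt_bits (h : IsBW L P q y) {i : ℕ} (hi : i ≤ L) :
    cnt P (q * L + i) = cnt P (q * L) + cnt (fun k => y.testBit k = true) i := by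
  rw [cnt_add]
  congr 1
  exact cnt_congr fun k hk => (h.2 k (by omega)).symm

theorem IsBW.rank (h : IsBW L P q y) {i : ℕ} (hi : i ≤ L) :
    cnt P (q * L + i) = cnt P (q * L) + pc L (y % 2 ^ i) := by
  rw [pc_mod hi, h.cnt_bits hi]

end IsBW

/-! ### Rows with a bit, and the bits that start them -/

/-- Row `q` is nonempty. -/
def NER (L : ℕ) (P : ℕ → Prop) (q : ℕ) : Prop := ∃ i < L, P (q * L + i)

/-- The one bit number `r` is the first one of its row. -/
def Start (L : ℕ) (P : ℕ → Prop) (r : ℕ) : Prop := ∃ q, NER L P q ∧ cnt P (q * L) = r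

section Start

variable {L q r : ℕ} {P : ℕ → Prop}

theorem NER.cnt_lt (h : NER L P q) : cnt P (q * L) < cnt P ((q + 1) * L) := by
  obtain ⟨i, hi, hp⟩ := h
  calc cnt P (q * L) ≤ cnt P (q * L + i) := cnt_mono (by omega)
    _ < cnt P ((q + 1) * L) := cnt_lt_cnt hp (by rw [add_mul]; omega)

theorem cnt_row_of_not_NER (h : ¬ NER L P q) : cnt P ((q + 1) * L) = cnt P (q * L) := by
  apply cnt_eq_of_le (Nat.mul_le_mul_right _ (by omega))
  intro i h1 h2 hp
  exact h ⟨i - q * L, by rw [add_mul] at h2; omega, by rwa [Nat.add_sub_cancel' h1]⟩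

/-- The numbers of the one bits in row `q` fill the interval between the two counts. These intervals
are disjoint, and each nonempty one contains a single start, its left end. -/
theorem start_iff (h1 : cnt P (q * L) ≤ r) (h2 : r < cnt P ((q + 1) * L)) :
    Start L P r ↔ r = cnt P (q * L) := by
  constructor
  · rintro ⟨q', hn, rfl⟩
    rcases Nat.lt_trichotomy q' q with h | rfl | h
    · have := hn.cnt_lt
      have := cnt_mono (P := P) (Nat.mul_le_mul_right L (show q' + 1 ≤ q from h))
      omega
    · rfl
    · have := cnt_mono (P := P) (Nat.mul_le_mul_right L (show q + 1 ≤ q' from h))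
      omega
  · rintro rfl
    refine ⟨q, ?_, rfl⟩
    by_contra hn
    rw [cnt_row_of_not_NER hn] at h2
    omega

/-- Each nonempty row contributes exactly one start, so starts up to the beginning of a row count
the nonempty rows above it. -/
theorem cnt_start (L : ℕ) (P : ℕ → Prop) (q : ℕ) :
    cnt (Start L P) (cnt P (q * L)) = cnt (NER L P) q := by
  induction q with
  | zero => simp
  | succ q ih =>
    by_cases hn : NER L P q
    · have hlt := hn.cnt_lt
      rw [cnt_succ_pos hn, ← ih, ← cnt_succ_pos ((start_iff le_rfl hlt).2 rfl)]
      refine cnt_eq_of_le hlt fun r h1 h2 hs => ?_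
      have := (start_iff (by omega) h2).1 hs
      omega
    · rw [cnt_row_of_not_NER hn, cnt_succ_neg hn, ih]

/-- Beyond the first one bit of row `q`, and up to its last, the number of starts seen stays
constant. It identifies the row among the nonempty ones. -/
theorem cnt_start_of_mem (h1 : cnt P (q * L) < r) (h2 : r ≤ cnt P ((q + 1) * L)) :
    cnt (Start L P) r = cnt (NER L P) q + 1 := by
  rw [← cnt_start]
  have hlt : cnt P (q * L) < cnt P ((q + 1) * L) := by omega
  rw [← cnt_succ_pos ((start_iff le_rfl hlt).2 rfl)]
  refine cnt_eq_of_le h1 fun i h3 h4 hs => ?_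
  have := (start_iff (q := q) (by omega) (by omega)).1 hs
  omega

end Start

/-- The state of the five arrays of a column for the predicate `P`, stored from address `base`,
when the rows below `q` have been written. -/
structure ColInv (L : ℕ) (P : ℕ → Prop) (base q : ℕ) (W R NE UM UB : ℕ → ℕ) : Prop where
  word : ∀ k < q, IsBW L P k (W (base + k))
  rank : ∀ k < q, R (base + k) = cnt P (k * L)
  row : ∀ k < q, NER L P k → NE (base + cnt (NER L P) k) = k
  mark : ∀ t ≤ cnt P (q * L) / L,
    IsBW L (fun r => Start L P r ∧ r < cnt P (q * L)) t (UM (base + t))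
  markRank : ∀ t ≤ cnt P (q * L) / L, UB (base + t) = cnt (Start L P) (t * L)

/-! ### Extending a column by one row -/

section ColInv

variable {L base q : ℕ} {P : ℕ → Prop} {W R NE UM UB W' R' NE' UM' UB' : ℕ → ℕ}

/-- The mark word that contains the next free number is required to be valid in advance. So even the
empty column needs its first mark word and mark rank cleared, as memory is arbitrary. -/
theorem ColInv.init (hM : UM base = 0) (hB : UB base = 0) : ColInv L P base 0 W R NE UM UB where
  word := by simp
  rank := by simp
  row := by simp
  mark := by
    intro t ht
    simp at ht
    subst ht
    rw [add_zero, hM]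
    exact IsBW.zero (by simp)
  markRank := by
    intro t ht
    simp at ht
    subst ht
    simp [hB]

/-- Since `P` lives below `n`, both the rows and the mark words in use have numbers at most `n / L`.
Nothing outside these addresses matters. -/
theorem ColInv.congr (h : ColInv L P base q W R NE UM UB) {n : ℕ} (hq : q * L ≤ n + L)
    (hL : 0 < L) (hP : ∀ p, P p → p < n)
    (hW : ∀ k ≤ n / L, W' (base + k) = W (base + k))
    (hR : ∀ k ≤ n / L, R' (base + k) = R (base + k))
    (hNE : ∀ k ≤ n / L, NE' (base + k) = NE (base + k))
    (hUM : ∀ k ≤ n / L, UM' (base + k) = UM (base + k))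
    (hUB : ∀ k ≤ n / L, UB' (base + k) = UB (base + k)) :
    ColInv L P base q W' R' NE' UM' UB' := by
  have hk : ∀ k < q, k ≤ n / L := by
    intro k hk
    rw [Nat.le_div_iff_mul_le hL]
    have := Nat.mul_le_mul_right L (show k + 1 ≤ q from hk)
    rw [add_mul] at this
    omega
  have hc : cnt P (q * L) / L ≤ n / L := by
    apply Nat.div_le_div_right
    rcases Nat.le_total (q * L) n with h | h
    · exact cnt_le.trans h
    · rw [cnt_eq_of_le h fun i h1 _ hp => absurd (hP i hp) (by omega)]; exact cnt_le
  refine ⟨fun k h1 => ?_, fun k h1 => ?_, fun k h1 h2 => ?_, fun t ht => ?_, fun t ht => ?_⟩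
  · rw [hW k (hk k h1)]; exact h.word k h1
  · rw [hR k (hk k h1)]; exact h.rank k h1
  · rw [hNE _ (cnt_le.trans (hk k h1))]; exact h.row k h1 h2
  · rw [hUM t (ht.trans hc)]; exact h.mark t ht
  · rw [hUB t (ht.trans hc)]; exact h.markRank t ht

theorem ColInv.step_empty (h : ColInv L P base q W R NE UM UB) {cur : ℕ} (hcur : IsBW L P q cur)
    (h0 : cur = 0) (hW : ∀ x, W' x = if x = base + q then cur else W x)
    (hR : ∀ x, R' x = if x = base + q then cnt P (q * L) else R x) :
    ColInv L P base (q + 1) W' R' NE UM UB := by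
  have hn : ¬ NER L P q := by
    rintro ⟨i, hi, hp⟩; exact hcur.eq_zero_iff.1 h0 i hi hp
  refine ⟨fun k hk => ?_, fun k hk => ?_, fun k hk hk' => ?_, ?_, ?_⟩
  · rw [hW]
    rcases Nat.lt_succ_iff_lt_or_eq.1 hk with hk | rfl
    · rw [if_neg (by omega)]; exact h.word k hk
    · rw [if_pos rfl]; exact hcur
  · rw [hR]
    rcases Nat.lt_succ_iff_lt_or_eq.1 hk with hk | rfl
    · rw [if_neg (by omega)]; exact h.rank k hk
    · rw [if_pos rfl]
  · rcases Nat.lt_succ_iff_lt_or_eq.1 hk with hk | rfl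
    · exact h.row k hk hk'
    · exact absurd hk' hn
  · rw [cnt_row_of_not_NER hn]; exact h.mark
  · rw [cnt_row_of_not_NER hn]; exact h.markRank

/-- A nonempty row adds between one and `L` one bits, so the mark vector advances by at most one
word. The only new start is the number `cnt P (q * L)`. If a new mark word is entered, it is still
empty, and all starts up to and including that of row `q` lie before it. -/
theorem ColInv.step (hL : 0 < L) (h : ColInv L P base q W R NE UM UB) {cur : ℕ}
    (hcur : IsBW L P q cur) (h0 : cur ≠ 0)
    (hW : ∀ x, W' x = if x = base + q then cur else W x)
    (hR : ∀ x, R' x = if x = base + q then cnt P (q * L) else R x)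
    (hNE : ∀ x, NE' x = if x = base + cnt (NER L P) q then q else NE x)
    (hUM : ∀ x, UM' x = if x = base + cnt P ((q + 1) * L) / L ∧
        cnt P ((q + 1) * L) / L ≠ cnt P (q * L) / L then 0
      else if x = base + cnt P (q * L) / L then
        UM (base + cnt P (q * L) / L) ||| 1 * 2 ^ (cnt P (q * L) % L) else UM x)
    (hUB : ∀ x, UB' x = if x = base + cnt P ((q + 1) * L) / L ∧
        cnt P ((q + 1) * L) / L ≠ cnt P (q * L) / L then cnt (NER L P) q + 1 else UB x) :
    ColInv L P base (q + 1) W' R' NE' UM' UB' := by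
  have hn : NER L P q := by
    by_contra hn
    exact h0 (hcur.eq_zero_iff.2 fun i hi hp => hn ⟨i, hi, hp⟩)
  have hlt := hn.cnt_lt
  have hle : cnt P ((q + 1) * L) ≤ cnt P (q * L) + L := by
    rw [hcur.pc_eq]; have := pc_le (L := L) (y := cur); omega
  have hst := @start_iff L q
  set c := cnt P (q * L) with hc
  set c' := cnt P ((q + 1) * L) with hc'
  have hdm := Nat.div_add_mod c L
  have hdm' := Nat.div_add_mod c' L
  have hml := Nat.mod_lt c hL
  have hml' := Nat.mod_lt c' hL
  have hdiv : c' / L = c / L ∨ c' / L = c / L + 1 := by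
    have h1 : c / L ≤ c' / L := Nat.div_le_div_right (by omega)
    have h2 : c' / L ≤ (c + L) / L := Nat.div_le_div_right hle
    rw [Nat.add_div_right _ hL] at h2
    omega
  refine ⟨fun k hk => ?_, fun k hk => ?_, fun k hk hk' => ?_, fun t ht => ?_, fun t ht => ?_⟩
  · rw [hW]
    rcases Nat.lt_succ_iff_lt_or_eq.1 hk with hk | rfl
    · rw [if_neg (by omega)]; exact h.word k hk
    · rw [if_pos rfl]; exact hcur
  · rw [hR]
    rcases Nat.lt_succ_iff_lt_or_eq.1 hk with hk | rfl
    · rw [if_neg (by omega)]; exact h.rank k hk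
    · rw [if_pos rfl]
  · rw [hNE]
    rcases Nat.lt_succ_iff_lt_or_eq.1 hk with hk | rfl
    · rw [if_neg ?_]
      · exact h.row k hk hk'
      · have := cnt_lt_cnt hk' hk; omega
    · rw [if_pos rfl]
  · rw [← hc'] at ht
    rw [← hc', hUM]
    have hold : ∀ r, c ≤ r → r < c' → (Start L P r ↔ r = c) := fun r h1 h2 => start_iff h1 h2
    by_cases ht1 : t = c' / L ∧ c' / L ≠ c / L
    · rw [if_pos ⟨by omega, ht1.2⟩]
      apply IsBW.zero
      rintro i hi ⟨h1, h2⟩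
      have hd : c' / L = c / L + 1 := by omega
      have : c < t * L := by
        rw [ht1.1, hd, add_mul, mul_comm (c / L)]; omega
      have := (hold _ (by omega) h2).1 h1
      omega
    · have htc : t ≤ c / L := by omega
      rw [if_neg (by omega)]
      by_cases htc' : t = c / L
      · rw [if_pos (by omega)]
        have hm := h.mark t htc
        rw [htc'] at hm ⊢
        refine hm.set hml fun k hk => ?_
        have hk' : k = c % L ↔ c / L * L + k = c := by
          rw [mul_comm]; omega
        rw [hk']
        constructor
        · rintro ⟨h1, h2⟩
          by_cases h3 : c / L * L + k < c
          · exact Or.inl ⟨h1, h3⟩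
          · exact Or.inr ((hold _ (by omega) h2).1 h1)
        · rintro (⟨h1, h2⟩ | h1)
          · exact ⟨h1, by omega⟩
          · exact ⟨(hold _ (by omega) (by omega)).2 h1, by omega⟩
      · rw [if_neg (by omega)]
        refine (h.mark t htc).congr fun i hi => ?_
        have h3 : t * L + i < c := by
          have := Nat.mul_le_mul_right L (show t + 1 ≤ c / L by omega)
          rw [add_mul, mul_comm (c / L)] at this
          omega
        constructor
        · rintro ⟨h1, h2⟩; exact ⟨h1, by omega⟩
        · rintro ⟨h1, h2⟩; exact ⟨h1, h3⟩
  · rw [← hc'] at ht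
    rw [hUB]
    by_cases ht1 : t = c' / L ∧ c' / L ≠ c / L
    · rw [if_pos ⟨by omega, ht1.2⟩]
      have hd : c' / L = c / L + 1 := by omega
      symm
      apply cnt_start_of_mem (q := q)
      · rw [← hc, ht1.1, hd, add_mul, mul_comm (c / L)]; omega
      · rw [← hc', ht1.1, mul_comm]; omega
    · rw [if_neg (by omega)]
      exact h.markRank t (by rw [← hc]; omega)

/-- The row of the one bit number `r`, and its place there. -/
theorem ColInv.select_row {n : ℕ} (hL : 0 < L)
    (h : ColInv L P base (n / L + 1) W R NE UM UB) (hP : ∀ p, P p → p < n) {p : ℕ} (hp : P p) :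
    NE (base + (cnt (Start L P) (cnt P p + 1) - 1)) = p / L := by
  have hdm := Nat.div_add_mod p L
  have hml := Nat.mod_lt p hL
  rw [mul_comm] at hdm
  have hn : NER L P (p / L) := ⟨p % L, hml, by rwa [hdm]⟩
  have h1 : cnt P (p / L * L) ≤ cnt P p := cnt_mono (by omega)
  have h2 : cnt P p < cnt P ((p / L + 1) * L) := cnt_lt_cnt hp (by rw [add_mul]; omega)
  rw [cnt_start_of_mem (q := p / L) (by omega) (by omega), Nat.add_sub_cancel]
  exact h.row _ (Nat.lt_succ_of_le (Nat.div_le_div_right (hP p hp).le)) hn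

end ColInv

end PagedRAM

/-! ## Subsequences of large elements, and levels of thresholds -/

namespace PagedRAM

/-- `Y` of length `n` is the subsequence of the elements of `a` (of length `n₀`) that are at
least `lo`, reduced by `lo`. -/
structure Filt (a : ℕ → ℕ) (n₀ lo n : ℕ) (Y : ℕ → ℕ) : Prop where
  len : n = cnt (fun i => lo ≤ a i) n₀
  val : ∀ i < n₀, lo ≤ a i → Y (cnt (fun i => lo ≤ a i) i) + lo = a i

/-! ### Counting through filtered subsequences -/

section Filt

variable {a Y Y' : ℕ → ℕ} {n₀ lo n b n' : ℕ}

theorem Filt.refl (a : ℕ → ℕ) (n₀ : ℕ) : Filt a n₀ 0 n₀ a := by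
  have h : ∀ n, cnt (fun i => 0 ≤ a i) n = n := by
    intro n
    induction n with
    | zero => simp
    | succ n ih => rw [cnt_succ_pos (P := fun i => 0 ≤ a i) (Nat.zero_le _), ih]
  exact ⟨(h _).symm, fun i _ _ => by rw [h]; rfl⟩

/-- Induction on `j`: an element below `lo` affects neither side, and any other element is the next
one of the subsequence and passes the threshold `lo + t` exactly if its reduced value passes `t`. -/
theorem Filt.cnt_eq (h : Filt a n₀ lo n Y) (t : ℕ) {j : ℕ} (hj : j ≤ n₀) :
    cnt (fun i => lo + t ≤ a i) j = cnt (fun p => t ≤ Y p) (cnt (fun i => lo ≤ a i) j) := by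
  induction j with
  | zero => simp
  | succ j ih =>
    have ih := ih (by omega)
    by_cases h1 : lo ≤ a j
    · have hv := h.val j (by omega) h1
      rw [cnt_succ_pos (P := fun i => lo ≤ a i) h1]
      by_cases h2 : lo + t ≤ a j
      · rw [cnt_succ_pos (P := fun i => lo + t ≤ a i) h2, cnt_succ_pos, ih]
        show t ≤ Y _
        omega
      · rw [cnt_succ_neg (P := fun i => lo + t ≤ a i) h2, cnt_succ_neg, ih]
        show ¬ t ≤ Y _
        omega
    · rw [cnt_succ_neg (P := fun i => lo ≤ a i) h1,
        cnt_succ_neg (P := fun i => lo + t ≤ a i) (by omega), ih]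

theorem Filt.congr (h : Filt a n₀ lo n Y) (hY : ∀ p < n, Y' p = Y p) : Filt a n₀ lo n Y' := by
  refine ⟨h.len, fun i hi h1 => ?_⟩
  rw [hY _ (by rw [h.len]; exact cnt_lt_cnt h1 hi)]
  exact h.val i hi h1

/-- Thresholds of successive filters add up, so each level can be filtered from the preceding one
instead of from the whole array. -/
theorem Filt.trans (h : Filt a n₀ lo n Y) (h' : Filt Y n b n' Y') :
    Filt a n₀ (lo + b) n' Y' := by
  refine ⟨?_, fun i hi h1 => ?_⟩
  · rw [h.cnt_eq b le_rfl, ← h.len, h'.len]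
  · have h2 : lo ≤ a i := by omega
    have hv := h.val i hi h2
    rw [h.cnt_eq b hi.le]
    have := h'.val (cnt (fun i => lo ≤ a i) i) (by rw [h.len]; exact cnt_lt_cnt h2 hi) (by omega)
    omega

theorem Filt.le_length (h : Filt a n₀ lo n Y) : n ≤ n₀ := by rw [h.len]; exact cnt_le

end Filt

/-- The column of a sequence `X` of length `n` for the threshold `u`. -/
def colP (n : ℕ) (X : ℕ → ℕ) (u p : ℕ) : Prop := p < n ∧ u ≤ X p

theorem cnt_colP {n u j : ℕ} {X : ℕ → ℕ} (hj : j ≤ n) :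
    cnt (colP n X u) j = cnt (fun p => u ≤ X p) j :=
  cnt_congr fun i hi => ⟨fun h => h.2, fun h => ⟨by omega, h⟩⟩

/-- The level of the class `c`. -/
def lev (L c : ℕ) : ℕ := if c < L then c else L + Nat.log 2 (c / L)

/-- The least class on the level of `c`. -/
def low (L c : ℕ) : ℕ := if c < L then c else L * 2 ^ Nat.log 2 (c / L)

/-! ### Levels: single classes below `L`, then doubling intervals -/

section lev

variable {L c a k : ℕ}

theorem lev_of_lt (h : c < L) : lev L c = c := if_pos h

theorem low_of_lt (h : c < L) : low L c = c := if_pos h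

theorem lev_low_of_mem (hL : 0 < L) (h1 : L * 2 ^ k ≤ c) (h2 : c < L * 2 ^ (k + 1)) :
    lev L c = L + k ∧ low L c = L * 2 ^ k := by
  have hlog : Nat.log 2 (c / L) = k := by
    rw [Nat.log_eq_iff (Or.inr ⟨by norm_num, ?_⟩)]
    · exact ⟨(Nat.le_div_iff_mul_le hL).2 (by rwa [mul_comm]),
        (Nat.div_lt_iff_lt_mul hL).2 (by rwa [mul_comm])⟩
    · have : 0 < c / L := Nat.div_pos (le_trans (Nat.le_mul_of_pos_right L (by positivity)) h1) hL
      omega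
  have hc : ¬ c < L := by
    have := Nat.le_mul_of_pos_right L (show 0 < 2 ^ k by positivity); omega
  simp [lev, low, hc, hlog]

theorem exists_level (hL : 0 < L) (h : L ≤ c) : ∃ k, L * 2 ^ k ≤ c ∧ c < L * 2 ^ (k + 1) := by
  have hp : c / L ≠ 0 := by have := Nat.div_pos h hL; omega
  refine ⟨Nat.log 2 (c / L), ?_, ?_⟩
  · have := Nat.pow_log_le_self 2 hp
    rw [Nat.le_div_iff_mul_le hL] at this; rwa [mul_comm]
  · have := Nat.lt_pow_succ_log_self (b := 2) (by norm_num) (c / L)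
    rw [Nat.div_lt_iff_lt_mul hL] at this; rwa [mul_comm]

theorem le_of_level_lt {k k' : ℕ} (h : k < k') : L * 2 ^ (k + 1) ≤ L * 2 ^ k' :=
  Nat.mul_le_mul_left _ (Nat.pow_le_pow_right (by norm_num) h)

theorem level_mono {k k' : ℕ} (h : k ≤ k') : L * 2 ^ k ≤ L * 2 ^ k' :=
  Nat.mul_le_mul_left _ (Nat.pow_le_pow_right (by norm_num) h)

/-- The level is a monotone function of the class, and `low` is the least class where it takes the
given value. Comparing levels thus amounts to comparing with one threshold. -/
theorem lev_le_iff (hL : 0 < L) : lev L c ≤ lev L a ↔ low L c ≤ a := by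
  rcases Nat.lt_or_ge c L with hc | hc
  · rw [lev_of_lt hc, low_of_lt hc]
    rcases Nat.lt_or_ge a L with ha | ha
    · rw [lev_of_lt ha]
    · obtain ⟨k, h1, h2⟩ := exists_level hL ha
      rw [(lev_low_of_mem hL h1 h2).1]; omega
  · obtain ⟨k, h1, h2⟩ := exists_level hL hc
    rw [(lev_low_of_mem hL h1 h2).1, (lev_low_of_mem hL h1 h2).2]
    rcases Nat.lt_or_ge a L with ha | ha
    · have := Nat.le_mul_of_pos_right L (show 0 < 2 ^ k by positivity)
      rw [lev_of_lt ha]; omega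
    · obtain ⟨k', h1', h2'⟩ := exists_level hL ha
      rw [(lev_low_of_mem hL h1' h2').1]
      constructor
      · intro h; exact (level_mono (by omega)).trans h1'
      · intro h
        by_contra hk
        have := le_of_level_lt (L := L) (show k' < k by omega)
        omega

theorem low_le (hL : 0 < L) : low L c ≤ c := (lev_le_iff hL).1 le_rfl

theorem lev_le (hL : 0 < L) : lev L c ≤ c := by
  rcases Nat.lt_or_ge c L with hc | hc
  · rw [lev_of_lt hc]
  · obtain ⟨k, h1, h2⟩ := exists_level hL hc
    rw [(lev_low_of_mem hL h1 h2).1]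
    have : k + 1 ≤ 2 ^ k := Nat.lt_two_pow_self
    nlinarith

/-- A class in the `k`th interval is at least `2 ^ k`, whence `k < 4 * L`. This keeps the number of
levels O(L). -/
theorem lev_lt (hL : 0 < L) (hc : c < 2 ^ (4 * L)) : lev L c < 5 * L := by
  rcases Nat.lt_or_ge c L with h | h
  · rw [lev_of_lt h]; omega
  · obtain ⟨k, h1, h2⟩ := exists_level hL h
    rw [(lev_low_of_mem hL h1 h2).1]
    have h3 : 2 ^ k < 2 ^ (4 * L) := by
      have := Nat.le_mul_of_pos_left (2 ^ k) hL; omega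
    have := (Nat.pow_lt_pow_iff_right (a := 2) (by norm_num)).1 h3
    omega

/-- The number of classes on the level that starts at `x`. -/
def width (L x : ℕ) : ℕ := if x < L then 1 else x

/-- A level ends exactly when as many classes as its width have passed. This computes levels in
increasing order without logarithms. -/
theorem lev_low_succ (hL : 0 < L) (c : ℕ) :
    if c + 1 - low L c = width L (low L c) then lev L (c + 1) = lev L c + 1 ∧ low L (c + 1) = c + 1
    else lev L (c + 1) = lev L c ∧ low L (c + 1) = low L c := by
  rcases Nat.lt_or_ge c L with hc | hc
  · rw [low_of_lt hc, lev_of_lt hc, if_pos (by simp [width, hc])]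
    rcases Nat.lt_or_ge (c + 1) L with h | h
    · rw [lev_of_lt h, low_of_lt h]; simp
    · obtain rfl : L = c + 1 := by omega
      have := lev_low_of_mem (L := c + 1) (k := 0) (c := c + 1) hL (by simp) (by simp)
      rw [this.1, this.2]; simp
  · obtain ⟨k, h1, h2⟩ := exists_level hL hc
    have hk := lev_low_of_mem hL h1 h2
    have hkL := Nat.le_mul_of_pos_right L (show 0 < 2 ^ k by positivity)
    have hp : L * 2 ^ (k + 1) = L * 2 ^ k + L * 2 ^ k := by ring
    rw [hk.1, hk.2, show width L (L * 2 ^ k) = L * 2 ^ k from if_neg (by omega)]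
    split_ifs with h
    · have := lev_low_of_mem (L := L) (k := k + 1) (c := c + 1) hL (by omega)
        (by have : L * 2 ^ (k + 1 + 1) = 2 * (L * 2 ^ (k + 1)) := by ring
            omega)
      rw [this.1, this.2]; omega
    · have := lev_low_of_mem (L := L) (k := k) (c := c + 1) hL (by omega) (by omega)
      exact this

end lev

/-- A geometric sum with ratio two is at most twice its largest term, and the largest term that
occurs is at most `x`. -/
theorem sum_levels_one (L x K : ℕ) :
    ∑ k ∈ Finset.range K, (if L * 2 ^ k ≤ x then L * 2 ^ k else 0) ≤ 2 * x := by
  have h1 : ∀ K, ∑ k ∈ Finset.range K, (if L * 2 ^ k ≤ x then L * 2 ^ k else 0) ≤ L * 2 ^ K := by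
    intro K
    induction K with
    | zero => simp
    | succ K ih =>
      rw [Finset.sum_range_succ, pow_succ]
      split_ifs <;> nlinarith
  induction K with
  | zero => simp
  | succ K ih =>
    rw [Finset.sum_range_succ]
    have := h1 K
    split_ifs with h <;> omega

/-- Interchange of summation: each element is charged for the levels whose start it reaches, and
`sum_levels_one` bounds its charge by twice its size. -/
theorem sum_levels (L K : ℕ) (a : ℕ → ℕ) (n : ℕ) :
    ∑ k ∈ Finset.range K, cnt (fun i => L * 2 ^ k ≤ a i) n * (L * 2 ^ k) ≤
      2 * ∑ i ∈ Finset.range n, a i := by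
  induction n with
  | zero => simp
  | succ n ih =>
    rw [Finset.sum_range_succ, Nat.mul_add]
    have h := sum_levels_one L (a n) K
    calc _ = ∑ k ∈ Finset.range K, (cnt (fun i => L * 2 ^ k ≤ a i) n * (L * 2 ^ k) +
          (if L * 2 ^ k ≤ a n then L * 2 ^ k else 0)) := by
          refine Finset.sum_congr rfl fun k _ => ?_
          split_ifs with hk
          · rw [cnt_succ_pos (P := fun i => L * 2 ^ k ≤ a i) hk]; ring
          · rw [cnt_succ_neg (P := fun i => L * 2 ^ k ≤ a i) hk]; ring
      _ ≤ _ := by rw [Finset.sum_add_distrib]; omega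

/-- `v` is one of the first `n` values of `α`. -/
def IsVal (α : ℕ → ℕ) (n v : ℕ) : Prop := ∃ i < n, α i = v

/-- A further value adds at most one to the set of values. -/
theorem cnt_isVal_le (α : ℕ → ℕ) (n x : ℕ) : cnt (IsVal α n) x ≤ n := by
  induction n with
  | zero => rw [cnt_eq_zero]; rintro i _ ⟨j, hj, _⟩; omega
  | succ n ih =>
    -- The indicator of `α n < x` is needed for the induction on `x`: it records whether the only
    -- possible new value has been passed.
    suffices h : ∀ x, cnt (IsVal α (n + 1)) x ≤ cnt (IsVal α n) x + if α n < x then 1 else 0 by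
      have := h x
      split_ifs at this <;> omega
    intro x
    induction x with
    | zero => simp
    | succ x ihx =>
      by_cases h1 : IsVal α (n + 1) x
      · rw [cnt_succ_pos h1]
        by_cases h2 : IsVal α n x
        · rw [cnt_succ_pos h2]
          split_ifs at ihx ⊢ <;> omega
        · have hx : α n = x := by
            obtain ⟨i, hi, h3⟩ := h1
            rcases Nat.lt_succ_iff_lt_or_eq.1 hi with h4 | rfl
            · exact absurd ⟨i, h4, h3⟩ h2
            · exact h3
          rw [cnt_succ_neg h2]
          rw [if_neg (by omega)] at ihx
          rw [if_pos (by omega)]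
          omega
      · rw [cnt_succ_neg h1]
        have := cnt_mono (P := IsVal α n) (show x ≤ x + 1 by omega)
        split_ifs at ihx ⊢ <;> omega

/-- Comparison of values and of their classes. -/
theorem cnt_isVal_le_iff {α : ℕ → ℕ} {n i v : ℕ} (hi : i < n) :
    cnt (IsVal α n) v ≤ cnt (IsVal α n) (α i) ↔ v ≤ α i := by
  constructor
  · intro h
    by_contra hv
    have := cnt_lt_cnt (P := IsVal α n) ⟨i, hi, rfl⟩ (not_le.1 hv)
    omega
  · exact fun h => cnt_mono h

/-! ### The two queries in terms of zero-based counting -/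

theorem rcount_eq (A : ℕ → ℕ) (v j : ℕ) : rcount A v j = cnt (fun i => v ≤ A (i + 1)) j := by
  induction j with
  | zero => simp [rcount]
  | succ j ih =>
    have hI : Finset.Icc 1 (j + 1) = insert (j + 1) (Finset.Icc 1 j) := by
      ext x; simp; omega
    rw [rcount, hI, Finset.filter_insert]
    split_ifs with h
    · rw [Finset.card_insert_of_notMem (by simp), cnt_succ_pos (P := fun i => v ≤ A (i + 1)) h, ← ih,
        rcount]
    · rw [cnt_succ_neg (P := fun i => v ≤ A (i + 1)) h, ← ih, rcount]

/-- The predicate given to `Nat.nth` is one-based and false at `0`, so its count below `i + 1` is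
the zero-based count below `i`. -/
theorem rselect_eq {A : ℕ → ℕ} {n v r i : ℕ} (hi : i < n) (hv : v ≤ A (i + 1))
    (hr : cnt (fun i => v ≤ A (i + 1)) i = r - 1) : rselect A n v r = i + 1 := by
  classical
  have h1 : cnt (fun k => (1 ≤ k ∧ k ≤ n) ∧ v ≤ A k) (i + 1) = r - 1 := by
    rw [← hr, add_comm i 1, cnt_add, show (1 : ℕ) = 0 + 1 from rfl, cnt_succ_neg (by simp), cnt_zero,
      zero_add]
    refine cnt_congr fun k hk => ?_
    rw [add_comm (0 + 1) k]
    exact ⟨fun h => h.2, fun h => ⟨⟨by omega, by omega⟩, h⟩⟩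
  have h2 := Nat.nth_count (p := fun k => (1 ≤ k ∧ k ≤ n) ∧ v ≤ A k) (n := i + 1)
    ⟨⟨by omega, by omega⟩, hv⟩
  rw [rselect, ← h1]
  convert h2 using 2
  unfold cnt
  congr

end PagedRAM

/-! ## Preprocessing: word length and tables

Register `0` holds `m`, register `1` the length of the input array, register `2` the binary
logarithm of the length `L` of bit words, register `3` holds `L`, register `4` holds `1` and
register `5` holds `0`. -/

namespace PagedRAM

variable {w H m n₀ L lam : ℕ}

/-- The parameters of the data structure. -/
structure Par (w H m n₀ L lam : ℕ) : Prop where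
  hw : 2 ≤ w
  hH : 1 ≤ H
  hm : 2 ≤ m
  hmw : m < 2 ^ w
  hn : n₀ ≤ m
  hL : L = 2 ^ lam
  hLm : L * 2 ^ L ≤ m
  hmL : m < 2 ^ (2 * L) * (2 * L)

/-! ### Size bounds for the word length -/

namespace Par

theorem pos (h : Par w H m n₀ L lam) : 0 < L := by rw [h.hL]; positivity

theorem lam_lt (h : Par w H m n₀ L lam) : lam < L := by rw [h.hL]; exact Nat.lt_two_pow_self

theorem L_lt (h : Par w H m n₀ L lam) : 2 * L ≤ m := by
  have h1 : L + 1 ≤ 2 ^ L := Nat.lt_two_pow_self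
  have := h.hLm
  have := h.pos
  nlinarith

theorem sq_le (h : Par w H m n₀ L lam) : L * L ≤ m :=
  (Nat.mul_le_mul_left L (Nat.lt_two_pow_self).le).trans h.hLm

theorem pow_le (h : Par w H m n₀ L lam) : 2 ^ L ≤ m :=
  (Nat.le_mul_of_pos_left _ h.pos).trans h.hLm

/-- The estimate `2 * L < 2 ^ (2 * L)` absorbs the linear factor of `hmL`. This is the lower bound
on `L` in terms of log m. -/
theorem m_lt (h : Par w H m n₀ L lam) : m < 2 ^ (4 * L) := by
  refine h.hmL.trans_le ?_
  rw [show 4 * L = 2 * L + 2 * L by ring, pow_add]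
  exact Nat.mul_le_mul_left _ (Nat.lt_two_pow_self).le

theorem four_le (h : Par w H m n₀ L lam) : 4 * 2 ^ w ≤ 2 ^ w * 2 ^ w := by
  have : 2 ^ 2 ≤ 2 ^ w := Nat.pow_le_pow_right (by norm_num) h.hw
  exact Nat.mul_le_mul_right _ this

theorem le_H (h : Par w H m n₀ L lam) : 2 ^ w ≤ H * 2 ^ w := Nat.le_mul_of_pos_left _ h.hH

end Par

/-- The contents of the global registers. -/
structure Glob (m n₀ L lam : ℕ) (σ : AState) : Prop where
  r0 : σ.reg 0 = m
  r1 : σ.reg 1 = n₀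
  r2 : σ.reg 2 = lam
  r3 : σ.reg 3 = L
  r4 : σ.reg 4 = 1
  r5 : σ.reg 5 = 0

theorem Glob.agree {σ σ' : AState} (h : Glob m n₀ L lam σ) {rs as : List ℕ}
    (ha : Agree rs as σ σ') (hr : ∀ r < 6, r ∉ rs) : Glob m n₀ L lam σ' :=
  ⟨(ha.1 0 (hr 0 (by norm_num))).trans h.r0, (ha.1 1 (hr 1 (by norm_num))).trans h.r1,
    (ha.1 2 (hr 2 (by norm_num))).trans h.r2, (ha.1 3 (hr 3 (by norm_num))).trans h.r3,
    (ha.1 4 (hr 4 (by norm_num))).trans h.r4, (ha.1 5 (hr 5 (by norm_num))).trans h.r5⟩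

/-! ### Computation of the word length and of the tables -/

def wordLengthBody : Stmt :=
  block [.op .add 30 3 3, .op .shr 31 0 30, .op .lt 32 31 30,
    .ite 32 .skip (block [.op .mov 3 30 30, .op .add 2 2 4])]

/-- Compute the length of bit words. -/
def wordLengthProg : Stmt :=
  .seq (block [.const 4 1, .const 5 0, .const 2 0, .const 3 1, .op .mov 20 0 0])
    (forN 20 wordLengthBody)

/-- `L` is doubled as long as the doubled value still satisfies `hLm`. The last success gives `hLm`,
and the failure gives `hmL`. The loop runs `m` times, which linear time allows, although few rounds
change anything. -/
theorem wordLength_spec {σ : AState} (hw : 2 ≤ w) (hH : 1 ≤ H) (hm : 2 ≤ m) (hmw : m < 2 ^ w)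
    (hn : n₀ ≤ m) (h0 : σ.reg 0 = m) (h1 : σ.reg 1 = n₀) :
    Post w H wordLengthProg σ (20 * m) (fun σ' => ∃ L lam,
      Par w H m n₀ L lam ∧ Glob m n₀ L lam σ' ∧ σ'.mem = σ.mem) := by
  have hW : 1 < 2 ^ w := Nat.one_lt_two_pow (by omega)
  refine (Post.seq (T₁ := 6) (T₂ := m * (12 + 3) + 1) (Q₁ := fun σ' => σ'.reg 0 = m ∧
    σ'.reg 1 = n₀ ∧ σ'.reg 2 = 0 ∧ σ'.reg 3 = 1 ∧ σ'.reg 4 = 1 ∧ σ'.reg 5 = 0 ∧ σ'.reg 20 = m ∧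
    σ'.mem = σ.mem) (Post.wp (by decide) ?_) ?_).mono (T' := 20 * m) (by omega) (fun _ h => h)
  · simp only [block, wp, AOp.Valid, AOp.val, AState.set_reg, AState.set_mem, AState.setMem_reg,
      Nat.reduceEqDiff, reduceIte, true_and, and_true, h0, h1, forall_eq]
    omega
  · rintro σ₁ ⟨g0, g1, g2, g3, g4, g5, g20, gm⟩ -
    -- Either every round so far has doubled `L`, or the test has failed and fails ever after.
    refine (Post.forN m 12 (fun i σ' => ∃ lam, 2 ^ lam * 2 ^ 2 ^ lam ≤ m ∧
      (lam = i ∨ m / 2 ^ (2 * 2 ^ lam) < 2 * 2 ^ lam) ∧ Glob m n₀ (2 ^ lam) lam σ' ∧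
      σ'.mem = σ.mem) hw (by decide) g20 ?_ ?_).mono le_rfl ?_
    · exact ⟨0, by simpa using hm, Or.inl rfl, ⟨g0, g1, g2, g3, g4, g5⟩, gm⟩
    · rintro i hi σ' ag ⟨lam, k1, k2, ⟨l0, l1, l2, l3, l4, l5⟩, lm⟩
      refine Post.wp (by decide) ?_
      simp only [wordLengthBody, block, wp, AOp.Valid, AOp.val, AState.set_reg, AState.set_mem,
        AState.setMem_reg, Nat.reduceEqDiff, reduceIte, true_and, and_true, l0, l1, l2, l3, l4, l5]
      have a1 : 2 ^ lam + 1 ≤ 2 ^ 2 ^ lam := Nat.lt_two_pow_self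
      have a2 : lam + 1 ≤ 2 ^ lam := Nat.lt_two_pow_self
      have a3 : 2 ^ lam + 2 ^ lam ≤ m := by nlinarith
      have a4 : 2 ^ w ≤ 2 ^ w * 2 ^ w := Nat.le_mul_of_pos_left _ (by omega)
      refine ⟨by omega, fun v hv => ⟨⟨hmw, by omega⟩, ?_⟩⟩
      rw [← two_mul] at hv
      rintro _ rfl v2 hv2
      rw [hv] at hv2
      refine ⟨fun hne => ⟨lam, k1, ?_, by constructor <;> simp [*], lm⟩, fun he v3 hv3 =>
        ⟨by omega, fun v4 hv4 => ⟨lam + 1, ?_, ?_, ?_, lm⟩⟩⟩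
      · right
        by_contra hc
        rw [if_neg hc] at hv2
        exact hne hv2
      · have : 2 * 2 ^ lam ≤ m / 2 ^ (2 * 2 ^ lam) := by
          by_contra hc
          rw [if_pos (by omega)] at hv2
          omega
        rw [Nat.le_div_iff_mul_le (by positivity)] at this
        rwa [pow_succ', ]
      · left
        have : ¬ m / 2 ^ (2 * 2 ^ lam) < 2 * 2 ^ lam := by
          intro hc
          rw [if_pos hc] at hv2
          omega
        omega
      · constructor <;> simp [*, pow_succ']
    · rintro σ' ⟨lam, k1, k2, hg, lm⟩
      refine ⟨2 ^ lam, lam, ⟨hw, hH, hm, hmw, hn, rfl, k1, ?_⟩, hg, lm⟩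
      have : m / 2 ^ (2 * 2 ^ lam) < 2 * 2 ^ lam := by
        -- Doubling in all `m` rounds would give `2 ^ m ≤ m`.
        rcases k2 with rfl | h
        · have : lam + 1 ≤ 2 ^ lam := Nat.lt_two_pow_self
          have : 2 ^ lam ≤ 2 ^ lam * 2 ^ 2 ^ lam := Nat.le_mul_of_pos_right _ (by positivity)
          omega
        · exact h
      rw [Nat.div_lt_iff_lt_mul (by positivity)] at this
      rwa [mul_comm]

/-- `M` is the table of the numbers of one bits. -/
def PopTab (L : ℕ) (M : ℕ → ℕ) : Prop := ∀ y < 2 ^ L, M y = pc L y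

/-- `M` is the table of the positions of the one bits. -/
def SelTab (L : ℕ) (M : ℕ → ℕ) : Prop := ∀ y < 2 ^ L, ∀ k < L, y.testBit k = true →
  M (y * L + cnt (fun i => y.testBit i = true) k) = k

def popBody : Stmt :=
  block [.op .shr 33 31 4, .load 34 1 33, .op .band 35 31 4, .op .add 34 34 35, .store 1 31 34,
    .op .add 31 31 4]

/-- Compute the table of the numbers of one bits. -/
def popProg : Stmt :=
  .seq (block [.op .shl 30 4 3, .store 1 5 5, .op .sub 21 30 4, .op .mov 31 4 4])
    (forN 21 popBody)

/-- The entries are filled in increasing order by `pc_half`, from the entry at `y / 2` and the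
lowest bit. -/
theorem pop_spec (hp : Par w H m n₀ L lam) {σ : AState} (hg : Glob m n₀ L lam σ) :
    Post w H popProg σ (20 * m) (fun σ' => PopTab L (σ'.mem 1)) := by
  have hw := hp.hw
  have hmw := hp.hmw
  have hpow := hp.pow_le
  have hLlt := hp.L_lt
  have h4 := hp.four_le
  have hH := hp.le_H
  have hm := hp.hm
  obtain ⟨g0, g1, g2, g3, g4, g5⟩ := hg
  refine (Post.seq (T₁ := 6) (T₂ := (2 ^ L - 1) * (10 + 3) + 1) (Q₁ := fun σ' =>
    σ'.reg 21 = 2 ^ L - 1 ∧ σ'.reg 31 = 1 ∧ σ'.mem 1 0 = 0)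
    (Post.wp (by decide) ?_) ?_).mono (T' := 20 * m) (by omega) (fun _ h => h)
  · simp only [block, wp, AOp.Valid, AOp.val, AState.set_reg, AState.set_mem, AState.setMem_reg,
      Nat.reduceEqDiff, reduceIte, true_and, and_true, AState.setMem_mem_same, g0, g1, g2, g3, g4,
      g5, forall_eq, one_mul]
    omega
  · rintro σ₁ ⟨k1, k2, k3⟩ ag₁
    have hg₁ := Glob.agree ⟨g0, g1, g2, g3, g4, g5⟩ ag₁ (by decide)
    refine (Post.forN (2 ^ L - 1) 10 (fun i σ' => σ'.reg 31 = i + 1 ∧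
      ∀ y < i + 1, σ'.mem 1 y = pc L y) hw (by decide) k1 ?_ ?_).mono le_rfl ?_
    · refine ⟨by rw [k2], fun y hy => ?_⟩
      obtain rfl : y = 0 := by omega
      rw [k3, pc_zero]
    · rintro i hi σ' ag ⟨l1, l2⟩
      obtain ⟨g0, g1, g2, g3, g4, g5⟩ := hg₁.agree ag (by decide)
      refine Post.wp (by decide) ?_
      simp only [popBody, block, wp, AOp.Valid, AOp.val, AState.set_reg, AState.set_mem,
        AState.setMem_reg, Nat.reduceEqDiff, reduceIte, true_and, and_true,
        AState.setMem_mem_same, g0, g1, g2, g3, g4, g5, l1, pow_one]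
      refine ⟨by omega, fun v hv => ⟨by omega, fun v2 hv2 => ⟨by omega, fun v3 hv3 => ?_⟩⟩⟩
      rw [l2 v (by omega)] at hv2
      rw [Nat.and_one_is_mod] at hv3
      have hv4 : v2 + v3 = pc L (i + 1) := by
        rw [pc_half (show i + 1 < 2 ^ L by omega), hv2, hv3, hv]
      have := pc_le (L := L) (y := i + 1)
      refine ⟨by omega, fun v4 hv4' => ⟨by omega, by omega, by omega, fun v5 hv5 => ⟨hv5, ?_⟩⟩⟩
      intro y hy
      split_ifs with h
      · rw [hv4', hv4, h]
      · exact l2 y (by omega)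
    · rintro σ' ⟨l1, l2⟩ y hy
      exact l2 y (by omega)

def selInner : Stmt :=
  block [.op .shr 34 31 33, .op .band 34 34 4,
    .ite 34 (block [.op .shl 35 4 33, .op .sub 35 35 4, .op .band 36 31 35, .load 36 1 36,
      .op .shl 37 31 2, .op .add 37 37 36, .store 2 37 33]) .skip,
    .op .add 33 33 4]

def selOuter : Stmt :=
  .seq (block [.const 33 0, .op .mov 21 3 3]) (.seq (forN 21 selInner) (.op .add 31 31 4))

/-- Compute the table of the positions of the one bits. -/
def selProg : Stmt := .seq (block [.op .shl 20 4 3, .const 31 0]) (forN 20 selOuter)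

/-- For every word and every one bit at place `k`, the number of one bits below `k` is looked up,
and `k` is stored under that number. The `2 ^ L * L` pairs are paid for by `hLm`. -/
theorem sel_spec (hp : Par w H m n₀ L lam) {σ : AState} (hg : Glob m n₀ L lam σ)
    (ht : PopTab L (σ.mem 1)) :
    Post w H selProg σ (60 * m) (fun σ' => SelTab L (σ'.mem 2)) := by
  have hw := hp.hw
  have hmw := hp.hmw
  have hpow := hp.pow_le
  have hLlt := hp.L_lt
  have h4 := hp.four_le
  have hH := hp.le_H
  have hm := hp.hm
  have hLm := hp.hLm
  have hpos := hp.pos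
  have hlam := hp.lam_lt
  have hT : 4 + (2 ^ L * ((4 + (L * (16 + 3) + 1 + 1)) + 3) + 1) ≤ 60 * m := by
    nlinarith
  refine (Post.seq (T₁ := 4) (Q₁ := fun σ' => σ'.reg 20 = 2 ^ L ∧ σ'.reg 31 = 0)
    (Post.wp (by decide) ?_) ?_).mono hT (fun _ h => h)
  · simp only [block, wp, AOp.Valid, AOp.val, AState.set_reg, AState.set_mem, AState.setMem_reg,
      Nat.reduceEqDiff, reduceIte, true_and, and_true, hg.r4, hg.r3, forall_eq, one_mul]
    omega
  rintro σ₁ ⟨k1, k2⟩ ag₁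
  have hg₁ := hg.agree ag₁ (by decide)
  have ht₁ : PopTab L (σ₁.mem 1) := by rwa [ag₁.2 1 (by decide)]
  refine (Post.forN (2 ^ L) _ (fun x σ' => σ'.reg 31 = x ∧ ∀ y < x, ∀ k < L, y.testBit k = true →
      σ'.mem 2 (y * L + cnt (fun i => y.testBit i = true) k) = k) hw (by decide) k1 ?_ ?_).mono
      le_rfl ?_
  · exact ⟨k2, by simp⟩
  swap
  · rintro σ' ⟨-, h⟩ y hy; exact h y hy
  rintro x hx σ₂ ag₂ ⟨l1, l2⟩
  have hg₂ := hg₁.agree ag₂ (by decide)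
  have ht₂ : PopTab L (σ₂.mem 1) := by rwa [ag₂.2 1 (by decide)]
  refine Post.seq (T₁ := 4) (Q₁ := fun σ' => σ'.reg 21 = L ∧ σ'.reg 33 = 0 ∧ σ'.reg 31 = x ∧
    σ'.mem = σ₂.mem ∧ Glob m n₀ L lam σ') (Post.wp (by decide) ?_) ?_
  · simp only [block, wp, AOp.Valid, AOp.val, AState.set_reg, AState.set_mem, AState.setMem_reg,
      Nat.reduceEqDiff, reduceIte, true_and, and_true, hg₂.r3, forall_eq, one_mul, l1]
    refine ⟨by omega, ?_⟩
    constructor <;> simp [hg₂.r0, hg₂.r1, hg₂.r2, hg₂.r3, hg₂.r4, hg₂.r5]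
  rintro σ₃ ⟨p1, p2, p3, p4, hg₃⟩ -
  have ht₃ : PopTab L (σ₃.mem 1) := by rwa [p4]
  refine Post.seq (T₂ := 1) (Post.forN L 16 (fun i σ' => σ'.reg 33 = i ∧
      (∀ y < x, ∀ k < L, y.testBit k = true →
        σ'.mem 2 (y * L + cnt (fun i => y.testBit i = true) k) = k) ∧
      ∀ k < i, x.testBit k = true →
        σ'.mem 2 (x * L + cnt (fun i => x.testBit i = true) k) = k) hw (by decide) p1 ?_ ?_) ?_
  · exact ⟨p2, by rwa [p4], by simp⟩
  · rintro i hi σ₄ ag ⟨q1, q2, q3⟩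
    obtain ⟨g0, g1, g2, g3, g4, g5⟩ := hg₃.agree ag (by decide)
    have ht₄ : PopTab L (σ₄.mem 1) := by rwa [ag.2 1 (by decide)]
    have q4 : σ₄.reg 31 = x := (ag.1 31 (by decide)).trans p3
    refine Post.wp (by decide) ?_
    simp only [selInner, block, wp, AOp.Valid, AOp.val, AState.set_reg, AState.set_mem,
        AState.setMem_reg, Nat.reduceEqDiff, reduceIte, true_and, and_true,
        AState.setMem_mem_same, g0, g1, g2, g3, g4, g5, q1, q4]
    refine ⟨by omega, fun v hv => ⟨⟨by have := Nat.div_le_self x (2 ^ i); omega, by omega⟩,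
      fun v2 hv2 => ⟨fun hne => ?_, fun he => ⟨by omega, fun v3 hv3 => ⟨hv3, q2, ?_⟩⟩⟩⟩⟩
    · have hbit : x.testBit i = true := by
        rw [Nat.testBit_eq_decide_div_mod_eq]
        rw [Nat.and_one_is_mod, hv] at hv2
        simp; omega
      have hi2 : 2 ^ i < 2 ^ L := Nat.pow_lt_pow_right (by norm_num) hi
      have hxi : x % 2 ^ i < 2 ^ L := (Nat.mod_le _ _).trans_lt hx
      have hxL : x * L + L ≤ m := by
        have := Nat.mul_le_mul_left L (show x + 1 ≤ 2 ^ L from hx)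
        rw [mul_add, mul_one, mul_comm L x] at this
        omega
      have hxL' : x * 2 ^ lam = x * L := by rw [hp.hL]
      refine ⟨by omega, fun v3 hv3 v4 hv4 => ⟨by omega, fun v5 hv5 => ?_⟩⟩
      rw [hv4, hv3, Nat.and_mask] at hv5
      refine ⟨by omega, fun v6 hv6 => ?_⟩
      rw [hv5, ht₄ _ hxi, pc_mod hi.le] at hv6
      have hv6i : v6 ≤ i := by rw [hv6]; exact cnt_le
      refine ⟨by omega, fun v7 hv7 => ⟨by omega, fun v8 hv8 => ⟨by omega, by omega, by omega,
        fun v9 hv9 => ⟨hv9, fun y hy k hk hyk => ?_, fun k hk hxk => ?_⟩⟩⟩⟩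
      -- The entry number is at most `k < L`, so the blocks of `L` cells of different words are
      -- disjoint.
      · rw [if_neg]
        · exact q2 y hy k hk hyk
        · have h1 := Nat.mul_le_mul_right L (show y + 1 ≤ x from hy)
          rw [add_mul, one_mul] at h1
          have h2 : cnt (fun i => y.testBit i = true) k ≤ k := cnt_le
          omega
      · rcases Nat.lt_succ_iff_lt_or_eq.1 hk with hk | rfl
        · rw [if_neg]
          · exact q3 k hk hxk
          · have h2 := cnt_lt_cnt (P := fun i => x.testBit i = true) hxk hk
            omega
        · rw [if_pos (by omega)]
    · intro k hk hxk
      rcases Nat.lt_succ_iff_lt_or_eq.1 hk with hk | rfl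
      · exact q3 k hk hxk
      · exfalso
        rw [Nat.testBit_eq_decide_div_mod_eq] at hxk
        rw [Nat.and_one_is_mod, hv] at hv2
        simp at hxk; omega
  · rintro σ₄ ⟨q1, q2, q3⟩ ag
    have q4 : σ₄.reg 31 = x := (ag.1 31 (by decide)).trans p3
    have g4 := (hg₃.agree ag (by decide)).r4
    refine Post.wp (by decide) ?_
    simp only [block, wp, AOp.Valid, AOp.val, AState.set_reg, AState.set_mem,
        AState.setMem_reg, Nat.reduceEqDiff, reduceIte, true_and, and_true, g4, q4]
    refine ⟨by omega, fun v hv => ⟨hv, fun y hy k hk hyk => ?_⟩⟩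
    rcases Nat.lt_succ_iff_lt_or_eq.1 hy with hy | rfl
    · exact q2 y hy k hk hyk
    · exact q3 k hk hyk

end PagedRAM

/-! ## Preprocessing: compression of the values to classes -/

namespace PagedRAM

variable {w H m n₀ L lam : ℕ}

theorem Par.and_mask (hp : Par w H m n₀ L lam) (x : ℕ) : x &&& (L - 1) = x % L := by
  rw [hp.hL]; exact Nat.and_two_pow_sub_one_eq_mod x lam

/-! ### The largest value -/

/-- Find the largest element of the array. -/
def maxBody : Stmt :=
  block [.op .add 32 31 4, .load 33 0 32, .op .lt 34 6 33, .ite 34 (.op .mov 6 33 33) .skip,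
    .op .add 31 31 4]

def maxProg : Stmt :=
  .seq (block [.const 6 0, .const 31 0, .op .mov 20 1 1]) (forN 20 maxBody)

/-- The found maximum is also bounded by the sum; after division by `L` this makes the bit vector of
the values linear in `m`. -/
theorem max_spec (hp : Par w H m n₀ L lam) {σ : AState} (hg : Glob m n₀ L lam σ) {α : ℕ → ℕ}
    (hα : ∀ i < n₀, σ.mem 0 (i + 1) = α i) (hαw : ∀ i < n₀, α i < 2 ^ w) :
    Post w H maxProg σ (20 * m) (fun σ' => (∀ i < n₀, α i ≤ σ'.reg 6) ∧ σ'.reg 6 < 2 ^ w ∧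
      σ'.reg 6 ≤ ∑ i ∈ Finset.range n₀, α i) := by
  have hw := hp.hw
  have hmw := hp.hmw
  have hH := hp.le_H
  have h4 := hp.four_le
  have hn := hp.hn
  have hm := hp.hm
  refine (Post.seq (T₁ := 4) (T₂ := n₀ * (12 + 3) + 1) (Q₁ := fun σ' =>
    σ'.reg 20 = n₀ ∧ σ'.reg 31 = 0 ∧ σ'.reg 6 = 0)
    (Post.wp (by decide) ?_) ?_).mono (T' := 20 * m) (by omega) (fun _ h => h)
  · simp only [block, wp, AOp.Valid, AOp.val, AState.set_reg, AState.set_mem, AState.setMem_reg,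
      Nat.reduceEqDiff, reduceIte, true_and, and_true, hg.r1, forall_eq]
    omega
  rintro σ₁ ⟨k1, k2, k3⟩ ag₁
  have hg₁ := hg.agree ag₁ (by decide)
  refine (Post.forN n₀ 12 (fun i σ' => σ'.reg 31 = i ∧ (∀ j < i, α j ≤ σ'.reg 6) ∧
    σ'.reg 6 < 2 ^ w ∧ σ'.reg 6 ≤ ∑ j ∈ Finset.range i, α j) hw (by decide) k1 ?_ ?_).mono
    le_rfl (fun σ' h => h.2)
  · simp [k2, k3]
  rintro i hi σ₂ ag₂ ⟨l1, l2, l3, l4⟩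
  obtain ⟨g0, g1, g2, g3, g4, g5⟩ := hg₁.agree ag₂ (by decide)
  have hA : σ₂.mem 0 (i + 1) = α i := by
    rw [ag₂.2 0 (by decide), ag₁.2 0 (by decide)]; exact hα i hi
  refine Post.wp (by decide) ?_
  simp only [maxBody, block, wp, AOp.Valid, AOp.val, AState.set_reg, AState.set_mem,
    AState.setMem_reg, Nat.reduceEqDiff, reduceIte, true_and, and_true,
    AState.setMem_mem_same, g0, g1, g2, g3, g4, g5, l1]
  refine ⟨by omega, fun v hv => ⟨by omega, fun v2 hv2 v3 hv3 => ?_⟩⟩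
  rw [hv, hA] at hv2
  rw [Finset.sum_range_succ]
  constructor
  · intro hne v4 hv4
    have : σ₂.reg 6 < v2 := by by_contra hc; rw [if_neg hc] at hv3; exact hne hv3
    refine ⟨by omega, fun v5 hv5 => ⟨hv5, fun j hj => ?_, by have := hαw i hi; omega, by omega⟩⟩
    rcases Nat.lt_succ_iff_lt_or_eq.1 hj with hj | rfl
    · have := l2 j hj; omega
    · omega
  · intro he
    have : ¬ σ₂.reg 6 < v2 := by intro hc; rw [if_pos hc] at hv3; omega
    refine ⟨by omega, fun v5 hv5 => ⟨hv5, fun j hj => ?_, l3, by omega⟩⟩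
    rcases Nat.lt_succ_iff_lt_or_eq.1 hj with hj | rfl
    · exact l2 j hj
    · omega

/-! ### The set of occurring values and its ranks -/

def clearBody : Stmt := block [.store 3 31 5, .op .add 31 31 4]

def markBody : Stmt :=
  block [.op .add 32 31 4, .load 33 0 32, .op .shr 34 33 2, .op .band 35 33 38, .op .shl 36 4 35,
    .load 37 3 34, .op .bor 37 37 36, .store 3 34 37, .op .add 31 31 4]

/-- Mark the values that occur in the array. -/
def markProg : Stmt :=
  .seq (block [.op .shr 40 6 2, .op .add 20 40 4, .const 31 0]) (.seq (forN 20 clearBody)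
    (.seq (block [.op .mov 20 1 1, .const 31 0, .op .sub 38 3 4]) (forN 20 markBody)))

theorem mark_spec (hp : Par w H m n₀ L lam) {σ : AState} (hg : Glob m n₀ L lam σ) {α : ℕ → ℕ}
    (hα : ∀ i < n₀, σ.mem 0 (i + 1) = α i) {M : ℕ} (hM : σ.reg 6 = M) (hMw : M < 2 ^ w)
    (hαM : ∀ i < n₀, α i ≤ M) :
    Post w H markProg σ (30 * (m + M / L)) (fun σ' => σ'.reg 40 = M / L ∧
      ∀ x ≤ M / L, IsBW L (IsVal α n₀) x (σ'.mem 3 x)) := by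
  have hw := hp.hw
  have hmw := hp.hmw
  have hH := hp.le_H
  have h4 := hp.four_le
  have hn := hp.hn
  have hm := hp.hm
  have hlam := hp.lam_lt
  have hL2 := hp.L_lt
  have hpos := hp.pos
  have hpow := hp.pow_le
  have hMx : M / L ≤ M := Nat.div_le_self _ _
  refine (Post.seq (T₁ := 4) (T₂ := ((M / L + 1) * (4 + 3) + 1) + (4 + (n₀ * (12 + 3) + 1)))
    (Q₁ := fun σ' => σ'.reg 20 = M / L + 1 ∧ σ'.reg 31 = 0 ∧ σ'.reg 40 = M / L)
    (Post.wp (by decide) ?_) ?_).mono (T' := 30 * (m + M / L)) (by generalize M / L = X; omega) (fun _ h => h)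
  · simp only [block, wp, AOp.Valid, AOp.val, AState.set_reg, AState.set_mem, AState.setMem_reg,
      Nat.reduceEqDiff, reduceIte, true_and, and_true, hg.r2, hg.r4, hM, forall_eq, ← hp.hL]
    omega
  rintro σ₁ ⟨k1, k2, k3⟩ ag₁
  have hg₁ := hg.agree ag₁ (by decide)
  refine Post.seq (Post.forN (M / L + 1) 4 (fun i σ' => σ'.reg 31 = i ∧ ∀ x < i, σ'.mem 3 x = 0)
    hw (by decide) k1 ?_ ?_) ?_
  · simp [k2]
  · rintro i hi σ₂ ag₂ ⟨l1, l2⟩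
    obtain ⟨g0, g1, g2, g3, g4, g5⟩ := hg₁.agree ag₂ (by decide)
    refine Post.wp (by decide) ?_
    simp only [clearBody, block, wp, AOp.Valid, AOp.val, AState.set_reg, AState.set_mem,
      AState.setMem_reg, Nat.reduceEqDiff, reduceIte, true_and, and_true,
      AState.setMem_mem_same, g0, g1, g2, g3, g4, g5, l1]
    refine ⟨by omega, by omega, by omega, fun v hv => ⟨hv, fun x hx => ?_⟩⟩
    split_ifs with hxi
    · rfl
    · exact l2 x (by omega)
  rintro σ₂ ⟨l1, l2⟩ ag₂
  have hg₂ := hg₁.agree ag₂ (by decide)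
  have k3₂ : σ₂.reg 40 = M / L := (ag₂.1 40 (by decide)).trans k3
  refine Post.seq (T₁ := 4)
    (Q₁ := fun σ' => σ'.reg 20 = n₀ ∧ σ'.reg 31 = 0 ∧ σ'.reg 38 = L - 1 ∧ σ'.reg 40 = M / L)
    (Post.wp (by decide) ?_) ?_
  · simp only [block, wp, AOp.Valid, AOp.val, AState.set_reg, AState.set_mem, AState.setMem_reg,
      Nat.reduceEqDiff, reduceIte, true_and, and_true, hg₂.r1, hg₂.r3, hg₂.r4, forall_eq, k3₂]
    omega
  rintro σ₃ ⟨q1, q2, q3, q4⟩ ag₃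
  have hg₃ := hg₂.agree ag₃ (by decide)
  refine (Post.forN n₀ 12 (fun i σ' => σ'.reg 31 = i ∧ σ'.reg 40 = M / L ∧
    ∀ x ≤ M / L, IsBW L (IsVal α i) x (σ'.mem 3 x)) hw (by decide) q1 ?_ ?_).mono
    le_rfl (fun σ' h => h.2)
  · refine ⟨q2, q4, fun x hx => ?_⟩
    rw [ag₃.2 3 (by decide), l2 x (by omega)]
    refine IsBW.zero fun i _ => ?_
    rintro ⟨j, hj, -⟩
    omega
  rintro i hi σ₄ ag₄ ⟨r1, r2, r3⟩
  obtain ⟨g0, g1, g2, g3, g4, g5⟩ := hg₃.agree ag₄ (by decide)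
  have hA : σ₄.mem 0 (i + 1) = α i := by
    rw [ag₄.2 0 (by decide), ag₃.2 0 (by decide), ag₂.2 0 (by decide), ag₁.2 0 (by decide)]
    exact hα i hi
  have q3₄ : σ₄.reg 38 = L - 1 := (ag₄.1 38 (by decide)).trans q3
  have hle := hαM i hi
  have hdiv : α i / L ≤ M / L := Nat.div_le_div_right hle
  have hmod := Nat.mod_lt (α i) hpos
  refine Post.wp (by decide) ?_
  simp only [markBody, block, wp, AOp.Valid, AOp.val, AState.set_reg, AState.set_mem,
    AState.setMem_reg, Nat.reduceEqDiff, reduceIte, true_and, and_true,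
    AState.setMem_mem_same, g0, g1, g2, g3, g4, g5, r1, r2, q3₄]
  refine ⟨by omega, fun v hv => ⟨by omega, fun v2 hv2 => ?_⟩⟩
  rw [hv, hA] at hv2
  refine ⟨by omega, fun v3 hv3 => ?_⟩
  rw [hv2, ← hp.hL] at hv3
  refine ⟨by omega, fun v4 hv4 => ?_⟩
  rw [hp.and_mask, hv2] at hv4
  have hpw : 2 ^ (α i % L) < 2 ^ L := Nat.pow_lt_pow_right (by norm_num) hmod
  refine ⟨by rw [hv4]; omega, fun v5 hv5 => ⟨by omega, fun v6 hv6 => ?_⟩⟩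
  rw [hv3] at hv6
  have hbw := r3 (α i / L) hdiv
  have hb2 : IsBW L (IsVal α (i + 1)) (α i / L) (v6 ||| v5) := by
    rw [hv6, hv5, hv4]
    refine hbw.set hmod fun k hk => ?_
    have hk' : k = α i % L ↔ α i = α i / L * L + k := by
      have := Nat.div_add_mod (α i) L
      rw [mul_comm] at this
      omega
    rw [hk']
    constructor
    · rintro ⟨j, hj, h⟩
      rcases Nat.lt_succ_iff_lt_or_eq.1 hj with hj | rfl
      · exact Or.inl ⟨j, hj, h⟩
      · exact Or.inr h
    · rintro (⟨j, hj, h⟩ | h)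
      · exact ⟨j, by omega, h⟩
      · exact ⟨i, by omega, h⟩
  refine ⟨⟨by rw [hv6]; exact hbw.1.trans_le (by omega), by rw [hv5, hv4, one_mul]; omega⟩,
    fun v7 hv7 => ⟨by omega, ?_, by omega, fun v8 hv8 => ⟨hv8, fun x hx => ?_⟩⟩⟩
  · rw [hv7]; exact hb2.1.trans_le (by omega)
  · split_ifs with h
    · rw [h, hv7, hv3]; exact hb2
    · refine (r3 x hx).congr fun k hk => ?_
      constructor
      · rintro ⟨j, hj, h⟩; exact ⟨j, by omega, h⟩
      · rintro ⟨j, hj, h'⟩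
        rcases Nat.lt_succ_iff_lt_or_eq.1 hj with hj | rfl
        · exact ⟨j, hj, h'⟩
        · exfalso
          apply h
          rw [hv3, h', mul_comm, Nat.mul_add_div hpos, Nat.div_eq_of_lt hk, add_zero]

def prefixBody : Stmt :=
  block [.store 4 31 7, .load 33 3 31, .load 33 1 33, .op .add 7 7 33, .op .add 31 31 4]

/-- Count the values below each multiple of `L`. -/
def prefixProg : Stmt :=
  .seq (block [.const 7 0, .const 31 0, .op .add 20 40 4]) (forN 20 prefixBody)

/-- The running total ends as the number of distinct values, which later serves as the number of
classes. -/
theorem prefix_spec (hp : Par w H m n₀ L lam) {σ : AState} (hg : Glob m n₀ L lam σ) {α : ℕ → ℕ}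
    (ht : PopTab L (σ.mem 1)) {M : ℕ} (hMw : M < 2 ^ w) (hr : σ.reg 40 = M / L)
    (hB : ∀ x ≤ M / L, IsBW L (IsVal α n₀) x (σ.mem 3 x)) :
    Post w H prefixProg σ (20 * (m + M / L)) (fun σ' =>
      σ'.reg 7 = cnt (IsVal α n₀) ((M / L + 1) * L) ∧
      ∀ x ≤ M / L, σ'.mem 4 x = cnt (IsVal α n₀) (x * L)) := by
  have hw := hp.hw
  have hmw := hp.hmw
  have hH := hp.le_H
  have h4 := hp.four_le
  have hn := hp.hn
  have hm := hp.hm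
  have hpow := hp.pow_le
  have hMx : M / L ≤ M := Nat.div_le_self _ _
  refine (Post.seq (T₁ := 4) (T₂ := ((M / L + 1) * (10 + 3) + 1))
    (Q₁ := fun σ' => σ'.reg 20 = M / L + 1 ∧ σ'.reg 31 = 0 ∧ σ'.reg 7 = 0)
    (Post.wp (by decide) ?_) ?_).mono (T' := 20 * (m + M / L)) (by omega) (fun _ h => h)
  · simp only [block, wp, AOp.Valid, AOp.val, AState.set_reg, AState.set_mem, AState.setMem_reg,
      Nat.reduceEqDiff, reduceIte, true_and, and_true, hg.r2, hg.r4, hr, forall_eq, ← hp.hL]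
    omega
  rintro σ₁ ⟨k1, k2, k3⟩ ag₁
  have hg₁ := hg.agree ag₁ (by decide)
  refine (Post.forN (M / L + 1) 10 (fun i σ' => σ'.reg 31 = i ∧
    σ'.reg 7 = cnt (IsVal α n₀) (i * L) ∧ ∀ x < i, σ'.mem 4 x = cnt (IsVal α n₀) (x * L))
    hw (by decide) k1 ?_ ?_).mono le_rfl ?_
  · simp [k2, k3]
  · rintro i hi σ₂ ag₂ ⟨l1, l2, l3⟩
    obtain ⟨g0, g1, g2, g3, g4, g5⟩ := hg₁.agree ag₂ (by decide)
    have hb := hB i (by omega)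
    rw [← ag₁.2 3 (by decide), ← ag₂.2 3 (by decide)] at hb
    rw [← ag₁.2 1 (by decide), ← ag₂.2 1 (by decide)] at ht
    have hc := cnt_isVal_le α n₀ (i * L)
    have hc' := cnt_isVal_le α n₀ ((i + 1) * L)
    refine Post.wp (by decide) ?_
    simp only [prefixBody, block, wp, AOp.Valid, AOp.val, AState.set_reg, AState.set_mem,
      AState.setMem_reg, Nat.reduceEqDiff, reduceIte, true_and, and_true,
      AState.setMem_mem_same, AState.setMem_mem, g0, g1, g2, g3, g4, g5, l1, l2, false_and]
    refine ⟨by omega, by omega, by omega, fun v hv => ⟨?_, fun v2 hv2 => ?_⟩⟩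
    · rw [hv]; have := hb.1; omega
    rw [hv, ht _ hb.1] at hv2
    rw [hb.pc_eq] at hc' ⊢
    refine ⟨by omega, fun v3 hv3 => ⟨by omega, fun v4 hv4 => ⟨hv4, by omega, fun x hx => ?_⟩⟩⟩
    split_ifs with h
    · rw [h]
    · exact l3 x (by omega)
  · rintro σ' ⟨l1, l2, l3⟩
    exact ⟨l2, fun x hx => l3 x (by omega)⟩

/-- The rank query for a bit vector stored from address `reg 65` in the arrays `aW` (bit words) and
`aR` (ranks of the rows), at the position in register `66`, with the result in register `64`. -/
def rankCode (aW aR : ℕ) : Stmt :=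
  block [.op .shr 60 66 2, .op .add 60 65 60, .load 61 aR 60, .load 62 aW 60, .op .sub 63 3 4,
    .op .band 63 66 63, .op .shl 63 4 63, .op .sub 63 63 4, .op .band 62 62 63, .load 62 1 62,
    .op .add 64 61 62]

/-- The rank at the start of the row is added to the number of one bits in the masked word. Only row
`i / L` has to be valid, so the code serves the value set, the columns and the mark vectors alike.
-/
theorem rank_spec (hp : Par w H m n₀ L lam) {σ : AState} (g2 : σ.reg 2 = lam) (g3 : σ.reg 3 = L)
    (g4 : σ.reg 4 = 1) (ht : PopTab L (σ.mem 1)) {aW aR base i : ℕ} {P : ℕ → Prop} (hb : σ.reg 65 = base)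
    (hi : σ.reg 66 = i) (hiw : i < 2 ^ w) (hadr : base + i / L < H * 2 ^ w)
    (hadr' : base + i / L < 2 ^ w * 2 ^ w) (hW : IsBW L P (i / L) (σ.mem aW (base + i / L)))
    (hR : σ.mem aR (base + i / L) = cnt P (i / L * L)) :
    Post w H (rankCode aW aR) σ 12 (fun σ' => σ'.reg 64 = cnt P i) := by
  have hmw := hp.hmw
  have hH := hp.le_H
  have h4 := hp.four_le
  have hlam := hp.lam_lt
  have hL2 := hp.L_lt
  have hpow := hp.pow_le
  have hmod := Nat.mod_lt i hp.pos
  have hpw : 2 ^ (i % L) < 2 ^ L := Nat.pow_lt_pow_right (by norm_num) hmod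
  have hdm : i / L * L + i % L = i := by rw [mul_comm]; exact Nat.div_add_mod i L
  have hrank := hW.rank hmod.le
  rw [hdm] at hrank
  have hci : cnt P i ≤ i := cnt_le
  refine Post.wp (by simp [rankCode, block, Stmt.size]) ?_
  simp only [rankCode, block, wp, AOp.Valid, AOp.val, AState.set_reg, AState.set_mem,
    AState.setMem_reg, Nat.reduceEqDiff, reduceIte, true_and, and_true, g2, g3, g4, hb, hi]
  refine ⟨by omega, fun v hv => ?_⟩
  rw [← hp.hL] at hv
  subst hv
  refine ⟨hadr', fun v2 hv2 => ?_⟩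
  subst hv2
  refine ⟨hadr, fun v3 hv3 => ⟨hadr, fun v4 hv4 v5 hv5 => ⟨by omega, fun v6 hv6 => ?_⟩⟩⟩
  rw [hv5, hp.and_mask] at hv6
  refine ⟨by rw [hv6]; omega, fun v7 hv7 v8 hv8 => ?_⟩
  rw [hv7, hv6] at hv8
  refine ⟨⟨by rw [hv4]; exact hW.1.trans_le (by omega), by omega⟩, fun v9 hv9 => ?_⟩
  rw [hv8, Nat.and_mask, hv4] at hv9
  have h9 : v9 < 2 ^ L := by rw [hv9]; exact (Nat.mod_le _ _).trans_lt hW.1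
  refine ⟨by omega, fun v10 hv10 => ?_⟩
  rw [ht v9 h9, hv9] at hv10
  rw [hv3, hR]
  exact ⟨by omega, fun v11 hv11 => by omega⟩

/-! ### Classes of the elements -/

def classBody : Stmt :=
  .seq (block [.op .add 32 31 4, .load 66 0 32, .op .mov 65 5 5]) (.seq (rankCode 3 4)
    (block [.store 5 31 64, .op .add 31 31 4]))

/-- Replace the elements of the array by their classes. -/
def classProg : Stmt :=
  .seq (block [.const 31 0, .op .mov 20 1 1]) (forN 20 classBody)

theorem class_spec (hp : Par w H m n₀ L lam) {σ : AState} (hg : Glob m n₀ L lam σ) {α : ℕ → ℕ}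
    (hα : ∀ i < n₀, σ.mem 0 (i + 1) = α i)
    (ht : PopTab L (σ.mem 1)) {M : ℕ} (hMw : M < 2 ^ w) (hαM : ∀ i < n₀, α i ≤ M)
    (hB : ∀ x ≤ M / L, IsBW L (IsVal α n₀) x (σ.mem 3 x))
    (hC : ∀ x ≤ M / L, σ.mem 4 x = cnt (IsVal α n₀) (x * L)) :
    Post w H classProg σ (40 * m) (fun σ' => ∀ i < n₀, σ'.mem 5 i = cnt (IsVal α n₀) (α i)) := by
  have hw := hp.hw
  have hmw := hp.hmw
  have hH := hp.le_H
  have h4 := hp.four_le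
  have hn := hp.hn
  have hm := hp.hm
  refine (Post.seq (T₁ := 3) (T₂ := n₀ * ((4 + (12 + 3)) + 3) + 1) (Q₁ := fun σ' =>
    σ'.reg 20 = n₀ ∧ σ'.reg 31 = 0)
    (Post.wp (by decide) ?_) ?_).mono (T' := 40 * m) (by omega) (fun _ h => h)
  · simp only [block, wp, AOp.Valid, AOp.val, AState.set_reg, AState.set_mem, AState.setMem_reg,
      Nat.reduceEqDiff, reduceIte, true_and, and_true, hg.r1, forall_eq]
    omega
  rintro σ₁ ⟨k1, k2⟩ ag₁
  have hg₁ := hg.agree ag₁ (by decide)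
  refine (Post.forN n₀ _ (fun i σ' => σ'.reg 31 = i ∧
    ∀ j < i, σ'.mem 5 j = cnt (IsVal α n₀) (α j)) hw (by decide) k1 ?_ ?_).mono
    le_rfl (fun σ' h => h.2)
  · simp [k2]
  rintro i hi σ₂ ag₂ ⟨l1, l2⟩
  have hg₂ := hg₁.agree ag₂ (by decide)
  have hmem : ∀ a, a ≠ 5 → σ₂.mem a = σ.mem a := by
    intro a ha
    have : a ∉ classBody.wa := by
      rw [show classBody.wa = [5] from rfl]; simpa using ha
    rw [ag₂.2 a this, ag₁.2 a (by simp [block, Stmt.wa])]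
  have hle := hαM i hi
  have hdiv : α i / L ≤ M / L := Nat.div_le_div_right hle
  have hdl : α i / L ≤ α i := Nat.div_le_self _ _
  refine Post.seq (T₁ := 4) (Q₁ := fun σ' => σ'.reg 65 = 0 ∧ σ'.reg 66 = α i ∧ σ'.reg 31 = i ∧
    σ'.mem = σ₂.mem ∧ Glob m n₀ L lam σ') (Post.wp (by decide) ?_) ?_
  · simp only [block, wp, AOp.Valid, AOp.val, AState.set_reg, AState.set_mem, AState.setMem_reg,
      Nat.reduceEqDiff, reduceIte, true_and, and_true, hg₂.r4, hg₂.r5, l1, forall_eq]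
    refine ⟨by omega, by omega, ?_, ?_⟩
    · rw [hmem 0 (by norm_num)]; exact hα i hi
    · constructor <;> simp [hg₂.r0, hg₂.r1, hg₂.r2, hg₂.r3, hg₂.r4, hg₂.r5]
  rintro σ₃ ⟨q1, q2, q3, q4, hg₃⟩ -
  refine Post.seq (T₂ := 3) (rank_spec (P := IsVal α n₀) hp hg₃.r2 hg₃.r3 hg₃.r4 ?_ q1 q2 (by omega) (by omega) (by omega) ?_ ?_) ?_
  · rwa [q4, hmem 1 (by norm_num)]
  · rw [q4, zero_add, hmem 3 (by norm_num)]; exact hB _ hdiv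
  · rw [q4, zero_add, hmem 4 (by norm_num)]; exact hC _ hdiv
  · rintro σ₄ r1 ag₄
    have r2 : σ₄.reg 31 = i := (ag₄.1 31 (by decide)).trans q3
    have r4 := (hg₃.agree ag₄ (by decide)).r4
    have hc := cnt_isVal_le α n₀ (α i)
    refine Post.wp (by decide) ?_
    simp only [block, wp, AOp.Valid, AOp.val, AState.set_reg, AState.set_mem, AState.setMem_reg,
      Nat.reduceEqDiff, reduceIte, true_and, and_true, r1, r2, r4, forall_eq,
      AState.setMem_mem_same]
    refine ⟨by omega, by omega, by omega, fun j hj => ?_⟩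
    split_ifs with h
    · rw [h]
    · rw [ag₄.2 5 (by decide), q4]; exact l2 j (by omega)

/-! ### Levels of the classes and of the elements -/

def levBody : Stmt :=
  block [.op .sub 36 31 34, .op .eq 37 36 35,
    .ite 37 (block [.op .add 33 33 4, .op .mov 34 31 31, .op .lt 38 31 3,
      .ite 38 (.const 35 1) (.op .mov 35 31 31)]) .skip,
    .store 6 31 33, .op .add 14 33 4, .op .add 31 31 4]

/-- Compute the levels of the classes. -/
def levProg : Stmt :=
  .seq (block [.const 31 0, .const 33 0, .const 34 0, .const 35 1, .const 14 0, .op .mov 20 7 7])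
    (forN 20 levBody)

theorem lev_spec (hp : Par w H m n₀ L lam) {σ : AState} (hg : Glob m n₀ L lam σ) {D : ℕ}
    (hD : D ≤ m) (hr : σ.reg 7 = D) :
    Post w H levProg σ (40 * m) (fun σ' => σ'.reg 14 = (if D = 0 then 0 else lev L (D - 1) + 1) ∧
      ∀ c < D, σ'.mem 6 c = lev L c) := by
  have hw := hp.hw
  have hmw := hp.hmw
  have hH := hp.le_H
  have h4 := hp.four_le
  have hm := hp.hm
  have hpos := hp.pos
  refine (Post.seq (T₁ := 7) (T₂ := D * (20 + 3) + 1) (Q₁ := fun σ' =>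
    σ'.reg 20 = D ∧ σ'.reg 31 = 0 ∧ σ'.reg 33 = 0 ∧ σ'.reg 34 = 0 ∧ σ'.reg 35 = 1 ∧ σ'.reg 14 = 0)
    (Post.wp (by decide) ?_) ?_).mono (T' := 40 * m) (by omega) (fun _ h => h)
  · simp only [block, wp, AOp.Valid, AOp.val, AState.set_reg, AState.set_mem, AState.setMem_reg,
      Nat.reduceEqDiff, reduceIte, true_and, and_true, hr, forall_eq]
    omega
  rintro σ₁ ⟨k1, k2, k3, k4, k5, k6⟩ ag₁
  have hg₁ := hg.agree ag₁ (by decide)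
  -- The registers describe the preceding class. At `i = 0` truncation makes this class `0`, and the
  -- test for a new level fails because the width is `1` and the difference `0`.
  refine (Post.forN D 20 (fun i σ' => σ'.reg 31 = i ∧ σ'.reg 33 = lev L (i - 1) ∧
    σ'.reg 34 = low L (i - 1) ∧ σ'.reg 35 = width L (low L (i - 1)) ∧
    σ'.reg 14 = (if i = 0 then 0 else lev L (i - 1) + 1) ∧
    ∀ c < i, σ'.mem 6 c = lev L c) hw (by decide) k1 ?_ ?_).mono
    le_rfl (fun σ' h => h.2.2.2.2)
  · rw [Nat.zero_sub, lev_of_lt hpos, low_of_lt hpos, width, if_pos hpos]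
    simp [k2, k3, k4, k5, k6]
  rintro i hi σ₂ ag₂ ⟨l1, l2, l3, l4, l5, l6⟩
  obtain ⟨g0, g1, g2, g3, g4, g5⟩ := hg₁.agree ag₂ (by decide)
  have hle := lev_le hpos (c := i)
  have hlow := low_le hpos (c := i)
  have hcond : (i - low L (i - 1) = width L (low L (i - 1)) → lev L i = lev L (i - 1) + 1 ∧
      low L i = i) ∧ (i - low L (i - 1) ≠ width L (low L (i - 1)) → lev L i = lev L (i - 1) ∧
      low L i = low L (i - 1)) := by
    rcases i with _ | i
    · rw [Nat.zero_sub, low_of_lt hpos, width, if_pos hpos]; simp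
    · have := lev_low_succ hpos i
      rw [Nat.add_sub_cancel]
      split_ifs at this with h
      · exact ⟨fun _ => this, fun h' => absurd h h'⟩
      · exact ⟨fun h' => absurd h' h, fun _ => this⟩
  refine Post.wp (by decide) ?_
  simp only [levBody, block, wp, AOp.Valid, AOp.val, AState.set_reg, AState.set_mem,
    AState.setMem_reg, Nat.reduceEqDiff, reduceIte, true_and, and_true,
    AState.setMem_mem_same, AState.setMem_mem, g0, g1, g2, g3, g4, g5, l1, l2, l3, l4, false_and,
    Nat.add_sub_cancel]
  intro v hv v2 hv2
  constructor
  · intro hne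
    have hc := hcond.1 (by rw [← hv]; by_contra hc; rw [if_neg hc] at hv2; exact hne hv2)
    refine ⟨by omega, fun v3 hv3 v4 hv4 v5 hv5 => ?_⟩
    have h3 : v3 = lev L i := by omega
    have h4' : v4 = low L i := by omega
    have key : ∀ c < i + 1, (if c = i then v3 else σ₂.mem 6 c) = lev L c := by
      intro c hc
      split_ifs with h
      · rw [h]; exact h3
      · exact l6 c (by omega)
    have hwid : width L (low L i) = if i < L then 1 else i := by rw [hc.2, width]
    constructor
    · intro hne
      have : i < L := by by_contra hc; rw [if_neg hc] at hv5; exact hne hv5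
      refine ⟨by omega, by omega, by omega, by omega, fun v6 hv6 =>
        ⟨by omega, fun v7 hv7 => ⟨hv7, h3, h4', ?_, ?_, key⟩⟩⟩
      · rw [hwid, if_pos this]
      · omega
    · intro he v6 hv6
      have : ¬ i < L := by intro hc; rw [if_pos hc] at hv5; omega
      refine ⟨by omega, by omega, by omega, fun v7 hv7 =>
        ⟨by omega, fun v8 hv8 => ⟨hv8, h3, h4', ?_, ?_, key⟩⟩⟩
      · rw [hwid, if_neg this, hv6]
      · omega
  · intro he
    have hc := hcond.2 (by rw [← hv]; intro hc; rw [if_pos hc] at hv2; omega)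
    refine ⟨by omega, by omega, by omega, fun v6 hv6 =>
      ⟨by omega, fun v7 hv7 => ⟨hv7, hc.1.symm, hc.2.symm, by rw [hc.2], ?_, fun c hc' => ?_⟩⟩⟩
    · omega
    · split_ifs with h
      · rw [h]; exact hc.1.symm
      · exact l6 c (by omega)

def levelSeqBody : Stmt :=
  block [.load 33 5 31, .load 33 6 33, .store 8 31 33, .op .add 31 31 4]

/-- Compute the sequence of the levels of the elements. -/
def levelSeqProg : Stmt :=
  .seq (block [.const 31 0, .op .mov 20 1 1]) (forN 20 levelSeqBody)

theorem levelSeq_spec (hp : Par w H m n₀ L lam) {σ : AState} (hg : Glob m n₀ L lam σ) {D : ℕ}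
    (hD : D ≤ m) {a : ℕ → ℕ} (ha : ∀ i < n₀, σ.mem 5 i = a i) (haD : ∀ i < n₀, a i < D)
    (hl : ∀ c < D, σ.mem 6 c = lev L c) :
    Post w H levelSeqProg σ (20 * m) (fun σ' => ∀ i < n₀, σ'.mem 8 i = lev L (a i)) := by
  have hw := hp.hw
  have hmw := hp.hmw
  have hH := hp.le_H
  have h4 := hp.four_le
  have hm := hp.hm
  have hn := hp.hn
  have hpos := hp.pos
  refine (Post.seq (T₁ := 3) (T₂ := n₀ * (10 + 3) + 1) (Q₁ := fun σ' =>
    σ'.reg 20 = n₀ ∧ σ'.reg 31 = 0)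
    (Post.wp (by decide) ?_) ?_).mono (T' := 20 * m) (by omega) (fun _ h => h)
  · simp only [block, wp, AOp.Valid, AOp.val, AState.set_reg, AState.set_mem, AState.setMem_reg,
      Nat.reduceEqDiff, reduceIte, true_and, and_true, hg.r1, forall_eq]
    omega
  rintro σ₁ ⟨k1, k2⟩ ag₁
  have hg₁ := hg.agree ag₁ (by decide)
  refine (Post.forN n₀ 10 (fun i σ' => σ'.reg 31 = i ∧
    ∀ j < i, σ'.mem 8 j = lev L (a j)) hw (by decide) k1 ?_ ?_).mono
    le_rfl (fun σ' h => h.2)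
  · simp [k2]
  rintro i hi σ₂ ag₂ ⟨l1, l2⟩
  obtain ⟨g0, g1, g2, g3, g4, g5⟩ := hg₁.agree ag₂ (by decide)
  have h5 : σ₂.mem 5 i = a i := by
    rw [ag₂.2 5 (by decide), ag₁.2 5 (by decide)]; exact ha i hi
  have h6 : σ₂.mem 6 (a i) = lev L (a i) := by
    rw [ag₂.2 6 (by decide), ag₁.2 6 (by decide)]; exact hl _ (haD i hi)
  have := haD i hi
  have := lev_le hpos (c := a i)
  refine Post.wp (by decide) ?_
  simp only [levelSeqBody, block, wp, AOp.Valid, AOp.val, AState.set_reg, AState.set_mem,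
    AState.setMem_reg, Nat.reduceEqDiff, reduceIte, true_and, and_true,
    AState.setMem_mem_same, g0, g1, g2, g3, g4, g5, l1, h5, forall_eq, h6]
  refine ⟨by omega, by omega, by omega, by omega, by omega, fun j hj => ?_⟩
  split_ifs with h
  · rw [h]
  · exact l2 j (by omega)

end PagedRAM

/-! ## Building the columns of a sequence: one step of the sweep -/

namespace PagedRAM

variable {w H m n₀ L lam : ℕ}

theorem cnt_le_of_support {P : ℕ → Prop} {n j : ℕ} (hP : ∀ p, P p → p < n) : cnt P j ≤ n := by
  rcases Nat.le_total j n with h | h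
  · exact cnt_le.trans h
  · rw [cnt_eq_of_le h fun i h1 _ hp => absurd (hP i hp) (by omega)]; exact cnt_le

/-- Process row `reg 32`, whose bits are in register `33`, of column `reg 31`, and move on to the
next column. -/
def stepBody (d : ℕ) : Stmt :=
  block [.op .add 40 11 31, .load 41 d 40, .load 42 (d + 1) 40, .op .pair 43 41 42, .load 44 10 31,
    .load 45 11 31, .op .add 46 43 32, .store (d + 2) 46 33, .store (d + 3) 46 44, .op .shr 47 44 2,
    .ite 33 (block [.op .add 48 43 45, .store (d + 4) 48 32, .op .add 45 45 4, .op .sub 49 3 4,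
      .op .band 50 44 49, .op .shl 51 4 50, .op .add 52 43 47, .load 53 (d + 5) 52,
      .op .bor 53 53 51, .store (d + 5) 52 53, .load 54 1 33, .op .add 55 44 54, .op .shr 56 55 2,
      .op .eq 57 56 47,
      .ite 57 .skip (block [.op .add 58 43 56, .store (d + 6) 58 45, .store (d + 5) 58 5]),
      .store 10 31 55, .store 11 31 45]) .skip,
    .load 59 9 31, .op .bxor 33 33 59, .store 9 31 5, .op .add 31 31 4]

/-- The column arrays of structure `d` as a state of `ColInv`. -/
abbrev ColAt (L : ℕ) (P : ℕ → Prop) (base q d : ℕ) (σ : AState) : Prop :=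
  ColInv L P base q (σ.mem (d + 2)) (σ.mem (d + 3)) (σ.mem (d + 4)) (σ.mem (d + 5)) (σ.mem (d + 6))

/-- The pointer to column `c` of structure `d` is `base`. -/
def PtrAt (w d c base : ℕ) (σ : AState) : Prop :=
  σ.mem d c = base / 2 ^ w ∧ σ.mem (d + 1) c = base % 2 ^ w

/-- The column arrays of structure `d` are unchanged at the addresses in `S`. -/
def ColFrame (S : ℕ → Prop) (d : ℕ) (σ σ' : AState) : Prop :=
  ∀ x, S x → σ'.mem (d + 2) x = σ.mem (d + 2) x ∧ σ'.mem (d + 3) x = σ.mem (d + 3) x ∧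
    σ'.mem (d + 4) x = σ.mem (d + 4) x ∧ σ'.mem (d + 5) x = σ.mem (d + 5) x ∧
    σ'.mem (d + 6) x = σ.mem (d + 6) x

/-- The program realises `ColInv.step` or `ColInv.step_empty`. Arrays `10` and `11` keep, for each
column, the numbers of one bits and of nonempty rows so far; array `9` holds the mark word, which is
removed from the current word and cleared for the next row. Only the block of the column is touched,
so the other columns survive. -/
theorem step_spec (hp : Par w H m n₀ L lam) {d : ℕ} (hd : d = 20 ∨ d = 30) {σ : AState}
    (hg : Glob m n₀ L lam σ) (ht : PopTab L (σ.mem 1)) {P : ℕ → Prop} {n lo u q cur mk base : ℕ}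
    (hn : n ≤ m) (hP : ∀ p, P p → p < n) (hlo : lo ≤ m) (hu : u ≤ m) (hlou : lo + u ≤ m)
    (hq : q ≤ n / L)
    (h11 : σ.reg 11 = lo) (h31 : σ.reg 31 = u) (h32 : σ.reg 32 = q) (h33 : σ.reg 33 = cur)
    (hptr : PtrAt w d (lo + u) base σ) (hb1 : base + n / L < H * 2 ^ w)
    (hb2 : base + n / L < 2 ^ w * 2 ^ w)
    (hcol : ColAt L P base q d σ) (hcur : IsBW L P q cur)
    (h10 : σ.mem 10 u = cnt P (q * L)) (hm11 : σ.mem 11 u = cnt (NER L P) q)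
    (h9 : σ.mem 9 u = mk) (hmk : mk < 2 ^ L) :
    Post w H (stepBody d) σ 50 (fun σ' => ColAt L P base (q + 1) d σ' ∧
      σ'.mem 10 u = cnt P ((q + 1) * L) ∧ σ'.mem 11 u = cnt (NER L P) (q + 1) ∧ σ'.mem 9 u = 0 ∧
      σ'.reg 33 = cur ^^^ mk ∧ σ'.reg 31 = u + 1 ∧
      ColFrame (fun x => x < base ∨ base + n / L < x) d σ σ' ∧
      ∀ u', u' ≠ u → σ'.mem 9 u' = σ.mem 9 u' ∧ σ'.mem 10 u' = σ.mem 10 u' ∧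
        σ'.mem 11 u' = σ.mem 11 u') := by
  have hmw := hp.hmw
  have hH := hp.le_H
  have h4 := hp.four_le
  have hlam := hp.lam_lt
  have hL2 := hp.L_lt
  have hpow := hp.pow_le
  have hpos := hp.pos
  have hqn : n / L ≤ n := Nat.div_le_self _ _
  obtain ⟨g0, g1, g2, g3, g4, g5⟩ := hg
  have hc : cnt P (q * L) ≤ n := cnt_le_of_support hP
  have hc' : cnt P ((q + 1) * L) ≤ n := cnt_le_of_support hP
  have he : cnt (NER L P) q ≤ q := cnt_le
  have hcd : cnt P (q * L) / L ≤ n / L := Nat.div_le_div_right hc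
  have hcd' : cnt P ((q + 1) * L) / L ≤ n / L := Nat.div_le_div_right hc'
  have hmod := Nat.mod_lt (cnt P (q * L)) hpos
  have hpw : 2 ^ (cnt P (q * L) % L) < 2 ^ L := Nat.pow_lt_pow_right (by norm_num) hmod
  have hmark := (hcol.mark _ le_rfl).1
  have hbase1 : base / 2 ^ w < 2 ^ w := Nat.div_lt_of_lt_mul (by omega)
  have hbase2 : base % 2 ^ w < 2 ^ w := Nat.mod_lt _ (by positivity)
  have hbase : base / 2 ^ w * 2 ^ w + base % 2 ^ w = base := by
    rw [mul_comm]; exact Nat.div_add_mod _ _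
  have hxor : cur ^^^ mk < 2 ^ L := Nat.xor_lt_two_pow hcur.1 hmk
  have hcurlt := hcur.1
  have hpc := hcur.pc_eq
  obtain ⟨hp1, hp2⟩ := hptr
  have hner0 : cur = 0 → cnt P ((q + 1) * L) = cnt P (q * L) ∧
      cnt (NER L P) (q + 1) = cnt (NER L P) q := by
    intro h0
    have hno : ¬ NER L P q := by rintro ⟨i, hi, hx⟩; exact hcur.eq_zero_iff.1 h0 i hi hx
    exact ⟨cnt_row_of_not_NER hno, cnt_succ_neg hno⟩
  have hner1 : cur ≠ 0 → cnt (NER L P) (q + 1) = cnt (NER L P) q + 1 := by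
    intro h0
    apply cnt_succ_pos
    by_contra hn
    exact h0 (hcur.eq_zero_iff.2 fun i hi hp => hn ⟨i, hi, hp⟩)
  have hnern : cnt (NER L P) (q + 1) ≤ n := by
    rw [← cnt_start]; exact cnt_le.trans hc'
  -- With numerals for the arrays, the simplifier can decide which of them coincide.
  rcases hd with rfl | rfl
  all_goals
    refine Post.wp (by decide) ?_
    simp only [Nat.reduceAdd] at hp1 hp2 hcol hmark
    simp only [stepBody, block, wp, AOp.Valid, AOp.val, AState.set_reg, AState.set_mem,
      AState.setMem_reg, Nat.reduceEqDiff, reduceIte, true_and, and_true, false_and,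
      AState.setMem_mem, g0, g1, g2, g3, g4, g5, h11, h31, h32, h33, Nat.reduceAdd, ColFrame, ← hp.hL]
    refine ⟨by omega, fun v hv => ⟨by omega, fun v2 hv2 => ⟨by omega, fun v3 hv3 => ?_⟩⟩⟩
    rw [hv, hp1] at hv2
    rw [hv, hp2] at hv3
    refine ⟨by omega, fun v4 hv4 => ?_⟩
    rw [hv2, hv3, hbase] at hv4
    subst hv4
    refine ⟨by omega, fun v5 hv5 => ⟨by omega, fun v6 hv6 => ?_⟩⟩
    rw [h10] at hv5
    rw [hm11] at hv6
    refine ⟨by omega, fun v7 hv7 => ⟨by omega, by omega, by omega, by omega, by omega,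
      fun v8 hv8 => ⟨fun hne => ?_, fun h0 => ?_⟩⟩⟩
    · refine ⟨by omega, fun v9 hv9 => ⟨by omega, by omega, by omega, fun v10 hv10 v11 hv11 =>
        ⟨by omega, fun v12 hv12 => ?_⟩⟩⟩
      rw [hv11, hp.and_mask, hv5] at hv12
      refine ⟨by rw [hv12]; omega, fun v13 hv13 => ?_⟩
      rw [hv5] at hv8
      rw [hv8]
      refine ⟨by omega, fun v14 hv14 => ⟨by omega, fun v15 hv15 => ?_⟩⟩
      rw [hv14] at hv15
      rw [hv12, one_mul] at hv13
      refine ⟨by rw [hv15, hv13]; omega, fun v16 hv16 => ⟨by omega, ?_, by omega, fun v17 hv17 => ?_⟩⟩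
      · rw [hv16, hv15, hv13]
        exact (Nat.or_lt_two_pow hmark hpw).trans_le (by omega)
      rw [ht _ hcurlt] at hv17
      refine ⟨by omega, fun v18 hv18 => ?_⟩
      have h18 : v18 = cnt P ((q + 1) * L) := by omega
      refine ⟨by omega, fun v19 hv19 v20 hv20 => ⟨fun hne2 => ?_, fun h02 => ?_⟩⟩
      · have hno : cnt P ((q + 1) * L) / L = cnt P (q * L) / L := by
          rw [hv19, h18] at hv20
          by_contra hcc
          rw [if_neg hcc] at hv20
          exact hne2 hv20
        refine ⟨by omega, by omega, by omega, by omega, by omega, fun v21 hv21 => ?_⟩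
        rw [h9] at hv21
        refine ⟨by omega, fun v22 hv22 => ⟨by omega, by omega, by omega, fun v23 hv23 => ⟨?_, h18,
          by rw [hner1 hne]; omega, by rw [hv22, hv21], hv23, ?_, ?_⟩⟩⟩
        · refine hcol.step hpos hcur hne (fun x => ?_) (fun x => ?_) (fun x => ?_) (fun x => ?_)
            (fun x => ?_)
          · simp [AState.setMem_mem, hv7]
          · simp [AState.setMem_mem, hv7, hv5]
          · simp [AState.setMem_mem, hv9, hv6]
          · simp [AState.setMem_mem, hv14, hno, hv16, hv15, hv13]
          · simp [AState.setMem_mem, hno]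
        · intro x hx
          refine ⟨if_neg (by omega), if_neg (by omega), if_neg (by omega), if_neg (by omega)⟩
        · intro u' hu'
          exact ⟨if_neg hu', if_neg hu', if_neg hu'⟩
      · have hno : cnt P ((q + 1) * L) / L ≠ cnt P (q * L) / L := by
          rw [hv19, h18] at hv20
          intro hcc
          rw [if_pos hcc] at hv20
          omega
        rw [h18] at hv19
        refine ⟨by omega, fun v21 hv21 => ⟨by omega, by omega, by omega, by omega, by omega, by omega,
          by omega, by omega, by omega, fun v22 hv22 => ?_⟩⟩
        rw [h9] at hv22
        refine ⟨by omega, fun v23 hv23 => ⟨by omega, by omega, by omega, fun v24 hv24 => ⟨?_, h18,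
          by rw [hner1 hne]; omega, by rw [hv23, hv22], hv24, ?_, ?_⟩⟩⟩
        · refine hcol.step hpos hcur hne (fun x => ?_) (fun x => ?_) (fun x => ?_) (fun x => ?_)
            (fun x => ?_)
          · simp [AState.setMem_mem, hv7]
          · simp [AState.setMem_mem, hv7, hv5]
          · simp [AState.setMem_mem, hv9, hv6]
          · simp [AState.setMem_mem, hv14, hno, hv16, hv15, hv13, hv21, hv19]
          · simp [AState.setMem_mem, hno, hv21, hv19, hv10, hv6]
        · intro x hx
          refine ⟨if_neg (by omega), if_neg (by omega), if_neg (by omega), ?_, if_neg (by omega)⟩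
          rw [if_neg (by omega), if_neg (by omega)]
        · intro u' hu'
          exact ⟨if_neg hu', if_neg hu', if_neg hu'⟩
    · obtain ⟨e1, e2⟩ := hner0 h0
      refine ⟨by omega, fun v21 hv21 => ?_⟩
      rw [h9] at hv21
      refine ⟨by omega, fun v22 hv22 => ⟨by omega, by omega, by omega, fun v23 hv23 => ⟨?_, by omega,
        by omega, by rw [hv22, hv21], hv23, ?_, ?_⟩⟩⟩
      · refine hcol.step_empty hcur h0 (fun x => ?_) (fun x => ?_)
        · simp [AState.setMem_mem, hv7]
        · simp [AState.setMem_mem, hv7, hv5]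
      · intro x hx
        exact ⟨if_neg (by omega), if_neg (by omega)⟩
      · intro u' hu'
        exact if_neg hu'

end PagedRAM

/-! ## Building the columns of a sequence -/

namespace PagedRAM

variable {w H m n₀ L lam : ℕ}

theorem ColInv.of_frame {P : ℕ → Prop} {S : ℕ → Prop} {base q d n : ℕ} {σ σ' : AState}
    (h : ColAt L P base q d σ) (hf : ColFrame S d σ σ') (hL : 0 < L) (hP : ∀ p, P p → p < n)
    (hq : q ≤ n / L + 1) (hS : ∀ k ≤ n / L, S (base + k)) : ColAt L P base q d σ' := by
  refine ColInv.congr h (n := n) ?_ hL hP (fun k hk => (hf _ (hS k hk)).1)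
    (fun k hk => (hf _ (hS k hk)).2.1) (fun k hk => (hf _ (hS k hk)).2.2.1)
    (fun k hk => (hf _ (hS k hk)).2.2.2.1) (fun k hk => (hf _ (hS k hk)).2.2.2.2)
  have h1 := Nat.mul_le_mul_right L hq
  have h2 := Nat.div_mul_le_self n L
  rw [add_mul, one_mul] at h1
  omega

theorem ColFrame.trans {S : ℕ → Prop} {d : ℕ} {σ σ₁ σ₂ : AState} (h : ColFrame S d σ σ₁)
    (h' : ColFrame S d σ₁ σ₂) : ColFrame S d σ σ₂ := fun x hx => by
  obtain ⟨a1, a2, a3, a4, a5⟩ := h x hx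
  obtain ⟨b1, b2, b3, b4, b5⟩ := h' x hx
  exact ⟨b1.trans a1, b2.trans a2, b3.trans a3, b4.trans a4, b5.trans a5⟩

theorem ColFrame.mono {S S' : ℕ → Prop} {d : ℕ} {σ σ₁ : AState} (h : ColFrame S d σ σ₁)
    (hS : ∀ x, S' x → S x) : ColFrame S' d σ σ₁ := fun x hx => h x (hS x hx)

theorem PtrAt.of_agree {rs as : List ℕ} {d c base : ℕ} {σ σ' : AState} (h : PtrAt w d c base σ)
    (ha : Agree rs as σ σ') (h1 : d ∉ as) (h2 : d + 1 ∉ as) : PtrAt w d c base σ' := by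
  refine ⟨?_, ?_⟩
  · rw [ha.2 d h1]; exact h.1
  · rw [ha.2 _ h2]; exact h.2

/-! ### Allocation of the columns -/

/-- Allocate column `reg 31`. -/
def allocBody (d : ℕ) : Stmt :=
  block [.op .add 40 11 31, .op .high 41 8 8, .op .low 42 8 8, .store d 40 41, .store (d + 1) 40 42,
    .store (d + 5) 8 5, .store (d + 6) 8 5, .store 10 31 5, .store 11 31 5, .store 9 31 5,
    .op .add 8 8 12, .op .add 8 8 4, .op .add 31 31 4]

/-- Each column gets a block of `rows` consecutive cells in all five arrays. Of these, only the
first mark word and mark rank have to be cleared, as `ColInv.init` requires. -/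
theorem alloc_spec (hp : Par w H m n₀ L lam) {d : ℕ} (hd : d = 20 ∨ d = 30) {σ : AState}
    (hg : Glob m n₀ L lam σ) {al rows b lo : ℕ} (hr : σ.reg 12 + 1 = rows) (h8 : σ.reg 8 = al)
    (h11 : σ.reg 11 = lo) (hlob : lo + b ≤ m) (h22 : σ.reg 22 = b) (h31 : σ.reg 31 = 0)
    (hf1 : al + b * rows ≤ H * 2 ^ w) (hf2 : al + b * rows < 2 ^ w * 2 ^ w) :
    Post w H (forN 22 (allocBody d)) σ (b * (20 + 3) + 1) (fun σ' => σ'.reg 8 = al + b * rows ∧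
      (∀ u < b, PtrAt w d (lo + u) (al + u * rows) σ' ∧ σ'.mem (d + 5) (al + u * rows) = 0 ∧
        σ'.mem (d + 6) (al + u * rows) = 0 ∧ σ'.mem 9 u = 0 ∧ σ'.mem 10 u = 0 ∧ σ'.mem 11 u = 0) ∧
      ColFrame (fun x => x < al) d σ σ' ∧
      ∀ c < lo, σ'.mem d c = σ.mem d c ∧ σ'.mem (d + 1) c = σ.mem (d + 1) c) := by
  have hw := hp.hw
  have hmw := hp.hmw
  have hH := hp.le_H
  have h4 := hp.four_le
  refine (Post.forN b 20 (fun i σ' => σ'.reg 31 = i ∧ σ'.reg 8 = al + i * rows ∧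
      (∀ u < i, PtrAt w d (lo + u) (al + u * rows) σ' ∧ σ'.mem (d + 5) (al + u * rows) = 0 ∧
        σ'.mem (d + 6) (al + u * rows) = 0 ∧ σ'.mem 9 u = 0 ∧ σ'.mem 10 u = 0 ∧ σ'.mem 11 u = 0) ∧
      ColFrame (fun x => x < al) d σ σ' ∧
      ∀ c < lo, σ'.mem d c = σ.mem d c ∧ σ'.mem (d + 1) c = σ.mem (d + 1) c) hw
      (by simp [allocBody, block, Stmt.wr]) h22 ?_ ?_).mono le_rfl (fun σ' h => h.2)
  · exact ⟨h31, by simpa using h8, by simp, fun x _ => by simp, fun c _ => by simp⟩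
  rintro i hi σ₂ ag₂ ⟨l1, l2, l3, l4, l5⟩
  obtain ⟨g0, g1, g2, g3, g4, g5⟩ := hg.agree ag₂ (by
    rw [show (allocBody d).wr = [40, 41, 42, 8, 8, 31] from rfl]; decide)
  have h12 : σ₂.reg 12 = σ.reg 12 := ag₂.1 12 (by simp [allocBody, block, Stmt.wr])
  have h11' : σ₂.reg 11 = lo := (ag₂.1 11 (by simp [allocBody, block, Stmt.wr])).trans h11
  have hrow : al + i * rows + rows ≤ al + b * rows := by
    have := Nat.mul_le_mul_right rows (show i + 1 ≤ b from hi)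
    rw [add_mul, one_mul] at this; omega
  have hirow : (i + 1) * rows = i * rows + rows := by ring
  have hbase1 : (al + i * rows) / 2 ^ w < 2 ^ w := Nat.div_lt_of_lt_mul (by omega)
  have hbase2 : (al + i * rows) % 2 ^ w < 2 ^ w := Nat.mod_lt _ (by positivity)
  have hne : ∀ u < i, al + u * rows ≠ al + i * rows := by
    intro u hu h
    have := Nat.mul_le_mul_right rows (show u + 1 ≤ i from hu)
    rw [add_mul, one_mul] at this
    omega
  rcases hd with rfl | rfl
  all_goals
    refine Post.wp (by decide) ?_
    simp only [allocBody, block, wp, AOp.Valid, AOp.val, AState.set_reg, AState.set_mem,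
      AState.setMem_reg, Nat.reduceEqDiff, reduceIte, true_and, and_true, false_and,
      AState.setMem_mem, g0, g1, g2, g3, g4, g5, h11', h12, l1, l2, Nat.reduceAdd, ColFrame, PtrAt]
    refine ⟨by omega, fun v hv v2 hv2 v3 hv3 => ⟨by omega, by omega, by omega, by omega, by omega,
      by omega, by omega, by omega, by omega, by omega, by omega, by omega, by omega, by omega,
      by omega, fun v4 hv4 => ⟨by omega, fun v5 hv5 => ⟨by omega, fun v6 hv6 =>
        ⟨hv6, by omega, fun u hu => ?_, fun x hx => ?_, fun c hc => ?_⟩⟩⟩⟩⟩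
    · rcases Nat.lt_succ_iff_lt_or_eq.1 hu with hu | rfl
      · have h1 := hne u hu
        obtain ⟨⟨p1, p2⟩, p3, p4, p5, p6, p7⟩ := l3 u hu
        have h2 : ¬ lo + u = v := by omega
        have h3 : ¬ u = i := by omega
        simp only [h1, h2, h3, if_false]
        exact ⟨⟨p1, p2⟩, p3, p4, p5, p6, p7⟩
      · simp [hv, hv2, hv3]
    · have h1 : ¬ x = al + i * rows := by omega
      simp only [h1, if_false]
      exact l4 x hx
    · have h1 : ¬ c = v := by omega
      simp only [h1, if_false]
      exact l5 c hc

/-! ### The bit words of one row -/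

/-- Take in position `reg 35` of the sequence in array `arr`. -/
def fillBody (arr : ℕ) : Stmt :=
  block [.op .lt 36 35 9,
    .ite 36 (block [.op .shl 37 4 34, .op .bor 33 33 37, .load 38 arr 35, .op .lt 39 38 10,
      .ite 39 (block [.load 36 9 38, .op .bor 36 36 37, .store 9 38 36]) .skip]) .skip,
    .op .add 34 34 4, .op .add 35 35 4]

/-- Register `33` collects the word for threshold `0`, which consists of all existing positions, and
array `9` collects one word per value below `b`. Values from `b` on are left in all columns, so they
need no mark. The last row may stick out beyond `n`. -/
theorem fill_spec (hp : Par w H m n₀ L lam) {arr : ℕ} (harr : arr ≠ 9) {σ : AState}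
    (hg : Glob m n₀ L lam σ) {X : ℕ → ℕ} {n b q : ℕ} (hn : n ≤ m) (hX : ∀ p < n, σ.mem arr p = X p)
    (hb : b ≤ m) (h9 : σ.reg 9 = n) (h10 : σ.reg 10 = b) (h22 : σ.reg 22 = L)
    (h33 : σ.reg 33 = 0) (h34 : σ.reg 34 = 0) (h35 : σ.reg 35 = q * L) (hq : q * L ≤ n)
    (hm9 : ∀ u < b, σ.mem 9 u = 0) :
    Post w H (forN 22 (fillBody arr)) σ (L * (20 + 3) + 1) (fun σ' =>
      IsBW L (colP n X 0) q (σ'.reg 33) ∧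
      ∀ u < b, IsBW L (fun p => p < n ∧ X p = u) q (σ'.mem 9 u)) := by
  have hw := hp.hw
  have hmw := hp.hmw
  have hH := hp.le_H
  have h4 := hp.four_le
  have hL2 := hp.L_lt
  have hpow := hp.pow_le
  refine (Post.forN L 20 (fun i σ' => σ'.reg 34 = i ∧ σ'.reg 35 = q * L + i ∧
    IsBW L (fun p => p < n ∧ p < q * L + i) q (σ'.reg 33) ∧
    ∀ u < b, IsBW L (fun p => (p < n ∧ X p = u) ∧ p < q * L + i) q (σ'.mem 9 u)) hw
      (by simp [fillBody, block, Stmt.wr]) h22 ?_ ?_).mono le_rfl ?_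
  · refine ⟨h34, h35, ?_, fun u hu => ?_⟩
    · rw [h33]; exact IsBW.zero fun i hi h => by omega
    · rw [hm9 u hu]; exact IsBW.zero fun i hi h => by omega
  swap
  · rintro σ' ⟨-, -, l3, l4⟩
    refine ⟨l3.congr fun i hi => ?_, fun u hu => (l4 u hu).congr fun i hi => ?_⟩
    · simp [colP, hi]
    · simp [hi]
  rintro i hi σ₂ ag₂ ⟨l1, l2, l3, l4⟩
  obtain ⟨g0, g1, g2, g3, g4, g5⟩ := hg.agree ag₂ (by
    rw [show (fillBody arr).wr = [36, 37, 33, 38, 39, 36, 36, 34, 35] from rfl]; decide)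
  have h9' : σ₂.reg 9 = n := (ag₂.1 9 (by simp [fillBody, block, Stmt.wr])).trans h9
  have h10' : σ₂.reg 10 = b := (ag₂.1 10 (by simp [fillBody, block, Stmt.wr])).trans h10
  have hX' : ∀ p < n, σ₂.mem arr p = X p := fun p hp => by
    rw [ag₂.2 arr (by simpa [fillBody, block, Stmt.wa] using harr)]; exact hX p hp
  have hpw : 2 ^ i < 2 ^ L := Nat.pow_lt_pow_right (by norm_num) hi
  have hcur := l3.1
  refine Post.wp (by simp [fillBody, block, Stmt.size]) ?_
  simp only [fillBody, block, wp, AOp.Valid, AOp.val, AState.set_reg, AState.set_mem,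
    AState.setMem_reg, Nat.reduceEqDiff, reduceIte, true_and, and_true, false_and,
    AState.setMem_mem, g0, g1, g2, g3, g4, g5, h9', h10', l1, l2]
  intro v hv
  refine ⟨fun hne => ?_, fun he => ?_⟩
  · have hpn : q * L + i < n := by by_contra hc; rw [if_neg hc] at hv; exact hne hv
    refine ⟨by omega, fun v2 hv2 => ⟨by omega, fun v3 hv3 => ⟨by omega, fun v4 hv4 => ?_⟩⟩⟩
    rw [hX' _ hpn] at hv4
    have hbw : IsBW L (fun p => p < n ∧ p < q * L + (i + 1)) q v3 := by
      rw [hv3, hv2]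
      refine l3.set hi fun k hk => ?_
      constructor
      · rintro ⟨h1, h2⟩
        by_cases h3 : k = i
        · exact Or.inr h3
        · exact Or.inl ⟨h1, by omega⟩
      · rintro (⟨h1, h2⟩ | h1)
        · exact ⟨h1, by omega⟩
        · exact ⟨by omega, by omega⟩
    intro v5 hv5
    constructor
    · intro hne2
      have hXb : v4 < b := by by_contra hc; rw [if_neg hc] at hv5; exact hne2 hv5
      refine ⟨by omega, fun v6 hv6 => ?_⟩
      have hmk := l4 v4 hXb
      have hmk' : IsBW L (fun p => (p < n ∧ X p = v4) ∧ p < q * L + (i + 1)) q (v6 ||| v2) := by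
        rw [hv6, hv2]
        refine hmk.set hi fun k hk => ?_
        constructor
        · rintro ⟨⟨h1, h2⟩, h3⟩
          by_cases h4 : k = i
          · exact Or.inr h4
          · exact Or.inl ⟨⟨h1, h2⟩, by omega⟩
        · rintro (⟨⟨h1, h2⟩, h3⟩ | rfl)
          · exact ⟨⟨h1, h2⟩, by omega⟩
          · exact ⟨⟨hpn, hv4.symm⟩, by omega⟩
      refine ⟨⟨by rw [hv6]; have := hmk.1; omega, by omega⟩, fun v7 hv7 => ⟨by omega,
        by rw [hv7]; have := hmk'.1; omega, by omega, fun v8 hv8 => ⟨by omega, fun v9 hv9 =>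
          ⟨hv8, by omega, hbw, fun u hu => ?_⟩⟩⟩⟩
      split_ifs with h
      · rw [h, hv7]; exact hmk'
      · refine (l4 u hu).congr fun k hk => ?_
        constructor
        · rintro ⟨h1, h2⟩; exact ⟨h1, by omega⟩
        · rintro ⟨⟨h1, h1'⟩, h2⟩
          refine ⟨⟨h1, h1'⟩, ?_⟩
          by_contra h3
          have : k = i := by omega
          rw [this, ← hv4] at h1'
          omega
    · intro he2
      have hXb : ¬ v4 < b := by intro hc; rw [if_pos hc] at hv5; omega
      refine ⟨by omega, fun v8 hv8 => ⟨by omega, fun v9 hv9 =>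
          ⟨hv8, by omega, hbw, fun u hu => ?_⟩⟩⟩
      refine (l4 u hu).congr fun k hk => ?_
      constructor
      · rintro ⟨h1, h2⟩; exact ⟨h1, by omega⟩
      · rintro ⟨⟨h1, h1'⟩, h2⟩
        refine ⟨⟨h1, h1'⟩, ?_⟩
        by_contra h3
        have : k = i := by omega
        rw [this, ← hv4] at h1'
        omega
  · have hpn : ¬ q * L + i < n := by intro hc; rw [if_pos hc] at hv; omega
    refine ⟨by omega, fun v8 hv8 => ⟨by omega, fun v9 hv9 =>
      ⟨hv8, by omega, l3.congr fun k hk => ?_, fun u hu => (l4 u hu).congr fun k hk => ?_⟩⟩⟩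
    · constructor
      · rintro ⟨h1, h2⟩; exact ⟨h1, by omega⟩
      · rintro ⟨h1, h2⟩; exact ⟨h1, by omega⟩
    · constructor
      · rintro ⟨h1, h2⟩; exact ⟨h1, by omega⟩
      · rintro ⟨h1, h2⟩; exact ⟨h1, by omega⟩

/-! ### The sweep over the thresholds -/

theorem stepBody_wa {d : ℕ} : (stepBody d).wa =
    [d + 2, d + 3, d + 4, d + 5, d + 6, d + 5, 10, 11, 9] := rfl

/-- The column invariants during the sweep of row `q` at column `u`. -/
structure SweepInv (L n b al lo u q d : ℕ) (X : ℕ → ℕ) (σ₀ σ : AState) : Prop where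
  r31 : σ.reg 31 = u
  cur : IsBW L (colP n X u) q (σ.reg 33)
  col : ∀ u' < b, ColAt L (colP n X u') (al + u' * (n / L + 1)) (if u' < u then q + 1 else q) d σ ∧
    σ.mem 10 u' = cnt (colP n X u') ((if u' < u then q + 1 else q) * L) ∧
    σ.mem 11 u' = cnt (NER L (colP n X u')) (if u' < u then q + 1 else q)
  done : ∀ u' < u, u' < b → σ.mem 9 u' = 0
  todo : ∀ u' < b, u ≤ u' → IsBW L (fun p => p < n ∧ X p = u') q (σ.mem 9 u')
  frame : ColFrame (fun x => x < al) d σ₀ σ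

/-- The word for `u + 1` is the word for `u` without the positions of value exactly `u`. So all
columns advance by one row in time linear in their number. -/
theorem sweep_spec (hp : Par w H m n₀ L lam) {d : ℕ} (hd : d = 20 ∨ d = 30) {σ₀ σ : AState}
    (hg : Glob m n₀ L lam σ) (ht : PopTab L (σ.mem 1)) {X : ℕ → ℕ} {n b q al lo : ℕ} (hn : n ≤ m)
    (hlob : lo + b ≤ m) (h11 : σ.reg 11 = lo) (h22 : σ.reg 22 = b) (h32 : σ.reg 32 = q)
    (hq : q ≤ n / L) (hptr : ∀ u < b, PtrAt w d (lo + u) (al + u * (n / L + 1)) σ)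
    (hf1 : al + b * (n / L + 1) ≤ H * 2 ^ w) (hf2 : al + b * (n / L + 1) < 2 ^ w * 2 ^ w)
    (hI : SweepInv L n b al lo 0 q d X σ₀ σ) :
    Post w H (forN 22 (stepBody d)) σ (b * (50 + 3) + 1) (SweepInv L n b al lo b q d X σ₀) := by
  have hw := hp.hw
  have hpos := hp.pos
  have hwr : (stepBody d).wr = (stepBody 20).wr := rfl
  refine Post.forN b 50 (fun u σ' => SweepInv L n b al lo u q d X σ₀ σ') hw
      (by rw [hwr]; decide) h22 hI ?_
  rintro u hu σ₂ ag₂ ⟨l1, l2, l3, l4, l5, l6⟩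
  have hg₂ := hg.agree ag₂ (by rw [hwr]; decide)
  have hmem : ∀ a, a = d ∨ a = d + 1 ∨ a = 1 → a ∉ (stepBody d).wa := by
    intro a ha; rw [stepBody_wa]; simp; omega
  obtain ⟨c1, c2, c3⟩ := l3 u hu
  rw [if_neg (lt_irrefl u)] at c1 c2 c3
  have hrow : al + u * (n / L + 1) + (n / L + 1) ≤ al + b * (n / L + 1) := by
    have := Nat.mul_le_mul_right (n / L + 1) (show u + 1 ≤ b from hu)
    rw [add_mul, one_mul] at this; omega
  have hmk := l5 u hu le_rfl
  have hagr : Agree (99 :: 22 :: (stepBody d).wr) (stepBody d).wa σ₂ ((σ₂.set 99 1).set 22 (b - 1 - u)) := by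
    refine ⟨fun r hr => ?_, fun _ _ => rfl⟩
    simp only [List.mem_cons, not_or] at hr
    simp [hr.1, hr.2.1]
  refine (step_spec hp hd (σ := (σ₂.set 99 1).set 22 (b - 1 - u)) (P := colP n X u) (lo := lo) (u := u) (q := q) (cur := σ₂.reg 33)
    (mk := σ₂.mem 9 u) (base := al + u * (n / L + 1))
    (hg₂.agree hagr (by rw [hwr]; decide)) ?_ hn (fun p h => h.1) (by omega) (by omega) (by omega) hq ?_ ?_ ?_ ?_ ?_
    (by omega) (by omega) ?_ ?_ ?_ ?_ ?_ hmk.1).mono le_rfl ?_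
  · simp only [AState.set_mem]; rw [ag₂.2 1 (hmem 1 (by simp))]; exact ht
  · simp; exact (ag₂.1 11 (by rw [hwr]; decide)).trans h11
  · simpa using l1
  · simp; exact (ag₂.1 32 (by rw [hwr]; decide)).trans h32
  · simp
  · show PtrAt w d (lo + u) (al + u * (n / L + 1)) σ₂
    exact (hptr u hu).of_agree ag₂ (hmem _ (by simp)) (hmem _ (by simp))
  · exact c1
  · exact l2
  · exact c2
  · exact c3
  · rfl
  rintro σ₃ ⟨r1, r2, r3, r4, r5, r6, r7, r8⟩
  simp only [AState.set_mem] at r8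
  refine ⟨r6, ?_, fun u' hu' => ?_, fun u' hu' hb' => ?_, fun u' hu' hle => ?_, ?_⟩
  · rw [r5]
    refine l2.xor hmk (fun k hk => ?_) (fun k hk h => ?_)
    · simp only [colP]
      constructor
      · rintro ⟨h1, h2⟩; exact ⟨⟨h1, by omega⟩, fun h => by omega⟩
      · rintro ⟨⟨h1, h2⟩, h3⟩
        refine ⟨h1, ?_⟩
        by_contra hc
        exact h3 ⟨h1, by omega⟩
    · exact ⟨h.1, h.2.ge⟩
  · by_cases hue : u' = u
    · subst hue
      rw [if_pos (by omega)]
      exact ⟨r1, r2, r3⟩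
    · obtain ⟨d1, d2, d3⟩ := l3 u' hu'
      have hif : (if u' < u + 1 then q + 1 else q) = if u' < u then q + 1 else q := by
        split_ifs <;> omega
      rw [hif]
      obtain ⟨s1, s2, s3⟩ := r8 u' hue
      refine ⟨?_, by rw [s2, d2], by rw [s3, d3]⟩
      refine ColInv.of_frame (n := n) (σ := (σ₂.set 99 1).set 22 (b - 1 - u)) d1 r7 hpos (fun p h => h.1) (by split_ifs <;> omega) ?_
      intro k hk
      rcases Nat.lt_or_gt_of_ne hue with h | h
      · left
        have := Nat.mul_le_mul_right (n / L + 1) (show u' + 1 ≤ u from h)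
        rw [add_mul, one_mul] at this; omega
      · right
        have := Nat.mul_le_mul_right (n / L + 1) (show u + 1 ≤ u' from h)
        rw [add_mul, one_mul] at this; omega
  · by_cases hue : u' = u
    · rw [hue]; exact r4
    · rw [(r8 u' hue).1]; exact l4 u' (by omega) hb'
  · rw [(r8 u' (by omega)).1]; exact l5 u' hu' (by omega)
  · exact l6.trans (r7.mono fun x hx => Or.inl (by omega))

def rowBody (d arr : ℕ) : Stmt :=
  .seq (block [.const 33 0, .const 34 0, .op .shl 35 32 2, .op .mov 22 3 3])
    (.seq (forN 22 (fillBody arr)) (.seq (block [.const 31 0, .op .mov 22 10 10])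
      (.seq (forN 22 (stepBody d)) (.op .add 32 32 4))))

/-- Build the columns `0, …, reg 10 - 1` of the sequence in array `arr`, of length `reg 9`, as the
columns from number `reg 11` on of structure `d`. -/
def buildProg (d arr : ℕ) : Stmt :=
  .seq (block [.op .shr 12 9 2, .const 31 0, .op .mov 22 10 10]) (.seq (forN 22 (allocBody d))
    (.seq (block [.const 32 0, .op .add 21 12 4]) (forN 21 (rowBody d arr))))

theorem rowBody_wr (d arr : ℕ) : (rowBody d arr).wr = (rowBody 20 8).wr := rfl

theorem rowBody_wa (d arr : ℕ) : (rowBody d arr).wa =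
    [9, d + 2, d + 3, d + 4, d + 5, d + 6, d + 5, 10, 11, 9] := rfl

theorem buildProg_wa (d arr : ℕ) : (buildProg d arr).wa =
    [d, d + 1, d + 5, d + 6, 10, 11, 9, 9, d + 2, d + 3, d + 4, d + 5, d + 6, d + 5, 10, 11, 9] := rfl

/-- Every row costs `L` for reading the elements and `b` for the sweep. The allocation pointer moves
on by whole blocks, and older columns, below the pointer, are untouched. -/
theorem build_spec (hp : Par w H m n₀ L lam) {d arr : ℕ} (hd : d = 20 ∨ d = 30)
    (harr : arr = 5 ∨ arr = 8) {σ : AState}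
    (hg : Glob m n₀ L lam σ) (ht : PopTab L (σ.mem 1)) {X : ℕ → ℕ} {n b al lo : ℕ} (hn : n ≤ m)
    (hlob : lo + b ≤ m) (h8 : σ.reg 8 = al) (h9 : σ.reg 9 = n) (h10 : σ.reg 10 = b)
    (h11 : σ.reg 11 = lo) (hX : ∀ p < n, σ.mem arr p = X p)
    (hf1 : al + b * (n / L + 1) ≤ H * 2 ^ w) (hf2 : al + b * (n / L + 1) < 2 ^ w * 2 ^ w) :
    Post w H (buildProg d arr) σ (100 * ((n / L + 1) * (L + b + 1))) (fun σ' =>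
      σ'.reg 8 = al + b * (n / L + 1) ∧
      (∀ u < b, PtrAt w d (lo + u) (al + u * (n / L + 1)) σ' ∧
        ColAt L (colP n X u) (al + u * (n / L + 1)) (n / L + 1) d σ') ∧
      ColFrame (fun x => x < al) d σ σ' ∧
      ∀ c < lo, σ'.mem d c = σ.mem d c ∧ σ'.mem (d + 1) c = σ.mem (d + 1) c) := by
  have hw := hp.hw
  have hmw := hp.hmw
  have hH := hp.le_H
  have h4 := hp.four_le
  have hm := hp.hm
  have hpos := hp.pos
  have hlam := hp.lam_lt
  have hL2 := hp.L_lt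
  have hqn : n / L ≤ n := Nat.div_le_self _ _
  have hqL := Nat.div_mul_le_self n L
  have hT : 4 + ((b * (20 + 3) + 1) + (3 + ((n / L + 1) * ((5 + ((L * (20 + 3) + 1) +
      (3 + ((b * (50 + 3) + 1) + 1)))) + 3) + 1))) ≤ 100 * ((n / L + 1) * (L + b + 1)) := by
    generalize n / L = r
    nlinarith [Nat.zero_le (r * b), Nat.zero_le (r * L)]
  refine Post.mono (Post.seq (T₁ := 4) (Q₁ := fun σ' => σ'.reg 12 = n / L ∧ σ'.reg 31 = 0 ∧
    σ'.reg 22 = b) (Post.wp (by decide) ?_) ?_) hT (fun _ h => h)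
  · simp only [block, wp, AOp.Valid, AOp.val, AState.set_reg, AState.set_mem, AState.setMem_reg,
      Nat.reduceEqDiff, reduceIte, true_and, and_true, hg.r2, h9, h10, forall_eq, ← hp.hL]
    omega
  rintro σ₁ ⟨k1, k2, k3⟩ ag₁
  have hg₁ := hg.agree ag₁ (by decide)
  have hm₁ : σ₁.mem = σ.mem := funext fun a => ag₁.2 a (by simp [block, Stmt.wa])
  refine Post.seq (alloc_spec hp hd hg₁ (al := al) (rows := n / L + 1) (b := b) (lo := lo) (by omega)
    ((ag₁.1 8 (by decide)).trans h8) ((ag₁.1 11 (by decide)).trans h11) hlob k3 k2 hf1 hf2) ?_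
  rintro σ₂ ⟨p1, p2, p3, p4⟩ ag₂
  have hwrA : (allocBody d).wr = [40, 41, 42, 8, 8, 31] := rfl
  have hwaA : (forN 22 (allocBody d)).wa = [d, d + 1, d + 5, d + 6, 10, 11, 9] := rfl
  have hg₂ := hg₁.agree ag₂ (by
    show ∀ r < 6, r ∉ 99 :: 22 :: (allocBody d).wr
    rw [hwrA]; decide)
  have hreg₂ : ∀ r, r = 9 ∨ r = 10 ∨ r = 11 ∨ r = 12 → σ₂.reg r = σ₁.reg r := by
    intro r hr
    refine ag₂.1 r ?_
    show r ∉ 99 :: 22 :: (allocBody d).wr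
    rw [hwrA]
    simp; omega
  have hmem₂ : ∀ a, a = 1 ∨ a = arr → σ₂.mem a = σ.mem a := by
    intro a ha
    rw [ag₂.2 a (by rw [hwaA]; simp; omega), hm₁]
  refine Post.seq (T₁ := 3) (Q₁ := fun σ' => σ'.reg 32 = 0 ∧ σ'.reg 21 = n / L + 1)
    (Post.wp (by decide) ?_) ?_
  · simp only [block, wp, AOp.Valid, AOp.val, AState.set_reg, AState.set_mem, AState.setMem_reg,
      Nat.reduceEqDiff, reduceIte, true_and, and_true, hg₂.r4, hreg₂ 12 (by simp), k1, forall_eq]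
    omega
  rintro σ₃ ⟨q1, q2⟩ ag₃
  have hg₃ := hg₂.agree ag₃ (by decide)
  have hm₃ : σ₃.mem = σ₂.mem := funext fun a => ag₃.2 a (by simp [block, Stmt.wa])
  have hr9 : σ₃.reg 9 = n := by
    rw [ag₃.1 9 (by decide), hreg₂ 9 (by simp), ag₁.1 9 (by decide), h9]
  have hr10 : σ₃.reg 10 = b := by
    rw [ag₃.1 10 (by decide), hreg₂ 10 (by simp), ag₁.1 10 (by decide), h10]
  have hr11 : σ₃.reg 11 = lo := by
    rw [ag₃.1 11 (by decide), hreg₂ 11 (by simp), ag₁.1 11 (by decide), h11]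
  have hmemd : d ∉ (rowBody d arr).wa ∧ d + 1 ∉ (rowBody d arr).wa ∧ 1 ∉ (rowBody d arr).wa ∧
      arr ∉ (rowBody d arr).wa := by
    rw [rowBody_wa]; simp; omega
  refine (Post.with_agree (Post.forN (n / L + 1) _ (fun q σ' => σ'.reg 32 = q ∧
    (∀ u < b, ColAt L (colP n X u) (al + u * (n / L + 1)) q d σ' ∧
      σ'.mem 10 u = cnt (colP n X u) (q * L) ∧ σ'.mem 11 u = cnt (NER L (colP n X u)) q ∧
      σ'.mem 9 u = 0) ∧ ColFrame (fun x => x < al) d σ σ') hw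
      (by rw [rowBody_wr]; decide) q2 ?_ ?_)).mono le_rfl ?_
  · refine ⟨q1, fun u hu => ?_, ?_⟩
    · obtain ⟨e1, e2, e3, e4, e5, e6⟩ := p2 u hu
      simp only [ColAt, hm₃]
      exact ⟨ColInv.init e2 e3, by simp [e5], by simp [e6], e4⟩
    · intro x hx
      rw [hm₃, ← hm₁]
      exact p3 x hx
  swap
  · rintro σ' ⟨⟨s1, s2, s3⟩, ag⟩
    replace ag : Agree (99 :: 21 :: (rowBody d arr).wr) (rowBody d arr).wa σ₃ σ' := ag
    refine ⟨?_, fun u hu => ⟨?_, (s2 u hu).1⟩, s3, fun c hc => ?_⟩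
    · rw [ag.1 8 (by rw [rowBody_wr]; decide), ag₃.1 8 (by decide), p1]
    · refine PtrAt.of_agree (σ := σ₂) (p2 u hu).1 (rs := 32 :: 21 :: 99 :: 21 :: (rowBody d arr).wr)
        (as := (rowBody d arr).wa) ?_ hmemd.1 hmemd.2.1
      refine ⟨fun r hr => ?_, fun a ha => by rw [ag.2 a ha, hm₃]⟩
      simp only [List.mem_cons, not_or] at hr
      rw [ag.1 r (by simp; tauto), ag₃.1 r (by simp [block, Stmt.wr]; tauto)]
    · rw [ag.2 _ hmemd.1, ag.2 _ hmemd.2.1, hm₃, ← hm₁]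
      exact p4 c hc
  rintro q hq σ₄ ag₄ ⟨l1, l2, l3⟩
  have hg₄ := hg₃.agree ag₄ (by rw [rowBody_wr]; decide)
  have hq' : q ≤ n / L := by omega
  have hqLn : q * L ≤ n := (Nat.mul_le_mul_right L hq').trans hqL
  refine Post.seq (T₁ := 5) (Q₁ := fun σ' => σ'.reg 33 = 0 ∧ σ'.reg 34 = 0 ∧ σ'.reg 35 = q * L ∧
    σ'.reg 22 = L ∧ σ'.reg 32 = q ∧ σ'.reg 9 = n ∧ σ'.reg 10 = b ∧ σ'.reg 11 = lo ∧
    σ'.mem = σ₄.mem ∧ Glob m n₀ L lam σ') (Post.wp (by decide) ?_) ?_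
  · simp only [block, wp, AOp.Valid, AOp.val, AState.set_reg, AState.set_mem, AState.setMem_reg,
      Nat.reduceEqDiff, reduceIte, true_and, and_true, hg₄.r2, hg₄.r3, l1, forall_eq, ← hp.hL,
      ag₄.1 9 (by rw [rowBody_wr]; decide), ag₄.1 10 (by rw [rowBody_wr]; decide),
      ag₄.1 11 (by rw [rowBody_wr]; decide), hr9, hr10, hr11]
    refine ⟨by omega, by omega, by omega, ?_⟩
    constructor <;> simp [hg₄.r0, hg₄.r1, hg₄.r2, hg₄.r3, hg₄.r4, hg₄.r5]
  rintro σ₅ ⟨e1, e2, e3, e4, e5, e6, e7, e8, e9, hg₅⟩ -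
  have hX₅ : ∀ p < n, σ₅.mem arr p = X p := by
    intro p hp
    rw [e9, ag₄.2 arr hmemd.2.2.2, hm₃, hmem₂ arr (Or.inr rfl)]
    exact hX p hp
  refine Post.seq (fill_spec hp (by omega) hg₅ (X := X) (n := n) (b := b) (q := q) hn hX₅
    (by omega) e6 e7 e4 e1 e2 e3 hqLn (fun u hu => by rw [e9]; exact (l2 u hu).2.2.2)) ?_
  rintro σ₆ ⟨f1, f2⟩ ag₆
  replace ag₆ : Agree [99, 22, 36, 37, 33, 38, 39, 36, 36, 34, 35] [9] σ₅ σ₆ := ag₆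
  have hg₆ := hg₅.agree ag₆ (by decide)
  have hm₆ : ∀ a, a ≠ 9 → σ₆.mem a = σ₄.mem a := by
    intro a ha; rw [ag₆.2 a (by simpa using ha), e9]
  refine Post.seq (T₁ := 3) (Q₁ := fun σ' => σ'.reg 31 = 0 ∧ σ'.reg 22 = b ∧ σ'.reg 32 = q ∧
    σ'.reg 11 = lo ∧ σ'.reg 33 = σ₆.reg 33 ∧ σ'.mem = σ₆.mem ∧ Glob m n₀ L lam σ')
    (Post.wp (by decide) ?_) ?_
  · simp only [block, wp, AOp.Valid, AOp.val, AState.set_reg, AState.set_mem, AState.setMem_reg,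
      Nat.reduceEqDiff, reduceIte, true_and, and_true, forall_eq, ag₆.1 10 (by decide),
      ag₆.1 11 (by decide), ag₆.1 32 (by decide), e5, e7, e8]
    refine ⟨by omega, ?_⟩
    constructor <;> simp [hg₆.r0, hg₆.r1, hg₆.r2, hg₆.r3, hg₆.r4, hg₆.r5]
  rintro σ₇ ⟨r1, r2, r3, r4, r5, r6, hg₇⟩ -
  have hm₇ : ∀ a, a ≠ 9 → σ₇.mem a = σ₄.mem a := by
    intro a ha; rw [r6, hm₆ a ha]
  refine Post.seq (T₂ := 1) (sweep_spec hp hd (σ₀ := σ) hg₇ ?_ (X := X) (n := n) (b := b) (q := q) (al := al)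
    (lo := lo) hn hlob r4 r2 r3 hq' ?_ hf1 hf2 ?_) ?_
  · rw [hm₇ 1 (by norm_num), ag₄.2 1 hmemd.2.2.1, hm₃, hmem₂ 1 (Or.inl rfl)]; exact ht
  · intro u hu
    have hpt := (p2 u hu).1
    refine ⟨?_, ?_⟩
    · rw [hm₇ d (by omega), ag₄.2 d hmemd.1, hm₃]; exact hpt.1
    · rw [hm₇ _ (by omega), ag₄.2 _ hmemd.2.1, hm₃]; exact hpt.2
  · refine ⟨r1, by rw [r5]; exact f1, fun u hu => ?_, by simp, fun u hu _ => by rw [r6]; exact f2 u hu, ?_⟩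
    · obtain ⟨t1, t2, t3, t4⟩ := l2 u hu
      simp only [ColAt]
      rw [if_neg (by omega), hm₇ (d + 2) (by omega), hm₇ (d + 3) (by omega), hm₇ (d + 4) (by omega),
        hm₇ (d + 5) (by omega), hm₇ (d + 6) (by omega), hm₇ 10 (by omega), hm₇ 11 (by omega)]
      exact ⟨t1, t2, t3⟩
    · intro x hx
      rw [hm₇ (d + 2) (by omega), hm₇ (d + 3) (by omega), hm₇ (d + 4) (by omega),
        hm₇ (d + 5) (by omega), hm₇ (d + 6) (by omega)]
      exact l3 x hx
  · rintro σ₈ ⟨u1, u2, u3, u4, u5, u6⟩ ag₈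
    have hwr8 : (forN 22 (stepBody d)).wr = (forN 22 (stepBody 20)).wr := rfl
    have h32 : σ₈.reg 32 = q := by rw [ag₈.1 32 (by rw [hwr8]; decide), r3]
    have h44 : σ₈.reg 4 = 1 := by rw [ag₈.1 4 (by rw [hwr8]; decide), hg₇.r4]
    refine Post.wp (by decide) ?_
    simp only [block, wp, AOp.Valid, AOp.val, AState.set_reg, AState.set_mem, AState.setMem_reg,
      Nat.reduceEqDiff, reduceIte, true_and, and_true, forall_eq, h32, h44]
    refine ⟨by omega, fun u hu => ?_, u6⟩
    have := u3 u hu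
    rw [if_pos hu] at this
    exact ⟨this.1, this.2.1, this.2.2, u4 u hu hu⟩

end PagedRAM

/-! ## Building the columns of all levels -/

namespace PagedRAM

variable {w H m n₀ L lam : ℕ}

/-! ### Passage to the next subsequence -/

def filterBody : Stmt :=
  block [.load 33 5 31, .op .lt 34 33 15,
    .ite 34 .skip (block [.op .sub 33 33 15, .store 5 32 33, .op .add 32 32 4]), .op .add 31 31 4]

/-- Keep the elements of array `5` that are at least `reg 15`, reduced by `reg 15`. -/
def filterProg : Stmt :=
  .seq (block [.const 31 0, .const 32 0, .op .mov 21 9 9])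
    (.seq (forN 21 filterBody) (.op .mov 9 32 32))

theorem filter_spec (hp : Par w H m n₀ L lam) {σ : AState} (hg : Glob m n₀ L lam σ) {Y : ℕ → ℕ}
    {n b : ℕ} (hn : n ≤ m) (h9 : σ.reg 9 = n) (h15 : σ.reg 15 = b)
    (hY : ∀ p < n, σ.mem 5 p = Y p) (hYw : ∀ p < n, Y p < 2 ^ w) :
    Post w H filterProg σ (20 * (n + 1)) (fun σ' => σ'.reg 9 = cnt (fun i => b ≤ Y i) n ∧
      Filt Y n b (cnt (fun i => b ≤ Y i) n) (σ'.mem 5)) := by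
  have hw := hp.hw
  have hmw := hp.hmw
  have hH := hp.le_H
  have h4 := hp.four_le
  refine (Post.seq (T₁ := 4) (T₂ := (n * (12 + 3) + 1) + 1) (Q₁ := fun σ' =>
    σ'.reg 21 = n ∧ σ'.reg 31 = 0 ∧ σ'.reg 32 = 0)
    (Post.wp (by decide) ?_) ?_).mono (T' := 20 * (n + 1)) (by omega) (fun _ h => h)
  · simp only [block, wp, AOp.Valid, AOp.val, AState.set_reg, AState.set_mem, AState.setMem_reg,
      Nat.reduceEqDiff, reduceIte, true_and, and_true, h9, forall_eq]
    omega
  rintro σ₁ ⟨k1, k2, k3⟩ ag₁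
  have hg₁ := hg.agree ag₁ (by decide)
  -- The filter works in place: the writing position never overtakes the reading position, so the
  -- entries from `i` on are still the original ones.
  refine Post.seq (Post.forN n 12 (fun i σ' => σ'.reg 31 = i ∧
    σ'.reg 32 = cnt (fun i => b ≤ Y i) i ∧ (∀ p, i ≤ p → p < n → σ'.mem 5 p = Y p) ∧
    ∀ j < i, b ≤ Y j → σ'.mem 5 (cnt (fun i => b ≤ Y i) j) + b = Y j) hw (by decide) k1 ?_ ?_) ?_
  · refine ⟨k2, by simp [k3], fun p _ hp => ?_, by simp⟩
    rw [ag₁.2 5 (by decide)]; exact hY p hp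
  · rintro i hi σ₂ ag₂ ⟨l1, l2, l3, l4⟩
    obtain ⟨g0, g1, g2, g3, g4, g5⟩ := hg₁.agree ag₂ (by decide)
    have h15' : σ₂.reg 15 = b := (ag₂.1 15 (by decide)).trans ((ag₁.1 15 (by decide)).trans h15)
    have hYi := hYw i hi
    have hmem := l3 i le_rfl hi
    have hc : cnt (fun i => b ≤ Y i) i ≤ i := cnt_le
    refine Post.wp (by decide) ?_
    simp only [filterBody, block, wp, AOp.Valid, AOp.val, AState.set_reg, AState.set_mem,
      AState.setMem_reg, Nat.reduceEqDiff, reduceIte, true_and, and_true,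
      AState.setMem_mem_same, g0, g1, g2, g3, g4, g5, l1, l2, h15', hmem, forall_eq]
    refine ⟨by omega, fun h => ?_, fun h => ?_⟩
    · have hlt : ¬ b ≤ Y i := by split_ifs at h <;> omega
      refine ⟨by omega, ?_, fun p h1 h2 => l3 p (by omega) h2, fun j hj hb => ?_⟩
      · rw [cnt_succ_neg (P := fun i => b ≤ Y i) hlt]
      · rcases Nat.lt_succ_iff_lt_or_eq.1 hj with hj | rfl
        · exact l4 j hj hb
        · exact absurd hb hlt
    · have hle : b ≤ Y i := by split_ifs at h; omega
      refine ⟨by omega, by omega, by omega, by omega, ?_, fun p h1 h2 => ?_, fun j hj hb => ?_⟩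
      · rw [cnt_succ_pos (P := fun i => b ≤ Y i) hle]
      · rw [if_neg (by omega)]; exact l3 p (by omega) h2
      · rcases Nat.lt_succ_iff_lt_or_eq.1 hj with hj | rfl
        · have := cnt_lt_cnt (P := fun i => b ≤ Y i) hb hj
          rw [if_neg (by omega)]; exact l4 j hj hb
        · rw [if_pos rfl]; omega
  · rintro σ₂ ⟨l1, l2, l3, l4⟩ ag₂
    refine Post.wp (by decide) ?_
    simp only [wp, AOp.Valid, AOp.val, AState.set_reg, AState.set_mem, reduceIte, true_and,
      forall_eq, l2]
    exact ⟨rfl, l4⟩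

/-! ### Sums over the levels -/

/-- The number of classes on the level that starts at `L * 2 ^ k`. -/
def levWidth (L D k : ℕ) : ℕ := min (L * 2 ^ k) (D - L * 2 ^ k)

/-- The cells taken up by the first `k` levels. -/
noncomputable def levAlloc (L D n₀ : ℕ) (a : ℕ → ℕ) (k : ℕ) : ℕ :=
  ∑ j ∈ Finset.range k, levWidth L D j * (cnt (fun i => L * 2 ^ j ≤ a i) n₀ / L + 1)

/-- The start of the level before the one that starts at `L * 2 ^ k`. -/
def prevLow (L : ℕ) : ℕ → ℕ
  | 0 => 0
  | k + 1 => L * 2 ^ k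

/-- The levels before the last have total width at most `L * 2 ^ (K - 1)`, the start of the last
one; its width is cut off at `D`. -/
theorem sum_levWidth {L D K : ℕ} (hK : ∀ k < K, L * 2 ^ k ≤ D) :
    ∑ k ∈ Finset.range K, levWidth L D k ≤ D := by
  have h1 : ∀ K, ∑ k ∈ Finset.range K, levWidth L D k + L ≤ L * 2 ^ K := by
    intro K
    induction K with
    | zero => simp
    | succ K ih =>
      rw [Finset.sum_range_succ, pow_succ]
      have : levWidth L D K ≤ L * 2 ^ K := min_le_left _ _
      rw [← mul_assoc]
      omega
  cases K with
  | zero => simp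
  | succ K =>
    have h2 := h1 K
    have h3 := hK K (by omega)
    rw [Finset.sum_range_succ]
    have : levWidth L D K ≤ D - L * 2 ^ K := min_le_right _ _
    omega

/-- After multiplication by `L` the quotients are bounded by the sizes themselves, and `sum_levels`
applies. The factor `L` saved by the bit words cancels the one in the bound on the sum. -/
theorem sum_rows (hL : 0 < L) {E K : ℕ} {a : ℕ → ℕ}
    (hS : ∑ i ∈ Finset.range n₀, a i ≤ E * m * L) :
    ∑ k ∈ Finset.range K, (cnt (fun i => L * 2 ^ k ≤ a i) n₀ / L) * (L * 2 ^ k) ≤ 2 * E * m := by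
  have h := sum_levels L K a n₀
  refine Nat.le_of_mul_le_mul_left (c := L) ?_ hL
  rw [Finset.mul_sum]
  calc _ ≤ ∑ k ∈ Finset.range K, cnt (fun i => L * 2 ^ k ≤ a i) n₀ * (L * 2 ^ k) := by
        refine Finset.sum_le_sum fun k _ => ?_
        rw [← mul_assoc, mul_comm L]
        exact Nat.mul_le_mul_right _ (Nat.div_mul_le_self _ _)
    _ ≤ _ := h.trans (by nlinarith)

theorem sum_sizes (hL : 0 < L) {E K : ℕ} {a : ℕ → ℕ}
    (hS : ∑ i ∈ Finset.range n₀, a i ≤ E * m * L) :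
    ∑ k ∈ Finset.range K, cnt (fun i => L * 2 ^ k ≤ a i) n₀ ≤ 2 * E * m := by
  have h := sum_levels L K a n₀
  refine Nat.le_of_mul_le_mul_left (c := L) ?_ hL
  rw [Finset.mul_sum]
  calc _ ≤ ∑ k ∈ Finset.range K, cnt (fun i => L * 2 ^ k ≤ a i) n₀ * (L * 2 ^ k) := by
        refine Finset.sum_le_sum fun k _ => ?_
        rw [mul_comm L]
        exact Nat.mul_le_mul_left _ (Nat.le_mul_of_pos_right L (by positivity))
    _ ≤ _ := h.trans (by nlinarith)

/-- The first bound fits the columns into constantly many pages. The second is free of `E`; it keeps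
addresses within double words even if `E` is large compared with `2 ^ w`. -/
theorem levAlloc_le (hp : Par w H m n₀ L lam) {D E K : ℕ} (hD : D ≤ m) {a : ℕ → ℕ}
    (hK : ∀ k < K, L * 2 ^ k ≤ D) (hS : ∑ i ∈ Finset.range n₀, a i ≤ E * m * L) :
    levAlloc L D n₀ a K ≤ (2 * E + 1) * m ∧ levAlloc L D n₀ a K ≤ m * (m + 1) := by
  have h1 := sum_levWidth hK
  constructor
  · calc _ ≤ ∑ k ∈ Finset.range K,
        ((cnt (fun i => L * 2 ^ k ≤ a i) n₀ / L) * (L * 2 ^ k) + levWidth L D k) := by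
          refine Finset.sum_le_sum fun k _ => ?_
          have : levWidth L D k ≤ L * 2 ^ k := min_le_left _ _
          rw [mul_add, mul_one, mul_comm (levWidth L D k)]
          exact Nat.add_le_add_right (Nat.mul_le_mul_left _ this) _
      _ ≤ _ := by
          rw [Finset.sum_add_distrib]
          have := sum_rows (K := K) hp.pos hS
          rw [add_mul]; omega
  · calc _ ≤ ∑ k ∈ Finset.range K, levWidth L D k * (m + 1) := by
          refine Finset.sum_le_sum fun k _ => Nat.mul_le_mul_left _ ?_
          have h2 : cnt (fun i => L * 2 ^ k ≤ a i) n₀ ≤ n₀ := cnt_le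
          have h3 := Nat.div_le_self (cnt (fun i => L * 2 ^ k ≤ a i) n₀) L
          have := hp.hn
          omega
      _ ≤ _ := by
          rw [← Finset.sum_mul]
          exact Nat.mul_le_mul_right _ (h1.trans hD)

/-- A bound on the time for level `k`. -/
noncomputable def levTime (L D n₀ : ℕ) (a : ℕ → ℕ) (k : ℕ) : ℕ :=
  20 * (cnt (fun i => prevLow L k ≤ a i) n₀ + 1) + (10 +
    100 * ((cnt (fun i => L * 2 ^ k ≤ a i) n₀ / L + 1) * (L + levWidth L D k + 1)))

/-- Filtering costs the length of the preceding subsequence, which is `n₀` for the first level and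
is summable afterwards. Each of the at most `4 * L` levels has a fixed cost O(L), and `L * L ≤ m`.
The rest is rows times width, as for the space. -/
theorem sum_levTime (hp : Par w H m n₀ L lam) {D E K : ℕ} (hD : D ≤ m) {a : ℕ → ℕ}
    (hK : ∀ k < K, L * 2 ^ k ≤ D) (hK4 : K ≤ 4 * L)
    (hS : ∑ i ∈ Finset.range n₀, a i ≤ E * m * L) :
    ∑ k ∈ Finset.range K, (levTime L D n₀ a k + 3) ≤ 1000 * (E + 1) * m := by
  have hpos := hp.pos
  have h1 := sum_levWidth hK
  have h2 := sum_rows (K := K) hp.pos hS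
  have h3 := sum_sizes (K := K) hp.pos hS
  have h4 : ∑ k ∈ Finset.range K, cnt (fun i => prevLow L k ≤ a i) n₀ ≤ m + 2 * E * m := by
    cases K with
    | zero => simp
    | succ K =>
      rw [Finset.sum_range_succ']
      have h5 : cnt (fun i => prevLow L 0 ≤ a i) n₀ ≤ n₀ := cnt_le
      have := hp.hn
      have := sum_sizes (K := K) hp.pos hS
      simp only [prevLow] at h5 ⊢
      omega
  have hsq := hp.sq_le
  have hL2 := hp.L_lt
  have hKL : K * (L + 1) ≤ 4 * m + 2 * m := by nlinarith
  calc _ ≤ ∑ k ∈ Finset.range K, (20 * cnt (fun i => prevLow L k ≤ a i) n₀ +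
        (300 * ((cnt (fun i => L * 2 ^ k ≤ a i) n₀ / L) * (L * 2 ^ k)) +
          (100 * levWidth L D k + (100 * (L + 1) + 33)))) := by
        refine Finset.sum_le_sum fun k _ => ?_
        have h5 : levWidth L D k ≤ L * 2 ^ k := min_le_left _ _
        have h6 : L ≤ L * 2 ^ k := Nat.le_mul_of_pos_right L (by positivity)
        rw [levTime]
        generalize cnt (fun i => L * 2 ^ k ≤ a i) n₀ / L = r
        have h7 : r * (L + levWidth L D k + 1) ≤ r * (3 * (L * 2 ^ k)) :=
          Nat.mul_le_mul_left _ (by omega)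
        have h8 : r * (3 * (L * 2 ^ k)) = 3 * (r * (L * 2 ^ k)) := by ring
        rw [add_mul, one_mul]
        omega
    _ = 20 * ∑ k ∈ Finset.range K, cnt (fun i => prevLow L k ≤ a i) n₀ +
        (300 * (∑ k ∈ Finset.range K, (cnt (fun i => L * 2 ^ k ≤ a i) n₀ / L) * (L * 2 ^ k)) +
          (100 * (∑ k ∈ Finset.range K, levWidth L D k) + (100 * (K * (L + 1)) + 33 * K))) := by
        simp only [Finset.sum_add_distrib, Finset.mul_sum, Finset.sum_const, Finset.card_range,
          smul_eq_mul]
        ring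
    _ ≤ _ := by nlinarith

/-! ### The loop over the levels -/

/-- Column `c` of structure `d` is complete and lies below `al`; it is the column for the
threshold `u` of the sequence `X` of length `n`. -/
def HasCol (w L d c n : ℕ) (X : ℕ → ℕ) (u al : ℕ) (σ : AState) : Prop :=
  ∃ base, base + n / L < al ∧ PtrAt w d c base σ ∧ ColAt L (colP n X u) base (n / L + 1) d σ

theorem HasCol.mono {d c n u al al' : ℕ} {X : ℕ → ℕ} {σ : AState}
    (h : HasCol w L d c n X u al σ) (hal : al ≤ al') : HasCol w L d c n X u al' σ := by
  obtain ⟨base, h1, h2⟩ := h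
  exact ⟨base, by omega, h2⟩

theorem HasCol.of_frame {d c n u al : ℕ} {X : ℕ → ℕ} {σ σ' : AState} (hL : 0 < L)
    (h : HasCol w L d c n X u al σ) (hf : ColFrame (fun x => x < al) d σ σ')
    (hc : σ'.mem d c = σ.mem d c ∧ σ'.mem (d + 1) c = σ.mem (d + 1) c) :
    HasCol w L d c n X u al σ' := by
  obtain ⟨base, h1, h2, h3⟩ := h
  refine ⟨base, h1, ⟨hc.1.trans h2.1, hc.2.trans h2.2⟩, ?_⟩
  exact h3.of_frame hf hL (fun p hp => hp.1) le_rfl fun k hk => by omega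

theorem HasCol.of_mem {d c n u al : ℕ} {X : ℕ → ℕ} {σ σ' : AState}
    (h : HasCol w L d c n X u al σ) (hm : ∀ k ≤ 6, σ'.mem (d + k) = σ.mem (d + k)) :
    HasCol w L d c n X u al σ' := by
  obtain ⟨base, h1, h2, h3⟩ := h
  have h0 := hm 0 (by norm_num)
  rw [add_zero] at h0
  refine ⟨base, h1, ?_, ?_⟩
  · rw [PtrAt, h0, hm 1 (by norm_num)]; exact h2
  · rw [ColAt, hm 2 (by norm_num), hm 3 (by norm_num), hm 4 (by norm_num), hm 5 (by norm_num),
      hm 6 (by norm_num)]; exact h3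

/-- The column of class `c` on its level. -/
def LevCol (w L n₀ : ℕ) (a : ℕ → ℕ) (c al : ℕ) (σ : AState) : Prop :=
  ∃ n Y, Filt a n₀ (low L c) n Y ∧ HasCol w L 30 c n Y (c - low L c) al σ

def levelBody : Stmt :=
  .seq filterProg (.seq (block [.op .add 11 11 15, .op .mov 15 11 11, .op .sub 10 7 11,
    .op .lt 31 11 10, .ite 31 (.op .mov 10 11 11) .skip]) (buildProg 30 5))

/-- Build the columns of all levels. -/
def levelsProg : Stmt :=
  .seq (block [.op .mov 9 1 1, .const 11 0, .op .mov 15 3 3, .const 8 0, .op .sub 20 14 3])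
    (forN 20 levelBody)

/-- One round filters the sequence of the preceding level further and builds a column for each class
of the new level. Columns of earlier levels lie below the allocation pointer and persist. -/
theorem levels_spec (hp : Par w H m n₀ L lam) {σ : AState} (hg : Glob m n₀ L lam σ)
    (ht : PopTab L (σ.mem 1)) {D E : ℕ} (hD : D ≤ m) (h7 : σ.reg 7 = D)
    (h14 : σ.reg 14 = if D = 0 then 0 else lev L (D - 1) + 1) {a : ℕ → ℕ}
    (ha : ∀ i < n₀, σ.mem 5 i = a i) (haD : ∀ i < n₀, a i < D)
    (hS : ∑ i ∈ Finset.range n₀, a i ≤ E * m * L) (hEH : 2 * E + 1 ≤ H) :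
    Post w H levelsProg σ (1100 * (E + 1) * m) (fun σ' =>
      ∀ c, L ≤ c → c < D → ∃ al, al ≤ H * 2 ^ w ∧ al < 2 ^ w * 2 ^ w ∧
        LevCol w L n₀ a c al σ') := by
  have hw := hp.hw
  have hmw := hp.hmw
  have hH := hp.le_H
  have h4 := hp.four_le
  have hm := hp.hm
  have hn := hp.hn
  have hpos := hp.pos
  have hL2 := hp.L_lt
  -- The number of interval levels in use: the `L` levels of single classes are taken off, with
  -- truncation if there are fewer.
  obtain ⟨K, hKdef⟩ : ∃ K, K = (if D = 0 then 0 else lev L (D - 1) + 1) - L := ⟨_, rfl⟩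
  have hK : ∀ k < K, L * 2 ^ k < D := by
    intro k hk
    split_ifs at hKdef with h0
    · omega
    have h1 := lev_low_of_mem (L := L) (k := k) (c := L * 2 ^ k) hpos le_rfl
      (by have := Nat.pos_of_ne_zero (show L * 2 ^ k ≠ 0 by positivity)
          rw [pow_succ, ← mul_assoc]; omega)
    have h2 := (lev_le_iff (c := L * 2 ^ k) (a := D - 1) hpos).1 (by rw [h1.1]; omega)
    rw [h1.2] at h2
    omega
  have hK' : ∀ k < K, L * 2 ^ k ≤ D := fun k hk => (hK k hk).le
  have hcK : ∀ c, L ≤ c → c < D → c < L * 2 ^ K := by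
    intro c h1 h2
    obtain ⟨k, h3, h4⟩ := exists_level hpos h1
    have h5 := lev_low_of_mem hpos h3 h4
    have h6 := (lev_le_iff (c := c) (a := D - 1) hpos).2 ((low_le hpos).trans (by omega))
    rw [h5.1] at h6
    rw [if_neg (by omega)] at hKdef
    exact h4.trans_le (level_mono (by omega))
  have hK4 : K ≤ 4 * L := by
    have h1 := hp.m_lt
    have := lev_lt (L := L) (c := D - 1) hpos (by omega)
    split_ifs at hKdef <;> omega
  have hbound : ∀ k ≤ K, levAlloc L D n₀ a k ≤ H * 2 ^ w ∧ levAlloc L D n₀ a k < 2 ^ w * 2 ^ w := by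
    intro k hk
    obtain ⟨h1, h2⟩ := levAlloc_le hp (K := k) hD (fun j hj => hK' j (by omega)) hS
    constructor
    · exact h1.trans (Nat.mul_le_mul hEH hmw.le)
    · calc _ ≤ m * (m + 1) := h2
        _ < 2 ^ w * 2 ^ w := Nat.mul_lt_mul_of_lt_of_le hmw hmw (by omega)
  have hT : 6 + ((∑ k ∈ Finset.range K, (levTime L D n₀ a k + 3)) + 1) ≤ 1100 * (E + 1) * m := by
    have := sum_levTime hp hD hK' hK4 hS
    nlinarith
  refine Post.mono (Post.seq (T₁ := 6) (Q₁ := fun σ' => σ'.reg 9 = n₀ ∧ σ'.reg 11 = 0 ∧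
    σ'.reg 15 = L ∧ σ'.reg 8 = 0 ∧ σ'.reg 20 = K) (Post.wp (by decide) ?_) ?_) hT (fun _ h => h)
  · simp only [block, wp, AOp.Valid, AOp.val, AState.set_reg, AState.set_mem, AState.setMem_reg,
      Nat.reduceEqDiff, reduceIte, true_and, and_true, hg.r1, hg.r3, h14, forall_eq, ← hKdef]
    omega
  rintro σ₁ ⟨k1, k2, k3, k4, k5⟩ ag₁
  have hg₁ := hg.agree ag₁ (by decide)
  have hmem₁ : ∀ a, σ₁.mem a = σ.mem a := fun a => ag₁.2 a (by simp [block, Stmt.wa])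
  -- Register `15` holds the next start relative to the amount already subtracted: `L` at first, and
  -- then the current start again, since starts double.
  refine (Post.forN_sum K (levTime L D n₀ a) (fun k σ' => σ'.reg 8 = levAlloc L D n₀ a k ∧
    σ'.reg 11 = prevLow L k ∧ σ'.reg 15 + prevLow L k = L * 2 ^ k ∧
    σ'.reg 9 = cnt (fun i => prevLow L k ≤ a i) n₀ ∧
    Filt a n₀ (prevLow L k) (cnt (fun i => prevLow L k ≤ a i) n₀) (σ'.mem 5) ∧
    ∀ c, L ≤ c → c < L * 2 ^ k → c < D → LevCol w L n₀ a c (levAlloc L D n₀ a k) σ')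
    hw (by decide) k5 ?_ ?_).mono le_rfl ?_
  · have h0 := Filt.refl a n₀
    have h1 := h0.len
    refine ⟨by simp [k4, levAlloc], k2, by simp [prevLow, k3], ?_, ?_, fun c h1 h2 => by simp at h2; omega⟩
    · rw [k1]; exact h1
    · simp only [prevLow]
      rw [← h1]
      exact h0.congr fun p hp => by rw [hmem₁]; exact ha p hp
  swap
  · rintro σ' ⟨l1, l2, l3, l4, l5, l6⟩ c h1 h2
    exact ⟨_, (hbound K le_rfl).1, (hbound K le_rfl).2, l6 c h1 (hcK c h1 h2) h2⟩
  rintro k hk σ₂ ag₂ ⟨l1, l2, l3, l4, l5, l6⟩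
  have hg₂ : Glob m n₀ L lam ((σ₂.set 99 1).set 20 (K - 1 - k)) := by
    have := hg₁.agree ag₂ (by decide)
    constructor <;> simp [this.r0, this.r1, this.r2, this.r3, this.r4, this.r5]
  have hlo := hK k hk
  have hnp : cnt (fun i => prevLow L k ≤ a i) n₀ ≤ n₀ := cnt_le
  have hYw : ∀ p < cnt (fun i => prevLow L k ≤ a i) n₀, σ₂.mem 5 p < 2 ^ w := by
    intro p hp
    obtain ⟨i, hi, h1, h2⟩ := exists_of_lt_cnt hp
    have h3 := l5.val i hi h1
    have := haD i hi
    rw [h2] at h3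
    omega
  obtain ⟨n, hndef⟩ : ∃ n, n = cnt (fun i => σ₂.reg 15 ≤ σ₂.mem 5 i)
    (cnt (fun i => prevLow L k ≤ a i) n₀) := ⟨_, rfl⟩
  rw [levTime]
  refine Post.seq (Q₁ := fun σ' => σ'.reg 9 = n ∧
    Filt a n₀ (L * 2 ^ k) n (σ'.mem 5)) ((filter_spec hp hg₂ (Y := σ₂.mem 5) (b := σ₂.reg 15)
      (n := cnt (fun i => prevLow L k ≤ a i) n₀) (by omega) (by simpa using l4) (by simp)
      (by simp) hYw).mono le_rfl ?_) ?_
  · rintro σ' ⟨h1, h2⟩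
    have := l5.trans h2
    rw [add_comm, l3] at this
    rw [hndef]
    exact ⟨h1, this⟩
  clear hndef
  rintro σ₃ ⟨p1, p2⟩ ag₃
  have hr3 : ∀ r, r ∉ filterProg.wr → r ≠ 20 → r ≠ 99 → σ₃.reg r = σ₂.reg r := by
    intro r h1 h2 h3
    rw [ag₃.1 r h1]; simp [h2, h3]
  have hg₃ := hg₂.agree ag₃ (by decide)
  have hm₃ : ∀ x, x ≠ 5 → σ₃.mem x = σ₂.mem x := by
    intro x hx
    rw [ag₃.2 x (by simpa [filterProg, filterBody, forN, block, Stmt.wa] using hx)]; rfl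
  have h7₃ : σ₃.reg 7 = D := by
    rw [hr3 7 (by decide) (by decide) (by decide), ag₂.1 7 (by decide), ag₁.1 7 (by decide), h7]
  have h11₃ := hr3 11 (by decide) (by decide) (by decide)
  have h15₃ := hr3 15 (by decide) (by decide) (by decide)
  have h8₃ := hr3 8 (by decide) (by decide) (by decide)
  have hnlen := p2.len
  rw [← hnlen]
  refine Post.seq (T₁ := 10) (Q₁ := fun σ' => σ'.reg 11 = L * 2 ^ k ∧ σ'.reg 15 = L * 2 ^ k ∧
    σ'.reg 10 = levWidth L D k) (Post.wp (by decide) ?_) ?_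
  · simp only [block, wp, AOp.Valid, AOp.val, AState.set_reg, AState.set_mem, AState.setMem_reg,
      Nat.reduceEqDiff, reduceIte, true_and, and_true, h7₃, h11₃, h15₃, l2, levWidth]
    rw [add_comm, l3]
    refine ⟨by omega, fun v hv v2 hv2 v3 hv3 v4 hv4 => ⟨fun h => ?_, fun h => ?_⟩⟩
    · intro v5 hv5
      refine ⟨hv, by omega, ?_⟩
      split_ifs at hv4 <;> omega
    · refine ⟨hv, by omega, ?_⟩
      split_ifs at hv4 <;> omega
  rintro σ₄ ⟨q1, q2, q3⟩ ag₄
  have hg₄ := hg₃.agree ag₄ (by decide)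
  have hm₄ : ∀ x, σ₄.mem x = σ₃.mem x := fun x => ag₄.2 x (by simp [block, Stmt.wa])
  have halloc : levAlloc L D n₀ a (k + 1) = levAlloc L D n₀ a k + levWidth L D k * (n / L + 1) := by
    rw [levAlloc, Finset.sum_range_succ, ← hnlen, levAlloc]
  obtain ⟨hb1, hb2⟩ := hbound (k + 1) hk
  rw [halloc] at hb1 hb2
  have hwid : L * 2 ^ k + levWidth L D k ≤ D := by
    have : levWidth L D k ≤ D - L * 2 ^ k := min_le_right _ _
    omega
  have hmem30 : ∀ x, x ≠ 5 → σ₄.mem x = σ₂.mem x := fun x hx => by rw [hm₄, hm₃ x hx]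
  refine Post.mono (Post.with_agree (build_spec hp (Or.inr rfl) (Or.inl rfl) hg₄ (X := σ₃.mem 5) (n := n)
    (b := levWidth L D k) (lo := L * 2 ^ k) (al := levAlloc L D n₀ a k) ?_ (p2.le_length.trans hn)
    (by omega) ?_ ?_ q3 q1 (fun p _ => by rw [hm₄]) hb1 hb2)) le_rfl ?_
  · rw [hmem30 1 (by decide), ag₂.2 1 (by decide), hmem₁]; exact ht
  · rw [ag₄.1 8 (by decide), h8₃, l1]
  · rw [ag₄.1 9 (by decide), p1]
  rintro σ₅ ⟨⟨r1, r2, r3, r4⟩, ag₅⟩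
  have hpl : prevLow L (k + 1) = L * 2 ^ k := rfl
  have hwr : (buildProg 30 5).wr = (buildProg 20 8).wr := rfl
  refine ⟨by rw [halloc]; exact r1, ?_, ?_, ?_, ?_, ?_⟩
  · rw [ag₅.1 11 (by rw [hwr]; decide), q1, hpl]
  · rw [ag₅.1 15 (by rw [hwr]; decide), q2, hpl, pow_succ]; ring
  · rw [ag₅.1 9 (by rw [hwr]; decide), ag₄.1 9 (by decide), p1, hpl, hnlen]
  · rw [ag₅.2 5 (by rw [buildProg_wa]; decide), hm₄, hpl, ← hnlen]; exact p2
  · intro c h1 h2 h3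
    rcases Nat.lt_or_ge c (L * 2 ^ k) with hc | hc
    · obtain ⟨n', Y', e1, e2⟩ := l6 c h1 hc h3
      refine ⟨n', Y', e1, HasCol.mono (HasCol.of_frame hpos (e2.of_mem fun x hx => ?_) r3 (r4 c hc))
        (by omega)⟩
      exact hmem30 _ (by omega)
    · have hlev := lev_low_of_mem hpos hc h2
      have hcw : c - L * 2 ^ k < levWidth L D k := by
        have : L * 2 ^ (k + 1) = L * 2 ^ k + L * 2 ^ k := by ring
        rw [levWidth]; omega
      obtain ⟨e1, e2⟩ := r2 _ hcw
      rw [Nat.add_sub_cancel' hc] at e1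
      refine ⟨n, σ₃.mem 5, by rw [hlev.2]; exact p2, ?_⟩
      rw [hlev.2]
      refine ⟨_, ?_, e1, e2⟩
      have := Nat.mul_le_mul_right (n / L + 1) (show c - L * 2 ^ k + 1 ≤ levWidth L D k from hcw)
      rw [add_mul, one_mul] at this
      omega

/-! ### The columns of the levels over the whole array -/

/-- Build the columns of the sequence of levels. -/
def baseProg : Stmt :=
  .seq (block [.op .mov 9 1 1, .op .mov 10 14 14, .const 11 0, .const 8 0]) (buildProg 20 8)

/-- There are at most `5 * L` levels with `n₀ / L + 1` rows each, hence at most `10 * m` cells; this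
is why ten pages are required. -/
theorem base_spec (hp : Par w H m n₀ L lam) {σ : AState} (hg : Glob m n₀ L lam σ)
    (ht : PopTab L (σ.mem 1)) {D : ℕ} (hD : D ≤ m)
    (h14 : σ.reg 14 = if D = 0 then 0 else lev L (D - 1) + 1) {X : ℕ → ℕ}
    (hX : ∀ i < n₀, σ.mem 8 i = X i) (hH10 : 10 ≤ H) :
    Post w H baseProg σ (2000 * m) (fun σ' =>
      ∀ c < D, ∃ al, al ≤ H * 2 ^ w ∧ al < 2 ^ w * 2 ^ w ∧
        HasCol w L 20 (lev L c) n₀ X (lev L c) al σ') := by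
  have hw := hp.hw
  have hmw := hp.hmw
  have hH := hp.le_H
  have h4 := hp.four_le
  have hm := hp.hm
  have hn := hp.hn
  have hpos := hp.pos
  have hL2 := hp.L_lt
  obtain ⟨b, hb⟩ : ∃ b, b = if D = 0 then 0 else lev L (D - 1) + 1 := ⟨_, rfl⟩
  rw [← hb] at h14
  have hbD : b ≤ D := by
    have := lev_le (L := L) (c := D - 1) hpos
    split_ifs at hb <;> omega
  have hb5 : b ≤ 5 * L := by
    have h1 := hp.m_lt
    have := lev_lt (L := L) (c := D - 1) hpos (by omega)
    split_ifs at hb <;> omega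
  have hdm := Nat.div_mul_le_self n₀ L
  have hdl := Nat.div_le_self n₀ L
  have hal1 : b * (n₀ / L + 1) ≤ 10 * m := by
    have := Nat.mul_le_mul_right (n₀ / L + 1) hb5
    nlinarith
  have hal2 : b * (n₀ / L + 1) < 2 ^ w * 2 ^ w :=
    calc _ ≤ m * (m + 1) := Nat.mul_le_mul (by omega) (by omega)
      _ < 2 ^ w * 2 ^ w := Nat.mul_lt_mul_of_lt_of_le hmw hmw (by omega)
  have hal3 : b * (n₀ / L + 1) ≤ H * 2 ^ w := hal1.trans (Nat.mul_le_mul hH10 hmw.le)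
  have hT : 5 + 100 * ((n₀ / L + 1) * (L + b + 1)) ≤ 2000 * m := by
    have : (n₀ / L + 1) * (L + b + 1) ≤ (n₀ / L + 1) * (7 * L) :=
      Nat.mul_le_mul_left _ (by omega)
    nlinarith
  refine Post.mono (Post.seq (T₁ := 5) (Q₁ := fun σ' => σ'.reg 9 = n₀ ∧ σ'.reg 10 = b ∧
    σ'.reg 11 = 0 ∧ σ'.reg 8 = 0) (Post.wp (by decide) ?_) ?_) hT (fun _ h => h)
  · simp only [block, wp, AOp.Valid, AOp.val, AState.set_reg, AState.set_mem, AState.setMem_reg,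
      Nat.reduceEqDiff, reduceIte, true_and, and_true, hg.r1, h14, forall_eq]
    omega
  rintro σ₁ ⟨k1, k2, k3, k4⟩ ag₁
  have hg₁ := hg.agree ag₁ (by decide)
  have hmem₁ : ∀ a, σ₁.mem a = σ.mem a := fun a => ag₁.2 a (by simp [block, Stmt.wa])
  refine (build_spec hp (Or.inl rfl) (Or.inr rfl) hg₁ (X := X) (n := n₀) (b := b) (lo := 0)
    (al := 0) (by rw [hmem₁]; exact ht) hn (by omega) k4 k1 k2 k3
    (fun p hp => by rw [hmem₁]; exact hX p hp) (by omega) (by omega)).mono le_rfl ?_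
  rintro σ₂ ⟨r1, r2, r3, r4⟩ c hc
  refine ⟨_, hal3, hal2, ?_⟩
  have hcb : lev L c < b := by
    rw [hb, if_neg (by omega)]
    have := (lev_le_iff (c := c) (a := D - 1) hpos).2 ((low_le hpos).trans (by omega))
    omega
  obtain ⟨e1, e2⟩ := r2 _ hcb
  rw [zero_add] at e1
  refine ⟨_, ?_, e1, e2⟩
  have := Nat.mul_le_mul_right (n₀ / L + 1) (show lev L c + 1 ≤ b from hcb)
  rw [add_mul, one_mul] at this
  omega

end PagedRAM

/-! ## The preprocessing -/

namespace PagedRAM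

variable {w H m n₀ L lam : ℕ}

/-- The class of the element `α i`. -/
noncomputable def cls (α : ℕ → ℕ) (n i : ℕ) : ℕ := cnt (IsVal α n) (α i)

/-- The memory after the preprocessing of the array `α` of length `n₀`, with largest element at
most `M`, and with `D` distinct values. -/
structure Prepared (w H n₀ L lam : ℕ) (α : ℕ → ℕ) (M D : ℕ) (σ : AState) : Prop where
  hα : ∀ i < n₀, α i ≤ M
  hMw : M < 2 ^ w
  hD : D = cnt (IsVal α n₀) ((M / L + 1) * L)
  pop : PopTab L (σ.mem 1)
  sel : SelTab L (σ.mem 2)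
  bits : ∀ x ≤ M / L, IsBW L (IsVal α n₀) x (σ.mem 3 x)
  ranks : ∀ x ≤ M / L, σ.mem 4 x = cnt (IsVal α n₀) (x * L)
  levels : ∀ c < D, σ.mem 6 c = lev L c
  baseCol : ∀ c < D, ∃ al, al ≤ H * 2 ^ w ∧ al < 2 ^ w * 2 ^ w ∧
    HasCol w L 20 (lev L c) n₀ (fun i => lev L (cls α n₀ i)) (lev L c) al σ
  levCol : ∀ c, L ≤ c → c < D → ∃ al, al ≤ H * 2 ^ w ∧ al < 2 ^ w * 2 ^ w ∧
    LevCol w L n₀ (cls α n₀) c al σ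
  cell12 : σ.mem 12 0 = lam
  cell13 : σ.mem 13 0 = M
  cell14 : σ.mem 14 0 = D

theorem Prepared.of_mem {α : ℕ → ℕ} {M D : ℕ} {σ σ' : AState}
    (h : Prepared w H n₀ L lam α M D σ) (hm : σ'.mem = σ.mem) :
    Prepared w H n₀ L lam α M D σ' := by
  obtain ⟨h1, h2, h3, h4, h5, h6, h7, h8, h9, h10, h11, h12, h13⟩ := h
  refine ⟨h1, h2, h3, ?_, ?_, ?_, ?_, ?_, fun c hc => ?_, fun c h1 h2 => ?_, ?_, ?_, ?_⟩
  all_goals try (rw [hm]; assumption)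
  · obtain ⟨al, a1, a2, a3⟩ := h9 c hc
    exact ⟨al, a1, a2, a3.of_mem fun _ _ => by rw [hm]⟩
  · obtain ⟨al, a1, a2, n, Y, a3, a4⟩ := h10 c h1 h2
    exact ⟨al, a1, a2, n, Y, a3, a4.of_mem fun _ _ => by rw [hm]⟩

theorem cls_lt {α : ℕ → ℕ} {M D i : ℕ} (hL : 0 < L) (hα : ∀ i < n₀, α i ≤ M)
    (hD : D = cnt (IsVal α n₀) ((M / L + 1) * L)) (hi : i < n₀) : cls α n₀ i < D := by
  rw [hD]
  refine cnt_lt_cnt ⟨i, hi, rfl⟩ ((hα i hi).trans_lt ?_)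
  have := Nat.div_add_mod M L
  have := Nat.mod_lt M hL
  rw [add_mul, one_mul, mul_comm]
  omega

/-- The tables of bit words. -/
def tableProg : Stmt := .seq popProg selProg

/-- The tables for the compression of the values to classes. -/
def valueProg : Stmt := .seq maxProg (.seq markProg prefixProg)

/-- The classes and their levels. -/
def levelProg : Stmt := .seq classProg (.seq levProg levelSeqProg)

def saveProg : Stmt := block [.store 12 5 2, .store 13 5 6, .store 14 5 7]

def columnProg : Stmt := .seq baseProg (.seq levelsProg saveProg)

/-- The preprocessing. -/
def prepProg : Stmt :=
  .seq wordLengthProg (.seq tableProg (.seq valueProg (.seq levelProg columnProg)))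

/-- The bound on the sum is assumed for every `L` with `m < 2 ^ (4 * L)`, because `L` is found only
during the run. -/
theorem prep_spec {σ : AState} (hw : 2 ≤ w) (hm : 2 ≤ m) (hmw : m < 2 ^ w) (hn : n₀ ≤ m) {E : ℕ}
    (hEH : 2 * E + 10 ≤ H) (h0 : σ.reg 0 = m) (h1 : σ.reg 1 = n₀) {α : ℕ → ℕ}
    (hα : ∀ i < n₀, σ.mem 0 (i + 1) = α i) (hαw : ∀ i < n₀, α i < 2 ^ w)
    (hS : ∀ L, m < 2 ^ (4 * L) → ∑ i ∈ Finset.range n₀, α i ≤ E * m * L) :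
    Post w H prepProg σ (5000 * (E + 1) * m) (fun σ' => ∃ L lam M D,
      Par w H m n₀ L lam ∧ Prepared w H n₀ L lam α M D σ') := by
  have key : ∀ L lam, Par w H m n₀ L lam → ∀ σ₁, Glob m n₀ L lam σ₁ → σ₁.mem = σ.mem →
      Post w H (.seq tableProg (.seq valueProg (.seq levelProg columnProg))) σ₁
        (4900 * (E + 1) * m) (fun σ' => ∃ M D, Prepared w H n₀ L lam α M D σ') := by
    intro L lam hp σ₁ hg₁ hm₁
    have hpos := hp.pos
    have hH := hp.le_H
    have hS' := hS L hp.m_lt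
    refine Post.mono (T := 20 * m + 60 * m + ((20 * m + (30 * (m + E * m) + 20 * (m + E * m))) +
      ((40 * m + (40 * m + 20 * m)) + (2000 * m + (1100 * (E + 1) * m + 4))))) ?_ (by nlinarith)
      (fun _ h => h)
    -- the tables
    refine Post.seq (Q₁ := fun σ' => PopTab L (σ'.mem 1) ∧ SelTab L (σ'.mem 2))
      (Post.seq (pop_spec hp hg₁) fun σ' h1 ag => ?_) ?_
    · have hg' := hg₁.agree ag (by decide)
      refine (Post.with_agree (sel_spec hp hg' h1)).mono le_rfl ?_
      rintro σ'' ⟨h2, ag'⟩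
      exact ⟨by rwa [ag'.2 1 (by decide)], h2⟩
    rintro σ₂ ⟨hpop, hsel⟩ ag₂
    have hg₂ := hg₁.agree ag₂ (by decide)
    have hα₂ : ∀ i < n₀, σ₂.mem 0 (i + 1) = α i := by
      intro i hi; rw [ag₂.2 0 (by decide), hm₁]; exact hα i hi
    -- values
    refine Post.seq (Q₁ := fun σ' => ∃ M D, (∀ i < n₀, α i ≤ M) ∧ M < 2 ^ w ∧
      D = cnt (IsVal α n₀) ((M / L + 1) * L) ∧ σ'.reg 6 = M ∧ σ'.reg 7 = D ∧
      (∀ x ≤ M / L, IsBW L (IsVal α n₀) x (σ'.mem 3 x)) ∧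
      ∀ x ≤ M / L, σ'.mem 4 x = cnt (IsVal α n₀) (x * L))
      (Post.seq (max_spec hp hg₂ hα₂ hαw) ?_) ?_
    · rintro σ₃ ⟨e1, e2, e3⟩ ag₃
      have hg₃ := hg₂.agree ag₃ (by decide)
      have hME : σ₃.reg 6 / L ≤ E * m := by
        refine Nat.div_le_of_le_mul (e3.trans (hS'.trans ?_))
        rw [mul_comm L]
      refine Post.seq ((mark_spec hp hg₃ (α := α)
        (fun i hi => by rw [ag₃.2 0 (by decide)]; exact hα₂ i hi) rfl e2 e1).mono
        (Nat.mul_le_mul_left _ (by omega)) (fun _ h => h)) ?_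
      rintro σ₄ ⟨f1, f2⟩ ag₄
      have hg₄ := hg₃.agree ag₄ (by decide)
      refine (Post.with_agree (prefix_spec hp hg₄ (α := α) ?_ e2 f1 f2)).mono
        (Nat.mul_le_mul_left _ (by omega)) ?_
      · rw [ag₄.2 1 (by decide), ag₃.2 1 (by decide)]; exact hpop
      rintro σ₅ ⟨⟨p1, p2⟩, ag₅⟩
      refine ⟨σ₃.reg 6, _, e1, e2, rfl, ?_, p1, fun x hx => ?_, p2⟩
      · rw [ag₅.1 6 (by decide), ag₄.1 6 (by decide)]
      · rw [ag₅.2 3 (by decide)]; exact f2 x hx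
    rintro σ₃ ⟨M, D, hαM, hMw, hD, h6, h7, hbits, hranks⟩ ag₃
    have hg₃ := hg₂.agree ag₃ (by decide)
    have hα₃ : ∀ i < n₀, σ₃.mem 0 (i + 1) = α i := by
      intro i hi; rw [ag₃.2 0 (by decide)]; exact hα₂ i hi
    have hpop₃ : PopTab L (σ₃.mem 1) := by rw [ag₃.2 1 (by decide)]; exact hpop
    have hDm : D ≤ m := by rw [hD]; exact (cnt_isVal_le α n₀ _).trans hn
    have haD : ∀ i < n₀, cls α n₀ i < D := fun i hi => cls_lt hpos hαM hD hi
    -- classes and levels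
    refine Post.seq (Q₁ := fun σ' => (∀ i < n₀, σ'.mem 5 i = cls α n₀ i) ∧
      (∀ c < D, σ'.mem 6 c = lev L c) ∧
      σ'.reg 14 = (if D = 0 then 0 else lev L (D - 1) + 1) ∧
      ∀ i < n₀, σ'.mem 8 i = lev L (cls α n₀ i))
      (Post.seq (class_spec hp hg₃ hα₃ hpop₃ hMw hαM hbits hranks) ?_) ?_
    · rintro σ₄ e1 ag₄
      have hg₄ := hg₃.agree ag₄ (by decide)
      refine Post.seq (lev_spec hp hg₄ hDm ((ag₄.1 7 (by decide)).trans h7)) ?_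
      rintro σ₅ ⟨f1, f2⟩ ag₅
      have hg₅ := hg₄.agree ag₅ (by decide)
      have e1' : ∀ i < n₀, σ₅.mem 5 i = cls α n₀ i := by
        intro i hi; rw [ag₅.2 5 (by decide)]; exact e1 i hi
      refine (Post.with_agree (levelSeq_spec hp hg₅ hDm e1' haD f2)).mono
        le_rfl ?_
      rintro σ₆ ⟨p1, ag₆⟩
      refine ⟨fun i hi => ?_, fun c hc => ?_, ?_, p1⟩
      · rw [ag₆.2 5 (by decide)]; exact e1' i hi
      · rw [ag₆.2 6 (by decide)]; exact f2 c hc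
      · rw [ag₆.1 14 (by decide)]; exact f1
    rintro σ₄ ⟨e1, e2, e3, e4⟩ ag₄
    have hg₄ := hg₃.agree ag₄ (by decide)
    -- columns
    refine Post.seq (base_spec hp hg₄ (by rw [ag₄.2 1 (by decide)]; exact hpop₃) hDm e3
      (X := fun i => lev L (cls α n₀ i)) e4 (by omega)) ?_
    rintro σ₅ f1 ag₅
    have hg₅ := hg₄.agree ag₅ (by decide)
    refine Post.seq (levels_spec hp hg₅ (D := D) (E := E) (a := cls α n₀) ?_ hDm ?_ ?_ ?_ haD ?_
      (by omega)) ?_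
    · rw [ag₅.2 1 (by decide), ag₄.2 1 (by decide)]; exact hpop₃
    · rw [ag₅.1 7 (by decide), ag₄.1 7 (by decide)]; exact h7
    · rw [ag₅.1 14 (by decide)]; exact e3
    · intro i hi; rw [ag₅.2 5 (by decide)]; exact e1 i hi
    -- A class counts distinct numbers below the value, so it does not exceed the value.
    · exact (Finset.sum_le_sum fun i _ => cnt_le).trans hS'
    rintro σ₆ p1 ag₆
    have hg₆ := hg₅.agree ag₆ (by decide)
    have h6₆ : σ₆.reg 6 = M := by
      rw [ag₆.1 6 (by decide), ag₅.1 6 (by decide), ag₄.1 6 (by decide)]; exact h6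
    have h7₆ : σ₆.reg 7 = D := by
      rw [ag₆.1 7 (by decide), ag₅.1 7 (by decide), ag₄.1 7 (by decide)]; exact h7
    have hlam := hp.lam_lt
    have hL2 := hp.L_lt
    refine (Post.with_agree (T := 4) (Q := fun σ' => σ'.mem 12 0 = lam ∧ σ'.mem 13 0 = M ∧
      σ'.mem 14 0 = D) (Post.wp (by decide) ?_)).mono le_rfl ?_
    · simp only [saveProg, block, wp, AState.setMem_reg, AState.setMem_mem, hg₆.r2, hg₆.r5, h6₆, h7₆,
        Nat.reduceEqDiff, false_and, and_true, reduceIte]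
      omega
    rintro σ₇ ⟨⟨q1, q2, q3⟩, ag₇⟩
    refine ⟨M, D, hαM, hMw, hD, ?_, ?_, fun x hx => ?_, fun x hx => ?_, fun c hc => ?_,
      fun c hc => ?_, fun c h1 h2 => ?_, q1, q2, q3⟩
    · rw [ag₇.2 1 (by decide), ag₆.2 1 (by decide), ag₅.2 1 (by decide), ag₄.2 1 (by decide)]
      exact hpop₃
    · rw [ag₇.2 2 (by decide), ag₆.2 2 (by decide), ag₅.2 2 (by decide), ag₄.2 2 (by decide),
        ag₃.2 2 (by decide)]
      exact hsel
    · rw [ag₇.2 3 (by decide), ag₆.2 3 (by decide), ag₅.2 3 (by decide), ag₄.2 3 (by decide)]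
      exact hbits x hx
    · rw [ag₇.2 4 (by decide), ag₆.2 4 (by decide), ag₅.2 4 (by decide), ag₄.2 4 (by decide)]
      exact hranks x hx
    · rw [ag₇.2 6 (by decide), ag₆.2 6 (by decide), ag₅.2 6 (by decide)]
      exact e2 c hc
    · obtain ⟨al, a1, a2, a3⟩ := f1 c hc
      refine ⟨al, a1, a2, a3.of_mem fun k hk => ?_⟩
      rw [ag₇.2 _ (by interval_cases k <;> decide), ag₆.2 _ (by interval_cases k <;> decide)]
    · obtain ⟨al, a1, a2, n, Y, a3, a4⟩ := p1 c h1 h2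
      refine ⟨al, a1, a2, n, Y, a3, a4.of_mem fun k hk => ?_⟩
      rw [ag₇.2 _ (by interval_cases k <;> decide)]
  refine Post.mono (Post.seq (wordLength_spec hw (by omega) hm hmw hn h0 h1)
    (T₂ := 4900 * (E + 1) * m) ?_) (by nlinarith) (fun _ h => h)
  rintro σ₁ ⟨L, lam, hp, hg₁, hm₁⟩ -
  refine (key L lam hp σ₁ hg₁ hm₁).mono le_rfl ?_
  rintro σ' ⟨M, D, h⟩
  exact ⟨L, lam, M, D, hp, h⟩

end PagedRAM

/-! ## The queries -/

namespace PagedRAM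

variable {w H m n₀ L lam : ℕ}

theorem Agree.mem_eq {p : Stmt} {σ σ' : AState} (h : Agree p.wr p.wa σ σ') (hp : p.wa = []) :
    σ'.mem = σ.mem := funext fun a => h.2 a (by simp [hp])

/-- The contents of the registers `2` to `5` during a query. -/
structure QReg (L lam : ℕ) (σ : AState) : Prop where
  r2 : σ.reg 2 = lam
  r3 : σ.reg 3 = L
  r4 : σ.reg 4 = 1
  r5 : σ.reg 5 = 0

theorem QReg.agree {σ σ' : AState} (h : QReg L lam σ) {rs as : List ℕ}
    (ha : Agree rs as σ σ') (hr : ∀ r < 6, r ∉ rs) : QReg L lam σ' :=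
  ⟨(ha.1 2 (hr 2 (by norm_num))).trans h.r2, (ha.1 3 (hr 3 (by norm_num))).trans h.r3,
    (ha.1 4 (hr 4 (by norm_num))).trans h.r4, (ha.1 5 (hr 5 (by norm_num))).trans h.r5⟩

/-! ### Rank and selection in a stored column -/

/-- Load the pointer to column `reg x` of structure `d` into register `65`. -/
def baseCode (d x : ℕ) : Stmt :=
  block [.load 34 d x, .load 35 (d + 1) x, .op .pair 65 34 35]

theorem baseCode_spec {σ : AState} {d x c base : ℕ} (hx : x ≠ 34) (hc : σ.reg x = c)
    (hcH : c < H * 2 ^ w) (hb : base < 2 ^ w * 2 ^ w) (hptr : PtrAt w d c base σ) :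
    Post w H (baseCode d x) σ 4 (fun σ' => σ'.reg 65 = base) := by
  have hbase1 : base / 2 ^ w < 2 ^ w := Nat.div_lt_of_lt_mul hb
  have hbase2 : base % 2 ^ w < 2 ^ w := Nat.mod_lt _ (by positivity)
  have hbase : base / 2 ^ w * 2 ^ w + base % 2 ^ w = base := by
    rw [mul_comm]; exact Nat.div_add_mod _ _
  refine Post.wp (by simp [baseCode, block, Stmt.size]) ?_
  simp only [baseCode, block, wp, AOp.Valid, AOp.val, AState.set_reg, AState.set_mem,
    Nat.reduceEqDiff, reduceIte, hx, hc, hptr.1, hptr.2, forall_eq]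
  exact ⟨hcH, hcH, ⟨hbase1, hbase2⟩, hbase⟩

/-- The rank query at position `reg 66` in column `reg x` of structure `d`. -/
def colRank (d x : ℕ) : Stmt := .seq (baseCode d x) (rankCode (d + 2) (d + 3))

theorem colRank_spec (hp : Par w H m n₀ L lam) {σ : AState} (hq : QReg L lam σ)
    (ht : PopTab L (σ.mem 1)) {d x c n u al i : ℕ} {X : ℕ → ℕ} (hx : x ≠ 34) (hc : σ.reg x = c)
    (hcH : c < H * 2 ^ w) (hal : al ≤ H * 2 ^ w) (hal' : al < 2 ^ w * 2 ^ w)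
    (hcol : HasCol w L d c n X u al σ) (hi : σ.reg 66 = i) (hin : i ≤ n) (hn : n ≤ m) :
    Post w H (colRank d x) σ 16 (fun σ' => σ'.reg 64 = cnt (colP n X u) i) := by
  obtain ⟨base, h1, h2, h3⟩ := hcol
  have hmw := hp.hmw
  have hil : i / L ≤ n / L := Nat.div_le_div_right hin
  have hb : base < al := (Nat.le_add_right _ _).trans_lt h1
  refine Post.seq (T₁ := 4) (T₂ := 12) (baseCode_spec hx hc hcH (by omega) h2) ?_
  rintro σ₁ k1 ag₁
  replace ag₁ : Agree [34, 35, 65] [] σ σ₁ := ag₁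
  have hq₁ := hq.agree ag₁ (by decide)
  refine rank_spec hp hq₁.r2 hq₁.r3 hq₁.r4 (P := colP n X u) ?_ k1 ((ag₁.1 66 (by decide)).trans hi)
    (by omega) (by omega) (by omega) ?_ ?_
  · rw [ag₁.2 1 (by simp)]; exact ht
  · rw [ag₁.2 _ (by simp)]; exact h3.word _ (by omega)
  · rw [ag₁.2 _ (by simp)]; exact h3.rank _ (by omega)

/-- The selection query in column `reg x` of structure `d`: the position, in register `68`, of the
one bit number `reg 67` (counted from one). -/
def colSelect (d x : ℕ) : Stmt :=
  .seq (baseCode d x) (.seq (.op .mov 66 67 67) (.seq (rankCode (d + 5) (d + 6))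
    (block [.op .sub 69 64 4, .op .add 69 65 69, .load 70 (d + 4) 69, .op .add 71 65 70,
      .load 72 (d + 2) 71, .load 73 (d + 3) 71, .op .sub 74 67 4, .op .sub 74 74 73,
      .op .shl 75 72 2, .op .add 75 75 74, .load 76 2 75, .op .shl 77 70 2, .op .add 68 77 76])))

/-- A rank in the mark vector at `r` counts the starts among the first `r` one bits. Less one, it is
the index of the row in the list of nonempty rows. What remains of `r` after the rank of the row is
looked up in the selection table. -/
theorem colSelect_spec (hp : Par w H m n₀ L lam) {σ : AState} (hq : QReg L lam σ)
    (ht : PopTab L (σ.mem 1)) (hs : SelTab L (σ.mem 2)) {d x c n u al p r : ℕ} {X : ℕ → ℕ}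
    (hx : x ≠ 34) (hc : σ.reg x = c)
    (hcH : c < H * 2 ^ w) (hal : al ≤ H * 2 ^ w) (hal' : al < 2 ^ w * 2 ^ w)
    (hcol : HasCol w L d c n X u al σ) (hr : σ.reg 67 = r) (hn : n ≤ m)
    (hpc : colP n X u p) (hcp : cnt (colP n X u) p + 1 = r) :
    Post w H (colSelect d x) σ 31 (fun σ' => σ'.reg 68 = p) := by
  obtain ⟨base, h1, h2, h3⟩ := hcol
  have hmw := hp.hmw
  have hH := hp.le_H
  have h4 := hp.four_le
  have hlam := hp.lam_lt
  have hL2 := hp.L_lt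
  have hLm := hp.hLm
  have hpow := hp.pow_le
  have hpos := hp.pos
  have hsupp : ∀ p, colP n X u p → p < n := fun p h => h.1
  have hpn := hpc.1
  have hdm : p / L * L + p % L = p := by rw [mul_comm]; exact Nat.div_add_mod p L
  have hmod := Nat.mod_lt p hpos
  have hpl : p / L ≤ n / L := Nat.div_le_div_right hpn.le
  have hrow := h3.select_row hpos hsupp hpc
  generalize hP : colP n X u = P at *
  have hpn1 : p < (n / L + 1) * L := by
    have := Nat.div_add_mod n L
    have := Nat.mod_lt n hpos
    rw [add_mul, one_mul, mul_comm]; omega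
  have htot : r ≤ cnt P ((n / L + 1) * L) := by rw [← hcp]; exact cnt_lt_cnt hpc hpn1
  have htotn : cnt P ((n / L + 1) * L) ≤ n := cnt_le_of_support hsupp
  have hrl : r / L ≤ cnt P ((n / L + 1) * L) / L := Nat.div_le_div_right htot
  have hrl' : r / L ≤ n / L := hrl.trans (Nat.div_le_div_right htotn)
  have e1 : cnt P (p / L * L) ≤ cnt P p := cnt_mono (by omega)
  have e2 : cnt P p < cnt P ((p / L + 1) * L) := cnt_lt_cnt hpc (by rw [add_mul]; omega)
  have hstart : cnt (Start L P) r = cnt (NER L P) (p / L) + 1 :=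
    cnt_start_of_mem (by omega) (by omega)
  have hner : cnt (NER L P) (p / L) ≤ p / L := cnt_le
  rw [hcp, hstart, Nat.add_sub_cancel] at hrow
  have hw1 := h3.word (p / L) (by omega)
  have hr1 := h3.rank (p / L) (by omega)
  have hbit : (σ.mem (d + 2) (base + p / L)).testBit (p % L) = true := by
    rw [hw1.2 _ hmod, hdm]; exact hpc
  have hcb := hw1.cnt_bits hmod.le
  rw [hdm] at hcb
  have hsel := hs _ hw1.1 _ hmod hbit
  have hcbl : cnt (fun k => (σ.mem (d + 2) (base + p / L)).testBit k = true) (p % L) ≤ p % L :=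
    cnt_le
  refine Post.mono (T := 4 + (1 + (12 + 14))) (Post.seq (T₁ := 4)
    (baseCode_spec hx hc hcH (by omega) h2) ?_) le_rfl (fun _ h => h)
  rintro σ₁ k1 ag₁
  replace ag₁ : Agree [34, 35, 65] [] σ σ₁ := ag₁
  have hq₁ := hq.agree ag₁ (by decide)
  refine Post.seq (T₁ := 1) (Q₁ := fun σ' => σ'.reg 66 = r) (Post.wp (by decide) ?_) ?_
  · simp only [wp, AOp.Valid, AOp.val, AState.set_reg, reduceIte, true_and, forall_eq,
      ag₁.1 67 (by decide), hr]
  rintro σ₂ k2 ag₂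
  replace ag₂ : Agree [66] [] σ₁ σ₂ := ag₂
  have hq₂ := hq₁.agree ag₂ (by decide)
  have hm₂ : ∀ a, σ₂.mem a = σ.mem a := fun a => by rw [ag₂.2 a (by simp), ag₁.2 a (by simp)]
  -- Stored marks cover only numbers below the total; up to `r`, which is at most the total, this
  -- restriction has no effect.
  refine Post.seq (rank_spec hp hq₂.r2 hq₂.r3 hq₂.r4
    (P := fun r => Start L P r ∧ r < cnt P ((n / L + 1) * L)) ?_ ((ag₂.1 65 (by decide)).trans k1)
    k2 (by omega) (by omega) (by omega) ?_ ?_) ?_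
  · rw [hm₂]; exact ht
  · rw [hm₂]; exact h3.mark _ hrl
  · rw [hm₂, h3.markRank _ hrl]
    have := Nat.div_mul_le_self r L
    exact cnt_congr fun i hi => ⟨fun h => ⟨h, by omega⟩, fun h => h.1⟩
  rintro σ₃ k3 ag₃
  replace ag₃ : Agree [60, 60, 61, 62, 63, 63, 63, 63, 62, 62, 64] [] σ₂ σ₃ := ag₃
  have hq₃ := hq₂.agree ag₃ (by decide)
  have hm₃ : ∀ a, σ₃.mem a = σ.mem a := fun a => by rw [ag₃.2 a (by simp), hm₂]
  have h65 : σ₃.reg 65 = base := by rw [ag₃.1 65 (by decide), ag₂.1 65 (by decide), k1]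
  have h67 : σ₃.reg 67 = r := by
    rw [ag₃.1 67 (by decide), ag₂.1 67 (by decide), ag₁.1 67 (by decide), hr]
  have h64 : σ₃.reg 64 = cnt (NER L P) (p / L) + 1 := by
    rw [k3, ← hstart]
    exact cnt_congr fun i hi => ⟨fun h => h.1, fun h => ⟨h, by omega⟩⟩
  have hyL : σ.mem (d + 2) (base + p / L) * L + L ≤ m := by
    have := Nat.mul_le_mul_left L (show σ.mem (d + 2) (base + p / L) + 1 ≤ 2 ^ L from hw1.1)
    rw [mul_add, mul_one, mul_comm L] at this
    omega
  have hw1lt := hw1.1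
  have hplp := Nat.div_le_self p L
  refine Post.wp (by simp [block, Stmt.size]) ?_
  simp only [block, wp, AOp.Valid, AOp.val, AState.set_reg, AState.set_mem,
    Nat.reduceEqDiff, reduceIte, true_and, hq₃.r2, hq₃.r4, hm₃, h65, h67, h64, forall_eq,
    Nat.add_sub_cancel, hrow, hr1, ← hp.hL]
  have ht' : r - 1 - cnt P (p / L * L) =
      cnt (fun k => (σ.mem (d + 2) (base + p / L)).testBit k = true) (p % L) := by omega
  rw [ht', hsel]
  exact ⟨by omega, by omega, by omega, by omega, by omega, by omega, by omega, by omega, by omega,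
    by omega, hdm⟩

/-! ### The class of the query threshold -/

/-- Load the constants for the queries, and the class of the threshold `reg 0` into register
`31`. -/
def queryInit : Stmt :=
  .seq (block [.const 4 1, .const 5 0, .load 2 12 5, .op .shl 3 4 2, .load 6 13 5, .load 7 14 5,
    .op .lt 30 6 0])
    (.ite 30 (.op .mov 31 7 7) (.seq (block [.op .mov 65 5 5, .op .mov 66 0 0])
      (.seq (rankCode 3 4) (.op .mov 31 64 64))))

/-- A threshold that does not occur as a value still has a rank in the value set, and this rank
separates the elements correctly. A threshold above the maximum would lie outside the stored set and
gets class `D`, larger than all others. -/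
theorem queryInit_spec (hp : Par w H m n₀ L lam) {α : ℕ → ℕ} {M D : ℕ} {σ : AState}
    (h : Prepared w H n₀ L lam α M D σ) {v : ℕ} (h0 : σ.reg 0 = v) :
    Post w H queryInit σ 30 (fun σ' => QReg L lam σ' ∧ σ'.reg 7 = D ∧ σ'.mem = σ.mem ∧
      σ'.reg 1 = σ.reg 1 ∧ ∀ i < n₀, v ≤ α i ↔ σ'.reg 31 ≤ cls α n₀ i) := by
  have hw := hp.hw
  have hmw := hp.hmw
  have hH := hp.le_H
  have h4 := hp.four_le
  have hlam := hp.lam_lt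
  have hL2 := hp.L_lt
  have hMw := h.hMw
  suffices hs : Post w H queryInit σ (8 + ((3 + (12 + 1)) + 1)) (fun σ' => QReg L lam σ' ∧
      σ'.reg 7 = D ∧ ∀ i < n₀, v ≤ α i ↔ σ'.reg 31 ≤ cls α n₀ i) by
    refine hs.with_agree.mono (by norm_num) ?_
    rintro σ' ⟨⟨q1, q2, q3⟩, ag⟩
    exact ⟨q1, q2, ag.mem_eq (by decide), ag.1 1 (by decide), q3⟩
  refine Post.seq (T₁ := 8) (Q₁ := fun σ' => QReg L lam σ' ∧ σ'.reg 7 = D ∧ σ'.reg 0 = v ∧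
    σ'.reg 30 = (if M < v then 1 else 0) ∧ σ'.mem = σ.mem) (Post.wp (by decide) ?_) ?_
  · simp only [block, wp, AOp.Valid, AOp.val, AState.set_reg, AState.set_mem,
      Nat.reduceEqDiff, reduceIte, true_and, and_true, h.cell12, h.cell13, h.cell14, forall_eq, h0,
      one_mul, ← hp.hL]
    refine ⟨by omega, by omega, by omega, by omega, by omega, by omega, ?_⟩
    constructor <;> simp
  rintro σ₁ ⟨hq₁, k7, k0, k30, km⟩ -
  have hP₁ := h.of_mem km
  refine Post.ite (fun hne => ?_) (fun he => ?_)
  · have hv : M < v := by by_contra hc; rw [if_neg hc] at k30; exact hne k30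
    refine Post.wp (by decide) ?_
    simp only [wp, AOp.Valid, AOp.val, AState.set_reg, AState.set_mem,
      Nat.reduceEqDiff, reduceIte, true_and, forall_eq, k7]
    refine ⟨?_, fun i hi => ?_⟩
    · constructor <;> simp [hq₁.r2, hq₁.r3, hq₁.r4, hq₁.r5]
    · have := cls_lt hp.pos h.hα h.hD hi
      have := h.hα i hi
      omega
  · have hv : v ≤ M := by by_contra hc; rw [if_pos (by omega)] at k30; omega
    have hvl : v / L ≤ M / L := Nat.div_le_div_right hv
    have hml : M / L ≤ M := Nat.div_le_self _ _
    refine Post.seq (T₁ := 3) (Q₁ := fun σ' => σ'.reg 65 = 0 ∧ σ'.reg 66 = v)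
      (Post.wp (by decide) ?_) ?_
    · simp only [block, wp, AOp.Valid, AOp.val, AState.set_reg, AState.set_mem,
        Nat.reduceEqDiff, reduceIte, true_and, and_true, forall_eq, k0, hq₁.r5]
    rintro σ₂ ⟨k65, k66⟩ ag₂
    have hq₂ := hq₁.agree ag₂ (by decide)
    have hm₂ := ag₂.mem_eq (by decide)
    refine Post.seq (T₂ := 1) (rank_spec hp hq₂.r2 hq₂.r3 hq₂.r4 (P := IsVal α n₀) ?_ k65 k66 (by omega)
      (by omega) (by omega) ?_ ?_) ?_
    · rw [hm₂]; exact hP₁.pop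
    · rw [hm₂, zero_add]; exact hP₁.bits _ hvl
    · rw [hm₂, zero_add]; exact hP₁.ranks _ hvl
    rintro σ₃ k64 ag₃
    have hq₃ := hq₂.agree ag₃ (by decide)
    have h7 : σ₃.reg 7 = D := by rw [ag₃.1 7 (by decide), ag₂.1 7 (by decide), k7]
    refine Post.wp (by decide) ?_
    simp only [wp, AOp.Valid, AOp.val, AState.set_reg, AState.set_mem,
      Nat.reduceEqDiff, reduceIte, true_and, forall_eq, k64, h7]
    refine ⟨?_, fun i hi => (cnt_isVal_le_iff hi).symm⟩
    constructor <;> simp [hq₃.r2, hq₃.r3, hq₃.r4, hq₃.r5]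

/-! ### Composition of level columns and class columns -/

theorem cnt_baseCol (hL : 0 < L) {a : ℕ → ℕ} {c j : ℕ} (hj : j ≤ n₀) :
    cnt (colP n₀ (fun i => lev L (a i)) (lev L c)) j = cnt (fun i => low L c ≤ a i) j := by
  rw [cnt_colP hj]
  exact cnt_congr fun i _ => lev_le_iff hL

/-- A rank in the level column is a prefix length of the subsequence, which is where `Filt.cnt_eq`
continues the count. -/
theorem cnt_levCol (hL : 0 < L) {a Y : ℕ → ℕ} {n c j : ℕ} (hf : Filt a n₀ (low L c) n Y)
    (hj : j ≤ n₀) : cnt (colP n Y (c - low L c)) (cnt (fun i => low L c ≤ a i) j) =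
      cnt (fun i => c ≤ a i) j := by
  rw [cnt_colP (by rw [hf.len]; exact cnt_mono hj), ← hf.cnt_eq _ hj,
    Nat.add_sub_cancel' (low_le hL)]

/-- The range counting query. -/
def countProg : Stmt :=
  .seq queryInit (.seq (.op .lt 32 31 7) (.ite 32
    (.seq (block [.load 33 6 31, .op .mov 66 1 1]) (.seq (colRank 20 33)
      (.seq (block [.op .mov 66 64 64, .op .lt 36 31 3])
        (.seq (.ite 36 .skip (colRank 30 31)) (.op .mov 0 64 64)))))
    (.const 0 0)))

theorem count_spec (hp : Par w H m n₀ L lam) {α : ℕ → ℕ} {M D : ℕ} {σ : AState}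
    (h : Prepared w H n₀ L lam α M D σ) {v j : ℕ} (h0 : σ.reg 0 = v) (h1 : σ.reg 1 = j)
    (hj : j ≤ n₀) :
    Post w H countProg σ 80 (fun σ' => σ'.reg 0 = cnt (fun i => v ≤ α i) j) := by
  have hw := hp.hw
  have hmw := hp.hmw
  have hH := hp.le_H
  have h4 := hp.four_le
  have hpos := hp.pos
  have hn := hp.hn
  refine Post.mono (T := 30 + (1 + ((3 + (16 + (3 + ((16 + 1) + 1)))) + 1)))
    (Post.seq (queryInit_spec hp h h0) ?_) (by norm_num) (fun _ h => h)
  rintro σ₁ ⟨hq₁, k7, km, k1, kc⟩ -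
  rw [h1] at k1
  have hP₁ := h.of_mem km
  obtain ⟨c, hc⟩ : ∃ c, σ₁.reg 31 = c := ⟨_, rfl⟩
  rw [hc] at kc
  have hcnt : cnt (fun i => v ≤ α i) j = cnt (fun i => c ≤ cls α n₀ i) j :=
    cnt_congr fun i hi => kc i (by omega)
  rw [hcnt]
  refine Post.seq (T₁ := 1) (Q₁ := fun σ' => σ'.reg 32 = if c < D then 1 else 0)
    (Post.wp (by decide) ?_) ?_
  · simp only [wp, AOp.Valid, AOp.val, AState.set_reg, reduceIte, true_and, forall_eq, hc, k7]
  rintro σ₂ k32 ag₂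
  have hq₂ := hq₁.agree ag₂ (by decide)
  have hP₂ := hP₁.of_mem (ag₂.mem_eq (by decide))
  have hc₂ : σ₂.reg 31 = c := (ag₂.1 31 (by decide)).trans hc
  refine Post.ite (fun hne => ?_) (fun he => ?_)
  swap
  · have hcD : D ≤ c := by by_contra hc; rw [if_pos (by omega)] at k32; omega
    refine Post.mono (T := 1) (Post.wp (by decide) ?_) (by norm_num) (fun _ h => h)
    simp only [wp, AState.set_reg, reduceIte]
    refine ⟨by omega, (cnt_eq_zero fun i hi => ?_).symm⟩
    have := cls_lt hpos h.hα h.hD (show i < n₀ by omega)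
    omega
  have hcD : c < D := by by_contra hc; rw [if_neg hc] at k32; exact hne k32
  have hDm : D ≤ m := by rw [h.hD]; exact (cnt_isVal_le α n₀ _).trans hn
  have hlevc := lev_le hpos (c := c)
  refine Post.seq (T₁ := 3) (Q₁ := fun σ' => σ'.reg 33 = lev L c ∧ σ'.reg 66 = j)
    (Post.wp (by decide) ?_) ?_
  · simp only [block, wp, AOp.Valid, AOp.val, AState.set_reg, AState.set_mem, reduceIte, true_and,
      forall_eq, hc₂, Nat.reduceEqDiff, hP₂.levels c hcD, ag₂.1 1 (by decide), k1, and_true]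
    omega
  rintro σ₃ ⟨k33, k66⟩ ag₃
  have hq₃ := hq₂.agree ag₃ (by decide)
  have hP₃ := hP₂.of_mem (ag₃.mem_eq (by decide))
  obtain ⟨al, a1, a2, a3⟩ := hP₃.baseCol c hcD
  refine Post.seq (T₂ := 3 + ((16 + 1) + 1)) (colRank_spec hp hq₃ hP₃.pop (by decide) k33 (by omega) a1 a2 a3 k66 hj hn) ?_
  rintro σ₄ k64 ag₄
  rw [cnt_baseCol hpos hj] at k64
  have hq₄ := hq₃.agree ag₄ (by decide)
  have hP₄ := hP₃.of_mem (ag₄.mem_eq (by decide))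
  have hc₄ : σ₄.reg 31 = c := by rw [ag₄.1 31 (by decide), ag₃.1 31 (by decide), hc₂]
  refine Post.seq (T₁ := 3) (Q₁ := fun σ' => σ'.reg 66 = cnt (fun i => low L c ≤ cls α n₀ i) j ∧
    σ'.reg 64 = cnt (fun i => low L c ≤ cls α n₀ i) j ∧
    σ'.reg 36 = if c < L then 1 else 0) (Post.wp (by decide) ?_) ?_
  · simp only [block, wp, AOp.Valid, AOp.val, AState.set_reg, AState.set_mem, reduceIte, true_and,
      forall_eq, hc₄, Nat.reduceEqDiff, k64, hq₄.r3, and_true]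
  rintro σ₅ ⟨k66, k64, k36⟩ ag₅
  have hq₅ := hq₄.agree ag₅ (by decide)
  have hP₅ := hP₄.of_mem (ag₅.mem_eq (by decide))
  have hc₅ : σ₅.reg 31 = c := (ag₅.1 31 (by decide)).trans hc₄
  refine Post.seq (T₁ := 16 + 1) (T₂ := 1) (Q₁ := fun σ' => σ'.reg 64 =
    cnt (fun i => c ≤ cls α n₀ i) j) (Post.ite (fun hne => ?_) (fun he => ?_)) ?_
  -- For a class below `L` the level is the class, so the first rank is already the answer.
  · have hcL : c < L := by by_contra hc; rw [if_neg hc] at k36; exact hne k36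
    refine Post.mono (T := 1) (Post.wp (by decide) ?_) (by norm_num) (fun _ h => h)
    rw [low_of_lt hcL] at k64
    exact k64
  · have hcL : L ≤ c := by by_contra hc; rw [if_pos (by omega)] at k36; omega
    obtain ⟨al, a1, a2, n, Y, a3, a4⟩ := hP₅.levCol c hcL hcD
    refine (colRank_spec hp hq₅ hP₅.pop (by decide) hc₅ (by omega) a1 a2 a4 k66 ?_
      (a3.le_length.trans hn)).mono le_rfl fun σ' h => h.trans (cnt_levCol hpos a3 hj)
    rw [a3.len]; exact cnt_mono hj
  · rintro σ₆ k64 -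
    refine Post.wp (by decide) ?_
    simp only [wp, AOp.Valid, AOp.val, AState.set_reg, reduceIte, true_and, forall_eq, k64]

/-- The range selection query. -/
def selectProg : Stmt :=
  .seq queryInit (.seq (block [.op .mov 67 1 1, .op .lt 36 31 3])
    (.seq (.ite 36 .skip (.seq (colSelect 30 31) (.op .add 67 68 4)))
      (.seq (.load 33 6 31) (.seq (colSelect 20 33) (.op .add 0 68 4)))))

/-- The two ranks of counting are inverted in the opposite order: selection in the class column
gives a place in the subsequence, and selection in the level column turns this place into a position
of the array. -/
theorem select_spec (hp : Par w H m n₀ L lam) {α : ℕ → ℕ} {M D : ℕ} {σ : AState}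
    (h : Prepared w H n₀ L lam α M D σ) {v r i : ℕ} (h0 : σ.reg 0 = v) (h1 : σ.reg 1 = r)
    (hi : i < n₀) (hvi : v ≤ α i) (hr : cnt (fun i => v ≤ α i) i + 1 = r) :
    Post w H selectProg σ 110 (fun σ' => σ'.reg 0 = i + 1) := by
  have hw := hp.hw
  have hmw := hp.hmw
  have hH := hp.le_H
  have h4 := hp.four_le
  have hpos := hp.pos
  have hn := hp.hn
  refine Post.mono (T := 30 + (3 + (((31 + 1) + 1) + (1 + (31 + 1)))))
    (Post.seq (queryInit_spec hp h h0) ?_) (by norm_num) (fun _ h => h)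
  rintro σ₁ ⟨hq₁, k7, km, k1, kc⟩ -
  rw [h1] at k1
  have hP₁ := h.of_mem km
  obtain ⟨c, hc⟩ : ∃ c, σ₁.reg 31 = c := ⟨_, rfl⟩
  rw [hc] at kc
  have hcnt : cnt (fun i => v ≤ α i) i = cnt (fun i => c ≤ cls α n₀ i) i :=
    cnt_congr fun k hk => kc k (by omega)
  rw [hcnt] at hr
  have hci := (kc i hi).1 hvi
  have hcD : c < D := hci.trans_lt (cls_lt hpos h.hα h.hD hi)
  have hDm : D ≤ m := by rw [h.hD]; exact (cnt_isVal_le α n₀ _).trans hn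
  have hlevc := lev_le hpos (c := c)
  have hlow := low_le hpos (c := c)
  have hlowi : low L c ≤ cls α n₀ i := hlow.trans hci
  refine Post.seq (T₁ := 3) (Q₁ := fun σ' => σ'.reg 67 = r ∧ σ'.reg 36 = if c < L then 1 else 0)
    (Post.wp (by decide) ?_) ?_
  · simp only [block, wp, AOp.Valid, AOp.val, AState.set_reg, AState.set_mem, reduceIte, true_and,
      forall_eq, hc, Nat.reduceEqDiff, k1, hq₁.r3, and_true]
  rintro σ₂ ⟨k67, k36⟩ ag₂
  have hq₂ := hq₁.agree ag₂ (by decide)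
  have hP₂ := hP₁.of_mem (ag₂.mem_eq (by decide))
  have hc₂ : σ₂.reg 31 = c := (ag₂.1 31 (by decide)).trans hc
  refine Post.seq (T₁ := (31 + 1) + 1) (Q₁ := fun σ' => σ'.reg 67 =
    cnt (fun i => low L c ≤ cls α n₀ i) i + 1) (Post.ite (fun hne => ?_) (fun he => ?_)) ?_
  · have hcL : c < L := by by_contra hc; rw [if_neg hc] at k36; exact hne k36
    refine Post.mono (T := 1) (Post.wp (by decide) ?_) (by norm_num) (fun _ h => h)
    rw [low_of_lt hcL, hr]
    exact k67
  · have hcL : L ≤ c := by by_contra hc; rw [if_pos (by omega)] at k36; omega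
    obtain ⟨al, a1, a2, n, Y, a3, a4⟩ := hP₂.levCol c hcL hcD
    have hval := a3.val i hi hlowi
    refine Post.seq (colSelect_spec hp hq₂ hP₂.pop hP₂.sel (by decide) hc₂ (by omega) a1 a2 a4 k67
      (a3.le_length.trans hn) (p := cnt (fun i => low L c ≤ cls α n₀ i) i) ⟨?_, by omega⟩ ?_) ?_
    · rw [a3.len]; exact cnt_lt_cnt hlowi hi
    · rw [cnt_levCol hpos a3 hi.le]; exact hr
    rintro σ₃ k68 ag₃
    have hq₃ := hq₂.agree ag₃ (by decide)
    have hle : cnt (fun i => low L c ≤ cls α n₀ i) i ≤ i := cnt_le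
    refine Post.wp (by decide) ?_
    simp only [wp, AOp.Valid, AOp.val, AState.set_reg, reduceIte, true_and, forall_eq, k68, hq₃.r4,
      and_true]
    omega
  rintro σ₃ k67 ag₃
  have hq₃ := hq₂.agree ag₃ (by decide)
  have hP₃ := hP₂.of_mem (ag₃.mem_eq (by decide))
  have hc₃ : σ₃.reg 31 = c := (ag₃.1 31 (by decide)).trans hc₂
  refine Post.seq (T₁ := 1) (Q₁ := fun σ' => σ'.reg 33 = lev L c) (Post.wp (by decide) ?_) ?_
  · simp only [wp, AState.set_reg, reduceIte, forall_eq, hc₃, hP₃.levels c hcD, and_true]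
    omega
  rintro σ₄ k33 ag₄
  have hq₄ := hq₃.agree ag₄ (by decide)
  have hP₄ := hP₃.of_mem (ag₄.mem_eq (by decide))
  obtain ⟨al, a1, a2, a3⟩ := hP₄.baseCol c hcD
  refine Post.seq (colSelect_spec hp hq₄ hP₄.pop hP₄.sel (by decide) k33 (by omega) a1 a2 a3
    ((ag₄.1 67 (by decide)).trans k67) hn (p := i) ⟨hi, (lev_le_iff hpos).2 hlowi⟩
    (by rw [cnt_baseCol hpos hi.le])) ?_
  rintro σ₅ k68 ag₅
  have hq₅ := hq₄.agree ag₅ (by decide)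
  refine Post.wp (by decide) ?_
  simp only [wp, AOp.Valid, AOp.val, AState.set_reg, reduceIte, true_and, forall_eq, k68, hq₅.r4,
    and_true]
  omega

end PagedRAM

/-! ## The programs for the word RAM -/

namespace PagedRAM

open WordRAM

/-- Run `p` with the arguments in registers `0` and `1` and the result in register `0`. -/
def entry (H : ℕ) (p : Stmt) : Program :=
  .seq (seqs [.op .bor 10 0 0, .const 11 0, .op .bor 12 1 1, .const 13 0])
    (.seq (p.compile H) (.op .bor 0 10 10))

/-- The paged memory `μ` is prescribed only on actual addresses. This lets a query start from the
very memory function that the preprocessing left, values outside included. -/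
theorem entry_exec {w H : ℕ} (hw : 2 ≤ w) (hH : 1 ≤ H) {p : Stmt} {s : State w} {x y T : ℕ}
    {μ : ℕ → ℕ → ℕ} {Q : AState → Prop}
    (hμ : ∀ a z, z < H * 2 ^ w →
      μ a z = (s.mem (a * H + z / 2 ^ w) (BitVec.ofNat w (z % 2 ^ w))).toNat)
    (hx : (s.reg 0).toNat = x) (hy : (s.reg 1).toNat = y)
    (hp : ∀ σ : AState, σ.reg 0 = x → σ.reg 1 = y → σ.mem = μ → Post w H p σ T Q) :
    ∃ t s' σ', Exec (entry H p) s t s' ∧ t ≤ 6 + (30 + 2 * H) * T ∧ Q σ' ∧ Rel H s' σ' ∧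
      s'.reg 0 = s'.reg 10 ∧ (p.wa = [] → s'.mem = s.mem) := by
  have h1 := exec_seqs [.op .bor 10 0 0, .const 11 0, .op .bor 12 1 1, .const 13 0] (by decide) s
  have hm := foldl_primStep_mem [.op .bor 10 0 0, .const 11 0, .op .bor 12 1 1, .const 13 0] s
  generalize hs₁ : List.foldl primStep s
    [.op .bor 10 0 0, .const 11 0, .op .bor 12 1 1, .const 13 0] = s₁ at h1 hm
  have hr : (s₁.reg 10 = s.reg 0 ∧ s₁.reg 11 = 0) ∧ s₁.reg 12 = s.reg 1 ∧ s₁.reg 13 = 0 := by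
    rw [← hs₁]
    simp [primStep, setReg_reg, Op.eval]
  obtain ⟨t, σ', h2, h3, h4⟩ := hp
    ⟨fun r => (s₁.reg (2 * r + 11)).toNat * 2 ^ w + (s₁.reg (2 * r + 10)).toNat, μ⟩
    (by simp [hr.1.1, hr.1.2, hx]) (by simp [hr.2.1, hr.2.2, hy]) rfl
  obtain ⟨t', s₂, h5, h6, h7, h8⟩ := compile_correct hw hH h2 s₁
    ⟨fun r => rfl, fun a z hz => by rw [hm]; exact hμ a z hz⟩
  refine ⟨_, _, σ', h1.seq (h5.seq (Exec.op _ _ _ _ _)), ?_, h4, ⟨fun r => ?_, h7.2⟩, ?_,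
    fun h => (h8 h).trans hm⟩
  · have := h6.trans (Nat.mul_le_mul_left (30 + 2 * H) h3)
    simp only [List.length_cons, List.length_nil]
    omega
  · rw [h7.1 r]; simp [setReg_reg]
  · simp [setReg_reg, Op.eval]

/-- Registers that hold one word. -/
theorem Rel.reg_zero {w H v : ℕ} {s : State w} {σ : AState} (h : Rel H s σ) (hv : σ.reg 0 = v)
    (hvw : v < 2 ^ w) : (s.reg 10).toNat = v := by
  have h0 := h.1 0
  rw [hv] at h0
  simp only [mul_zero, zero_add] at h0
  have : (s.reg 11).toNat = 0 := by
    by_contra hc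
    have := Nat.le_mul_of_pos_left (2 ^ w) (Nat.pos_of_ne_zero hc)
    omega
  rw [this] at h0
  omega

/-- From `m < 2 ^ (4 * L)` follows log m ≤ 4 L, and the real constant is rounded up; this is the
source of `E = 4 * ⌈C⌉₊`. -/
theorem sum_le_of_logb {C : ℝ} {m m' L : ℕ} {A : ℕ → ℕ} (hm : 2 ≤ m) (hL : m < 2 ^ (4 * L))
    (hA : (∑ i ∈ Finset.Icc 1 m', (A i : ℝ)) ≤ C * (m * Real.logb 2 m)) :
    ∑ i ∈ Finset.range m', A (i + 1) ≤ 4 * ⌈C⌉₊ * m * L := by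
  have hm0 : (0 : ℝ) < m := by exact_mod_cast (show 0 < m by omega)
  have hlog0 : 0 ≤ Real.logb 2 m := Real.logb_nonneg (by norm_num) (by exact_mod_cast (by omega))
  have hlog : Real.logb 2 m ≤ 4 * L := by
    rw [Real.logb_le_iff_le_rpow (by norm_num) hm0]
    have h : ((4 * L : ℕ) : ℝ) = 4 * L := by push_cast; ring
    rw [← h, Real.rpow_natCast]
    exact_mod_cast hL.le
  have hsum : ∑ i ∈ Finset.range m', A (i + 1) = ∑ i ∈ Finset.Icc 1 m', A i := by
    rw [Finset.range_eq_Ico, Finset.sum_Ico_add' A 0 m' 1]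
    rfl
  have : (∑ i ∈ Finset.Icc 1 m', (A i : ℝ)) ≤ ⌈C⌉₊ * (m * (4 * L)) :=
    calc _ ≤ C * (m * Real.logb 2 m) := hA
      _ ≤ ⌈C⌉₊ * (m * Real.logb 2 m) := by
        exact mul_le_mul_of_nonneg_right (Nat.le_ceil C) (by positivity)
      _ ≤ _ := by gcongr
  rw [hsum]
  have h2 : ((∑ i ∈ Finset.Icc 1 m', A i : ℕ) : ℝ) ≤ ((4 * ⌈C⌉₊ * m * L : ℕ) : ℝ) := by
    push_cast
    linarith
  exact_mod_cast h2

end PagedRAM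

open PagedRAM in
theorem mainTheorem7 (C : ℝ) :
    ∃ (prep count select : WordRAM.Program) (K : ℝ),
      ∀ (w m m' : ℕ) (A : ℕ → ℕ), 2 ≤ m → m' ≤ m → m < 2 ^ w →
        (∀ i ∈ Finset.Icc 1 m', A i < 2 ^ w) →
        (∑ i ∈ Finset.Icc 1 m', (A i : ℝ)) ≤ C * (m * Real.logb 2 m) →
        ∀ s : WordRAM.State w, IsInput s m m' A →
          ∃ (t : ℕ) (s₁ : WordRAM.State w), WordRAM.Exec prep s t s₁ ∧ (t : ℝ) ≤ K * m ∧
            (∀ v j : ℕ, v < 2 ^ w → j ≤ m' →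
              Answers count s₁.mem v j (rcount A v j)
                (K * (1 + Real.logb 2 (Real.logb 2 m)))) ∧
            (∀ v r : ℕ, v < 2 ^ w → 1 ≤ r → r ≤ rcount A v m' →
              Answers select s₁.mem v r (rselect A m' v r) K) := by
  obtain ⟨E, hE⟩ : ∃ E, E = 4 * ⌈C⌉₊ := ⟨_, rfl⟩
  -- Enough pages for both the `2 * E + 1` of the interval levels and the `10` of the level columns.
  obtain ⟨H, hH⟩ : ∃ H, H = 2 * E + 10 := ⟨_, rfl⟩
  obtain ⟨K, hK⟩ : ∃ K, K = 6 + (30 + 2 * H) * (5000 * (E + 1)) := ⟨_, rfl⟩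
  refine ⟨entry H prepProg, entry H countProg, entry H selectProg, K, ?_⟩
  rintro w m m' A hm hm' hmw hAw hA s ⟨hs0, hs1, hsA⟩
  have hw : 2 ≤ w := by
    by_contra hc
    have : 2 ^ w ≤ 2 ^ 1 := Nat.pow_le_pow_right (by norm_num) (by omega)
    omega
  have hpow : 0 < 2 ^ w := by positivity
  have hHw : 2 ^ w ≤ H * 2 ^ w := Nat.le_mul_of_pos_left _ (by omega)
  have hαw : ∀ i < m', A (i + 1) < 2 ^ w := fun i hi => hAw _ (by simp; omega)
  obtain ⟨t, s₁, σ₁, hex, ht, ⟨L, lam, M, D, hp, hprep⟩, hrel, -, -⟩ :=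
    entry_exec (H := H) (p := prepProg) (T := 5000 * (E + 1) * m) hw (by omega) (s := s)
      (μ := fun a z => (s.mem (a * H + z / 2 ^ w) (BitVec.ofNat w (z % 2 ^ w))).toNat)
      (fun a z _ => rfl) hs0 hs1 (fun σ h0 h1 hμ => prep_spec hw hm hmw hm' (E := E) (by omega) h0 h1
        (α := fun i => A (i + 1)) (fun i hi => by
          -- Input addresses lie on page `0`, and array `0` starts at bank `0`, so the input is
          -- found where the paged program expects it.
          have h2 : i + 1 < 2 ^ w := by omega
          simp only [hμ, zero_mul, zero_add, Nat.div_eq_of_lt h2, Nat.mod_eq_of_lt h2]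
          exact hsA _ (by omega) (by omega)) hαw
        (fun L hL => by rw [hE]; exact sum_le_of_logb hm hL hA))
  have hKT : ∀ T, T ≤ 5000 * (E + 1) → 6 + (30 + 2 * H) * T ≤ K := fun T hT => by
    rw [hK]; exact Nat.add_le_add_left (Nat.mul_le_mul_left _ hT) _
  refine ⟨t, s₁, hex, ?_, fun v j hv hj => ?_, fun v r hv hr1 hr2 => ?_⟩
  · have : t ≤ K * m := ht.trans (by rw [hK]; nlinarith)
    exact_mod_cast this
  · intro s' hs'm hv0 hj1
    obtain ⟨t', s₂, σ₂, hex', ht', hans, hrel', h010, hmem⟩ :=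
      entry_exec (H := H) (p := countProg) (T := 80) hw (by omega) (s := s') (μ := σ₁.mem)
        (fun a z hz => by rw [hs'm]; exact hrel.2 a z hz) hv0 hj1
        (fun σ h0 h1 hμ => count_spec hp (hprep.of_mem hμ) h0 h1 hj)
    refine ⟨t', s₂, hex', ?_, ?_, (hmem (by decide)).trans hs'm⟩
    · have h1 : t' ≤ K := ht'.trans (hKT 80 (by omega))
      have h2 : (t' : ℝ) ≤ K := by exact_mod_cast h1
      have h3 : 1 ≤ Real.logb 2 m := by
        rw [Real.le_logb_iff_rpow_le (by norm_num) (by exact_mod_cast (show 0 < m by omega)),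
          Real.rpow_one]
        exact_mod_cast hm
      -- As log m ≥ 1, the iterated logarithm is nonnegative, and the constant bound `K` already
      -- suffices.
      have h4 : 0 ≤ Real.logb 2 (Real.logb 2 m) := Real.logb_nonneg (by norm_num) h3
      have h5 : (0 : ℝ) ≤ K := Nat.cast_nonneg K
      nlinarith
    · rw [h010, rcount_eq]
      refine hrel'.reg_zero hans ?_
      have : cnt (fun i => v ≤ A (i + 1)) j ≤ j := cnt_le
      omega
  · intro s' hs'm hv0 hr0
    rw [rcount_eq] at hr2
    obtain ⟨i, hi, hvi, hci⟩ := exists_of_lt_cnt (show r - 1 < cnt (fun i => v ≤ A (i + 1)) m' by omega)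
    obtain ⟨t', s₂, σ₂, hex', ht', hans, hrel', h010, hmem⟩ :=
      entry_exec (H := H) (p := selectProg) (T := 110) hw (by omega) (s := s') (μ := σ₁.mem)
        (fun a z hz => by rw [hs'm]; exact hrel.2 a z hz) hv0 hr0
        (fun σ h0 h1 hμ => select_spec hp (hprep.of_mem hμ) h0 h1 hi hvi (by rw [hci]; omega))
    refine ⟨t', s₂, hex', ?_, ?_, (hmem (by decide)).trans hs'm⟩
    · have h1 : t' ≤ K := ht'.trans (hKT 110 (by omega))
      exact_mod_cast h1
    · rw [h010, rselect_eq hi hvi hci]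
      exact hrel'.reg_zero hans (by omega)
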